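/- Let $X$ be a smooth manifold of dimension $d\ge 0$ (Hausdorff, second countable, without boundary, possibly disconnected or non-compact). All vector bundles below are smooth real vector bundles over $X$ of constant finite rank with a smooth Euclidean metric $\langle\ ,\ \rangle$, and all connections are smooth metric connections, i.e. $d\langle s,t\rangle=\langle\nabla s,t\rangle+\langle s,\nabla t\rangle$. **Chern–Simons equivalence.** For a metric connection $\nabla$ with curvature $R^\nabla$, its Pontryagin character form is $$Ph(\nabla)=\sum_{k\ge 0}\frac{(-1)^k}{(2\pi)^{2k}(2k)!}\,\mathrm{tr}\big((R^\nabla)^{2k}\big)\in\bigoplus_{k\ge0}\Omega^{4k}(X),$$ the Chern character form of the complexified connection. A smooth path $\gamma=(\nabla^t)_{t\in[0,1]}$ of metric connections on $V$ defines the connection $\widetilde\nabla=dt\wedge\partial_t+\nabla^t$ on the pullback of $V$ to $[0,1]\times X$, and $$cs(\gamma)=\int_0^1\iota_{\partial_t}Ph(\widetilde\nabla)\,dt\in\bigoplus_{k\ge1}\Omega^{4k-1}(X).$$ Modulo exact forms, $cs(\gamma)$ depends only on $\nabla^0$ and $\nabla^1$. Two metric connections $\nabla^0,\nabla^1$ on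 $V$ are Chern–Simons equivalent if $cs(\gamma)$ is exact for a smooth path $\gamma$ of metric connections from $\nabla^0$ to $\nabla^1$; write $\{\nabla\}$ for the class of $\nabla$. **Structured bundles.** A structured bundle over $X$ is a pair $\mathcal V=[V,\{\nabla\}]$ consisting of a Euclidean vector bundle $V\to X$ and a Chern–Simons equivalence class $\{\nabla\}$ of metric connections on $V$. An isomorphism $[V,\{\nabla^V\}]\cong[W,\{\nabla^W\}]$ is a smooth bundle isometry $\sigma:V\to W$ over $\mathrm{id}_X$ with $\sigma^*\{\nabla^W\}=\{\nabla^V\}$. The direct sum is $[V,\{\nabla^V\}]\oplus[W,\{\nabla^W\}]=[V\oplus W,\{\nabla^V\oplus\nabla^W\}]$, with the orthogonal sum metric. For $n\ge 0$, $[n]$ denotes $[X\times\mathbb R^n,\{d\}]$, the product bundle with its standard metric and the class of the product connection $d$. **Theorem 2.6.** For every structured bundle $\mathcal V$ over $X$ there are a structured bundle $\mathcal W$ over $X$ and an integer $n\ge 0$ such that $$\mathcal V\oplus\mathcal W\cong[n].$$ -/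

import Mathlib

open Bundle Set Manifold ContDiff

universe u v w

set_option linter.unusedSectionVars false

namespace StructKO

noncomputable section




section Forms
variable {d : ℕ} {X : Type*} [TopologicalSpace X] [ChartedSpace (EuclideanSpace ℝ (Fin d)) X]

/-- The pullback of an `n`-form `η` on `X` under the inverse of the preferred chart at `c`, as a map
from the model space into alternating maps. -/
def formInChart {n : ℕ} (η : (x : X) → TangentSpace (𝓡 d) x [⋀^Fin n]→L[ℝ] ℝ) (c : X)
    (y : EuclideanSpace ℝ (Fin d)) : EuclideanSpace ℝ (Fin d) [⋀^Fin n]→L[ℝ] ℝ :=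
  (η ((extChartAt (𝓡 d) c).symm y)).compContinuousLinearMap
    (mfderiv 𝓘(ℝ, EuclideanSpace ℝ (Fin d)) (𝓡 d) (extChartAt (𝓡 d) c).symm y)

/-- A (possibly discontinuous) field of alternating `n`-linear maps is a smooth differential form
if its coordinate expressions are smooth in all the preferred charts, which form an atlas. -/
def IsSmoothForm {n : ℕ} (η : (x : X) → TangentSpace (𝓡 d) x [⋀^Fin n]→L[ℝ] ℝ) : Prop :=
  ∀ c : X, ContDiffOn ℝ ∞ (formInChart η c) (extChartAt (𝓡 d) c).target

/-- `θ = dη` for some smooth form `η`. The exterior derivative of `η` is computed in the preferred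
charts, which cover `X`, by Mathlib's `extDeriv`, whose convention is
`dη(v₀, …, vₙ) = ∑ᵢ (-1)ⁱ D_{vᵢ} η (…, v̂ᵢ, …)`. The field `θ` is given by its values on tuples of
tangent vectors. -/
def IsExactForm {n : ℕ} (θ : (x : X) → (Fin (n + 1) → TangentSpace (𝓡 d) x) → ℝ) : Prop :=
  ∃ η : (x : X) → TangentSpace (𝓡 d) x [⋀^Fin n]→L[ℝ] ℝ, IsSmoothForm η ∧
    ∀ c : X, ∀ y ∈ (extChartAt (𝓡 d) c).target, ∀ v : Fin (n + 1) → EuclideanSpace ℝ (Fin d),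
      extDeriv (formInChart η c) y v =
        θ ((extChartAt (𝓡 d) c).symm y) (fun i =>
          mfderiv 𝓘(ℝ, EuclideanSpace ℝ (Fin d)) (𝓡 d) (extChartAt (𝓡 d) c).symm y (v i))
end Forms

section Algebra

/-- The form `tr(B ∧ ⋯ ∧ B)` (`m` factors) of a `2`-form `B` with values in endomorphisms, evaluated
on `2 m` vectors:
`2⁻ᵐ ∑_σ sgn(σ) tr (B(v_{σ 0}, v_{σ 1}) ∘ ⋯ ∘ B(v_{σ (2m-2)}, v_{σ (2m-1)}))`. -/
def tracePow {T V : Type*} [AddCommGroup V] [Module ℝ V] (m : ℕ)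
    (B : T → T → Module.End ℝ V) (v : Fin (2 * m) → T) : ℝ :=
  (1 / 2 ^ m : ℝ) * ∑ σ : Equiv.Perm (Fin (2 * m)), ((Equiv.Perm.sign σ : ℤ) : ℝ) *
    LinearMap.trace ℝ V (List.ofFn fun j : Fin m =>
      B (v (σ ⟨2 * j, by omega⟩)) (v (σ ⟨2 * j + 1, by omega⟩))).prod

/-- The degree `4 k` component of the Pontryagin character form with curvature `B`, that is, of
`tr exp (i B / 2π)`, the Chern character form of the complexified connection:
`(-1)ᵏ / ((2π)²ᵏ (2k)!) tr B²ᵏ`. The components in degrees `4 k + 2` vanish for metric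
connections, since `B` is skew-adjoint. -/
def phForm {T V : Type*} [AddCommGroup V] [Module ℝ V] (k : ℕ)
    (B : T → T → Module.End ℝ V) (v : Fin (2 * (2 * k)) → T) : ℝ :=
  (-1) ^ k / ((2 * Real.pi) ^ (2 * k) * (2 * k).factorial) * tracePow (2 * k) B v
end Algebra

/-- A smooth real vector bundle of finite rank over `X` (fibres `V x`, model fibre `F`) with a smooth
fibrewise inner product. -/
structure EuclideanBundle (d : ℕ) (X : Type*) [TopologicalSpace X]
    [ChartedSpace (EuclideanSpace ℝ (Fin d)) X] [IsManifold (𝓡 d) ∞ X] where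
  F : Type v
  V : X → Type v
  [normedF : NormedAddCommGroup F]
  [normedSpaceF : NormedSpace ℝ F]
  [finiteF : FiniteDimensional ℝ F]
  [topTotal : TopologicalSpace (TotalSpace F V)]
  [addV : ∀ x, AddCommGroup (V x)]
  [moduleV : ∀ x, Module ℝ (V x)]
  [topV : ∀ x, TopologicalSpace (V x)]
  [topAddV : ∀ x, IsTopologicalAddGroup (V x)]
  [topSMulV : ∀ x, ContinuousSMul ℝ (V x)]
  [fiberBundle : FiberBundle F V]
  [vectorBundle : VectorBundle ℝ F V]
  [smoothBundle : ContMDiffVectorBundle ∞ F V (𝓡 d)]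
  metric : ContMDiffRiemannianMetric (𝓡 d) ∞ F V

attribute [instance] EuclideanBundle.normedF EuclideanBundle.normedSpaceF EuclideanBundle.finiteF
  EuclideanBundle.topTotal EuclideanBundle.addV EuclideanBundle.moduleV EuclideanBundle.topV
  EuclideanBundle.topAddV EuclideanBundle.topSMulV EuclideanBundle.fiberBundle
  EuclideanBundle.vectorBundle EuclideanBundle.smoothBundle

variable {d : ℕ} {X : Type*} [TopologicalSpace X] [ChartedSpace (EuclideanSpace ℝ (Fin d)) X]
  [IsManifold (𝓡 d) ∞ X]

/-- Smooth sections of a bundle. -/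
def EuclideanBundle.SmoothSection (B : EuclideanBundle d X) (s : (x : X) → B.V x) : Prop :=
  ContMDiff (𝓡 d) ((𝓡 d).prod 𝓘(ℝ, B.F)) ∞ (fun x => TotalSpace.mk' B.F x (s x))

/-- A metric connection: a smooth covariant derivative `∇` (it maps smooth sections `s` to smooth
sections `∇ s` of `Hom(TX, V)`) such that `d⟨s, t⟩ = ⟨∇ s, t⟩ + ⟨s, ∇ t⟩`.
The values `∇ s x` are only constrained for sections `s` differentiable at `x`. -/
structure MetricConnection (B : EuclideanBundle d X) where
  cov : CovariantDerivative (𝓡 d) B.F B.V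
  smooth : cov.ContMDiffCovariantDerivative ∞
  metric : ∀ (x : X) (s t : (x : X) → B.V x),
    MDifferentiableAt (𝓡 d) ((𝓡 d).prod 𝓘(ℝ, B.F)) (fun y => TotalSpace.mk' B.F y (s y)) x →
    MDifferentiableAt (𝓡 d) ((𝓡 d).prod 𝓘(ℝ, B.F)) (fun y => TotalSpace.mk' B.F y (t y)) x →
    ∀ v : TangentSpace (𝓡 d) x,
      mvfderiv (𝓡 d) (fun y => B.metric.inner y (s y) (t y)) x v =
        B.metric.inner x (cov s x v) (t x) + B.metric.inner x (s x) (cov t x v)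


/-- A section which is smooth on a neighbourhood of `x`. -/
def EuclideanBundle.SmoothNear (B : EuclideanBundle d X) (s : (x : X) → B.V x) (x : X) : Prop :=
  ∃ U ∈ nhds x,
    ContMDiffOn (𝓡 d) ((𝓡 d).prod 𝓘(ℝ, B.F)) ∞ (fun y => TotalSpace.mk' B.F y (s y)) U

lemma EuclideanBundle.SmoothNear.eventually {B : EuclideanBundle d X} {s : (x : X) → B.V x} {x : X}
    (h : B.SmoothNear s x) : ∀ᶠ y in nhds x,
      MDifferentiableAt (𝓡 d) ((𝓡 d).prod 𝓘(ℝ, B.F)) (fun y => TotalSpace.mk' B.F y (s y)) y := by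
  obtain ⟨U, hU, hs⟩ := h
  filter_upwards [eventually_mem_nhds_iff.2 hU] with y hy
  exact (hs.contMDiffAt hy).mdifferentiableAt (by simp)

lemma EuclideanBundle.SmoothNear.congr {B : EuclideanBundle d X} {s s' : (x : X) → B.V x} {x : X}
    (h : B.SmoothNear s' x) (hss : ∀ᶠ y in nhds x, s y = s' y) : B.SmoothNear s x := by
  obtain ⟨U, hU, hs⟩ := h
  refine ⟨U ∩ {y | s y = s' y}, Filter.inter_mem hU hss, ?_⟩
  exact (hs.mono inter_subset_left).congr fun y hy => by rw [hy.2]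

lemma EuclideanBundle.SmoothNear.add {B : EuclideanBundle d X} {s s' : (x : X) → B.V x} {x : X}
    (h : B.SmoothNear s x) (h' : B.SmoothNear s' x) : B.SmoothNear (s + s') x := by
  obtain ⟨U, hU, hs⟩ := h
  obtain ⟨U', hU', hs'⟩ := h'
  exact ⟨U ∩ U', Filter.inter_mem hU hU',
    (hs.mono inter_subset_left).add_section (hs'.mono inter_subset_right)⟩

lemma EuclideanBundle.SmoothNear.smul {B : EuclideanBundle d X} {s : (x : X) → B.V x} {x : X}
    (h : B.SmoothNear s x) (a : ℝ) : B.SmoothNear (a • s) x := by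
  obtain ⟨U, hU, hs⟩ := h
  exact ⟨U, hU, hs.const_smul_section⟩

lemma EuclideanBundle.smoothNear_extend (B : EuclideanBundle d X) {x : X} (u : B.V x) :
    B.SmoothNear (FiberBundle.extend B.F u) x :=
  FiberBundle.exists_contMDiffOn_extend (k := ∞) (𝓡 d) B.F u

lemma MetricConnection.cov_eventuallyEq {B : EuclideanBundle d X} (D : MetricConnection B)
    {s s' : (x : X) → B.V x} {x : X} (h : B.SmoothNear s' x)
    (hss : ∀ᶠ y in nhds x, s y = s' y) : ∀ᶠ y in nhds x, D.cov s y = D.cov s' y := by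
  filter_upwards [h.eventually, (h.congr hss).eventually, hss.eventually_nhds] with y h1 h2 h3
  exact D.cov.isCovariantDerivativeOnUniv.congr_of_eventuallyEq h2 h1 Filter.univ_mem h3

lemma exists_smooth_cutoff [T2Space X] (B : EuclideanBundle d X) {s : (x : X) → B.V x}
    {x : X} (h : B.SmoothNear s x) :
    ∃ s' : (x : X) → B.V x, B.SmoothSection s' ∧ ∀ᶠ y in nhds x, s' y = s y := by
  obtain ⟨U, hU, hs⟩ := h
  obtain ⟨O, hOU, hO, hxO⟩ := mem_nhds_iff.1 hU
  obtain ⟨f, hf⟩ := ((SmoothBumpFunction.nhds_basis_tsupport (I := 𝓡 d) x).mem_iff).1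
    (hO.mem_nhds hxO)
  refine ⟨fun y => f y • s y, ?_, ?_⟩
  · exact ContMDiffOn.smul_section_of_tsupport (ψ := f) (f.contMDiff.contMDiffOn) hO hf.2
      (hs.mono hOU)
  · filter_upwards [f.eventuallyEq_one] with y hy
    simp [hy]

lemma MetricConnection.mdifferentiableAt_cov_apply [T2Space X] {B : EuclideanBundle d X}
    (D : MetricConnection B) {s : (x : X) → B.V x} {x : X} (h : B.SmoothNear s x)
    (w : TangentSpace (𝓡 d) x) :
    MDifferentiableAt (𝓡 d) ((𝓡 d).prod 𝓘(ℝ, B.F))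
      (fun y => TotalSpace.mk' B.F y (D.cov s y
        (FiberBundle.extend (EuclideanSpace ℝ (Fin d)) w y))) x := by
  obtain ⟨s', hs', h'⟩ := exists_smooth_cutoff B h
  have h1 := ((D.smooth.contMDiff.contMDiff (σ := s') (by exact hs'.contMDiffOn)).contMDiffAt
    Filter.univ_mem (x := x)).mdifferentiableAt (by simp)
  have h2 := h1.clm_bundle_apply (FiberBundle.mdifferentiableAt_extend (𝓡 d) _ w)
  refine h2.congr_of_eventuallyEq ?_
  filter_upwards [D.cov_eventuallyEq h h'] with y hy
  rw [hy]

/-- The second covariant derivative expression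
`∇_v ∇_W s - ∇_w ∇_V s - ∇_[V, W] s` at `x`, where `V`, `W` are the vector fields with constant
coefficients in the preferred chart at `x` that extend `v`, `w`. -/
def MetricConnection.curvatureAux {B : EuclideanBundle d X}
    (D : MetricConnection B) (x : X) (v w : TangentSpace (𝓡 d) x) (s : (x : X) → B.V x) : B.V x :=
  let V := FiberBundle.extend (EuclideanSpace ℝ (Fin d)) v
  let W := FiberBundle.extend (EuclideanSpace ℝ (Fin d)) w
  D.cov (fun y => D.cov s y (W y)) x v - D.cov (fun y => D.cov s y (V y)) x w
    - D.cov s x (VectorField.mlieBracket (𝓡 d) V W x)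

lemma MetricConnection.curvatureAux_congr [T2Space X] {B : EuclideanBundle d X}
    (D : MetricConnection B) {x : X} (v w : TangentSpace (𝓡 d) x) {s s' : (x : X) → B.V x}
    (h : B.SmoothNear s' x) (hss : ∀ᶠ y in nhds x, s y = s' y) :
    D.curvatureAux x v w s = D.curvatureAux x v w s' := by
  have e := D.cov_eventuallyEq h hss
  have key : ∀ z : TangentSpace (𝓡 d) x,
      D.cov (fun y => D.cov s y (FiberBundle.extend (EuclideanSpace ℝ (Fin d)) z y)) x =
      D.cov (fun y => D.cov s' y (FiberBundle.extend (EuclideanSpace ℝ (Fin d)) z y)) x := by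
    intro z
    refine D.cov.isCovariantDerivativeOnUniv.congr_of_eventuallyEq
      (D.mdifferentiableAt_cov_apply (h.congr hss) z) (D.mdifferentiableAt_cov_apply h z)
      Filter.univ_mem ?_
    filter_upwards [e] with y hy
    rw [hy]
  simp only [curvatureAux, key, e.self_of_nhds]

lemma MetricConnection.curvatureAux_add [T2Space X] {B : EuclideanBundle d X}
    (D : MetricConnection B) {x : X} (v w : TangentSpace (𝓡 d) x) {s s' : (x : X) → B.V x}
    (h : B.SmoothNear s x) (h' : B.SmoothNear s' x) :
    D.curvatureAux x v w (s + s') = D.curvatureAux x v w s + D.curvatureAux x v w s' := by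
  have key : ∀ z : TangentSpace (𝓡 d) x,
      D.cov (fun y => D.cov (s + s') y (FiberBundle.extend (EuclideanSpace ℝ (Fin d)) z y)) x =
      D.cov (fun y => D.cov s y (FiberBundle.extend (EuclideanSpace ℝ (Fin d)) z y)) x +
      D.cov (fun y => D.cov s' y (FiberBundle.extend (EuclideanSpace ℝ (Fin d)) z y)) x := by
    intro z
    have h1 := D.mdifferentiableAt_cov_apply h z
    have h2 := D.mdifferentiableAt_cov_apply h' z
    rw [← D.cov.isCovariantDerivativeOnUniv.add h1 h2]
    refine D.cov.isCovariantDerivativeOnUniv.congr_of_eventuallyEq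
      (D.mdifferentiableAt_cov_apply (h.add h') z)
      (mdifferentiableAt_add_section h1 h2) Filter.univ_mem ?_
    filter_upwards [h.eventually, h'.eventually] with y hy hy'
    rw [D.cov.isCovariantDerivativeOnUniv.add hy hy']
    rfl
  simp only [curvatureAux, key, D.cov.isCovariantDerivativeOnUniv.add h.eventually.self_of_nhds
    h'.eventually.self_of_nhds, add_apply]
  abel

lemma MetricConnection.curvatureAux_smul [T2Space X] {B : EuclideanBundle d X}
    (D : MetricConnection B) {x : X} (v w : TangentSpace (𝓡 d) x) (a : ℝ) {s : (x : X) → B.V x}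
    (h : B.SmoothNear s x) :
    D.curvatureAux x v w (a • s) = a • D.curvatureAux x v w s := by
  have key : ∀ z : TangentSpace (𝓡 d) x,
      D.cov (fun y => D.cov (a • s) y (FiberBundle.extend (EuclideanSpace ℝ (Fin d)) z y)) x =
      a • D.cov (fun y => D.cov s y (FiberBundle.extend (EuclideanSpace ℝ (Fin d)) z y)) x := by
    intro z
    have h1 := D.mdifferentiableAt_cov_apply h z
    rw [← D.cov.isCovariantDerivativeOnUniv.smul_const a h1]
    refine D.cov.isCovariantDerivativeOnUniv.congr_of_eventuallyEq
      (D.mdifferentiableAt_cov_apply (h.smul a) z) h1.smul_const_section Filter.univ_mem ?_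
    filter_upwards [h.eventually] with y hy
    rw [D.cov.isCovariantDerivativeOnUniv.smul_const a hy]
    rfl
  simp only [curvatureAux, key, D.cov.isCovariantDerivativeOnUniv.smul_const a
    h.eventually.self_of_nhds, smul_apply, smul_sub]

lemma extend_add_eventually (B : EuclideanBundle d X) (x : X) (u u' : B.V x) :
    ∀ᶠ y in nhds x, FiberBundle.extend B.F (u + u') y =
      (FiberBundle.extend B.F u + FiberBundle.extend B.F u' : (y : X) → B.V y) y := by
  have hx := FiberBundle.mem_baseSet_trivializationAt' (F := B.F) (E := B.V) x
  filter_upwards [(trivializationAt B.F B.V x).open_baseSet.mem_nhds hx] with y hy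
  simp only [FiberBundle.extend, Pi.add_apply]
  rw [((trivializationAt B.F B.V x).linear ℝ hx).map_add, ← Trivialization.coe_symmₗ (R := ℝ) (hb := hy)]
  exact map_add _ _ _

lemma extend_smul_eventually (B : EuclideanBundle d X) (x : X) (a : ℝ) (u : B.V x) :
    ∀ᶠ y in nhds x, FiberBundle.extend B.F (a • u) y =
      (a • FiberBundle.extend B.F u : (y : X) → B.V y) y := by
  have hx := FiberBundle.mem_baseSet_trivializationAt' (F := B.F) (E := B.V) x
  filter_upwards [(trivializationAt B.F B.V x).open_baseSet.mem_nhds hx] with y hy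
  simp only [FiberBundle.extend, Pi.smul_apply]
  rw [((trivializationAt B.F B.V x).linear ℝ hx).map_smul, ← Trivialization.coe_symmₗ (R := ℝ) (hb := hy)]
  exact map_smul _ _ _

/-- The curvature `R(v, w)` of a connection, as an endomorphism of the fibre `V x`:
`R(v, w) u = ∇_v ∇_W s - ∇_w ∇_V s - ∇_[V, W] s` for the extensions `V`, `W`, `s` of `v`, `w`, `u`
with constant coefficients in the preferred trivializations at `x`. By tensoriality the value does
not depend on the choice of the extensions. -/
def MetricConnection.curvature [T2Space X] {B : EuclideanBundle d X}
    (D : MetricConnection B) (x : X) (v w : TangentSpace (𝓡 d) x) : Module.End ℝ (B.V x) where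
  toFun u := D.curvatureAux x v w (FiberBundle.extend B.F u)
  map_add' u u' := by
    rw [D.curvatureAux_congr v w ((B.smoothNear_extend u).add (B.smoothNear_extend u'))
      (extend_add_eventually B x u u'),
      D.curvatureAux_add v w (B.smoothNear_extend u) (B.smoothNear_extend u')]
  map_smul' a u := by
    rw [D.curvatureAux_congr v w ((B.smoothNear_extend u).smul a)
      (extend_smul_eventually B x a u), D.curvatureAux_smul v w a (B.smoothNear_extend u)]
    rfl

/-- A smooth path `γ(t)`, `t ∈ [0, 1]`, of metric connections from `D₀` to `D₁`. For every smooth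
section `s`, `(t, x) ↦ (∇_t s)(x)` is smooth on `[0, 1] × X`. The field `velocity` is the derivative
of the path, a `1`-form with values in endomorphisms; for `t ∈ [0, 1]` it is determined by the path,
and the values of `conn` and `velocity` for `t ∉ [0, 1]` are irrelevant. -/
structure ConnectionPath [T2Space X] {B : EuclideanBundle d X} (D₀ D₁ : MetricConnection B) where
  conn : ℝ → MetricConnection B
  conn_zero : conn 0 = D₀
  conn_one : conn 1 = D₁
  smooth : ∀ s : (x : X) → B.V x, B.SmoothSection s →
    ContMDiffOn (𝓘(ℝ, ℝ).prod (𝓡 d)) ((𝓡 d).prod 𝓘(ℝ, EuclideanSpace ℝ (Fin d) →L[ℝ] B.F)) ∞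
      (fun p : ℝ × X => TotalSpace.mk' (EuclideanSpace ℝ (Fin d) →L[ℝ] B.F)
        (E := fun y : X => TangentSpace (𝓡 d) y →L[ℝ] B.V y) p.2 ((conn p.1).cov s p.2))
      (Icc 0 1 ×ˢ univ)
  velocity : ℝ → (x : X) → TangentSpace (𝓡 d) x → Module.End ℝ (B.V x)
  hasDerivWithinAt : ∀ t ∈ Icc (0 : ℝ) 1, ∀ s : (x : X) → B.V x, B.SmoothSection s →
    ∀ (x : X) (v : TangentSpace (𝓡 d) x),
      HasDerivWithinAt (fun τ => (conn τ).cov s x v) (velocity t x v (s x)) (Icc 0 1) t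

/-- The curvature at `(t, x)` of the connection `∇̃ = dt ∧ ∂_t + ∇_t` that the path defines on the
pullback of the bundle to `[0, 1] × X`, namely `R_t + dt ∧ (d/dt) ∇_t`, evaluated on two tangent
vectors `a = (a.1 ∂_t, a.2)` and `b = (b.1 ∂_t, b.2)`. -/
def ConnectionPath.totalCurvature [T2Space X] {B : EuclideanBundle d X} {D₀ D₁ : MetricConnection B}
    (γ : ConnectionPath D₀ D₁) (t : ℝ) (x : X) (a b : ℝ × TangentSpace (𝓡 d) x) :
    Module.End ℝ (B.V x) :=
  (γ.conn t).curvature x a.2 b.2 + a.1 • γ.velocity t x b.2 - b.1 • γ.velocity t x a.2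

/-- The degree `4 k + 3` component of the Chern-Simons form of a path of metric connections:
`cs(γ) = ∫₀¹ ι_{∂_t} Ph(∇̃) dt`, where `Ph(∇̃)` is the Pontryagin character form of the connection
`∇̃` on `[0, 1] × X`. -/
def ConnectionPath.csForm [T2Space X] {B : EuclideanBundle d X} {D₀ D₁ : MetricConnection B}
    (γ : ConnectionPath D₀ D₁) (k : ℕ) (x : X)
    (v : Fin (2 * (2 * k + 1) + 1) → TangentSpace (𝓡 d) x) : ℝ :=
  ∫ t in (0 : ℝ)..1, phForm (k + 1) (γ.totalCurvature t x)
    (Fin.cons (1, 0) fun i => (0, v i))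

/-- Two metric connections are Chern-Simons equivalent if the Chern-Simons form of a smooth path
between them is exact, which for a form of mixed degree means that each homogeneous component is.
The class of the form modulo exact forms is the same for all paths between the two connections. -/
def CSEquiv [T2Space X] {B : EuclideanBundle d X} (D₀ D₁ : MetricConnection B) : Prop :=
  ∃ γ : ConnectionPath D₀ D₁, ∀ k : ℕ, IsExactForm (γ.csForm k)



section Prod
variable (A : EuclideanBundle.{v} d X) (B : EuclideanBundle.{w} d X)

lemma prod_trivializationAt (x : X) (y : X) (u : A.V y) (u' : B.V y) :
    (trivializationAt (A.F × B.F) (A.V ×ᵇ B.V) x ⟨y, (u, u')⟩).2 =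
      ((trivializationAt A.F A.V x ⟨y, u⟩).2, (trivializationAt B.F B.V x ⟨y, u'⟩).2) := rfl

lemma prod_symm (x : X) {y : X} (hA : y ∈ (trivializationAt A.F A.V x).baseSet)
    (hB : y ∈ (trivializationAt B.F B.V x).baseSet) (p : A.F × B.F) :
    ((trivializationAt A.F A.V x).prod (trivializationAt B.F B.V x)).symm y p =
      ((trivializationAt A.F A.V x).symm y p.1, (trivializationAt B.F B.V x).symm y p.2) := by
  have h : p = (((trivializationAt A.F A.V x).prod (trivializationAt B.F B.V x))
      ⟨y, ((trivializationAt A.F A.V x).symm y p.1, (trivializationAt B.F B.V x).symm y p.2)⟩).2 := by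
    refine Prod.ext ?_ ?_
    · change p.1 = ((trivializationAt A.F A.V x) ⟨y, _⟩).2
      rw [Trivialization.apply_mk_symm _ hA]
    · change p.2 = ((trivializationAt B.F B.V x) ⟨y, _⟩).2
      rw [Trivialization.apply_mk_symm _ hB]
  conv_lhs => rw [h]
  have hAB : y ∈ ((trivializationAt A.F A.V x).prod (trivializationAt B.F B.V x)).baseSet :=
    ⟨hA, hB⟩
  exact Trivialization.symm_apply_apply_mk _ hAB _

lemma contMDiffWithinAt_prod_section {n : WithTop ℕ∞} {s : (x : X) → A.V x} {s' : (x : X) → B.V x}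
    {U : Set X} {x : X} :
    ContMDiffWithinAt (𝓡 d) ((𝓡 d).prod 𝓘(ℝ, A.F × B.F)) n
      (fun y => TotalSpace.mk' (A.F × B.F) (E := A.V ×ᵇ B.V) y (s y, s' y)) U x ↔
    ContMDiffWithinAt (𝓡 d) ((𝓡 d).prod 𝓘(ℝ, A.F)) n (fun y => TotalSpace.mk' A.F y (s y)) U x ∧
    ContMDiffWithinAt (𝓡 d) ((𝓡 d).prod 𝓘(ℝ, B.F)) n (fun y => TotalSpace.mk' B.F y (s' y)) U x := by
  simp only [contMDiffWithinAt_totalSpace, prod_trivializationAt, contMDiffWithinAt_prod_module_iff]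
  tauto

lemma mdifferentiableAt_prod_section {s : (x : X) → A.V x} {s' : (x : X) → B.V x} {x : X} :
    MDifferentiableAt (𝓡 d) ((𝓡 d).prod 𝓘(ℝ, A.F × B.F))
      (fun y => TotalSpace.mk' (A.F × B.F) (E := A.V ×ᵇ B.V) y (s y, s' y)) x ↔
    MDifferentiableAt (𝓡 d) ((𝓡 d).prod 𝓘(ℝ, A.F)) (fun y => TotalSpace.mk' A.F y (s y)) x ∧
    MDifferentiableAt (𝓡 d) ((𝓡 d).prod 𝓘(ℝ, B.F)) (fun y => TotalSpace.mk' B.F y (s' y)) x := by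
  simp only [mdifferentiableAt_totalSpace, prod_trivializationAt,
    mdifferentiableAt_prod_module_iff]
  tauto

lemma contMDiffWithinAt_prod_hom {E' H' M : Type*} [NormedAddCommGroup E'] [NormedSpace ℝ E']
    [TopologicalSpace H'] (I' : ModelWithCorners ℝ E' H') [TopologicalSpace M] [ChartedSpace H' M]
    {n : WithTop ℕ∞} {b : M → X} {U : Set M} {m : M}
    {f : (m : M) → TangentSpace (𝓡 d) (b m) →L[ℝ] A.V (b m)}
    {g : (m : M) → TangentSpace (𝓡 d) (b m) →L[ℝ] B.V (b m)}
    (hf : ContMDiffWithinAt I' ((𝓡 d).prod 𝓘(ℝ, EuclideanSpace ℝ (Fin d) →L[ℝ] A.F)) n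
      (fun m => TotalSpace.mk' (EuclideanSpace ℝ (Fin d) →L[ℝ] A.F)
        (E := fun y : X => TangentSpace (𝓡 d) y →L[ℝ] A.V y) (b m) (f m)) U m)
    (hg : ContMDiffWithinAt I' ((𝓡 d).prod 𝓘(ℝ, EuclideanSpace ℝ (Fin d) →L[ℝ] B.F)) n
      (fun m => TotalSpace.mk' (EuclideanSpace ℝ (Fin d) →L[ℝ] B.F)
        (E := fun y : X => TangentSpace (𝓡 d) y →L[ℝ] B.V y) (b m) (g m)) U m) :
    ContMDiffWithinAt I' ((𝓡 d).prod 𝓘(ℝ, EuclideanSpace ℝ (Fin d) →L[ℝ] (A.F × B.F))) n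
      (fun m => TotalSpace.mk' (EuclideanSpace ℝ (Fin d) →L[ℝ] (A.F × B.F))
        (E := fun y : X => TangentSpace (𝓡 d) y →L[ℝ] (A.V ×ᵇ B.V) y) (b m) ((f m).prod (g m))) U m := by
  rw [contMDiffWithinAt_hom_bundle] at hf hg ⊢
  refine ⟨hf.1, ?_⟩
  have h1 := ContMDiffWithinAt.clm_comp (I := I') (n := n) (s := U) (x := m)
    (g := fun _ => ContinuousLinearMap.inl ℝ A.F B.F) contMDiffWithinAt_const hf.2
  have h2 := ContMDiffWithinAt.clm_comp (I := I') (n := n) (s := U) (x := m)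
    (g := fun _ => ContinuousLinearMap.inr ℝ A.F B.F) contMDiffWithinAt_const hg.2
  have key : ∀ y : M, b y ∈ (trivializationAt A.F A.V (b m)).baseSet →
      b y ∈ (trivializationAt B.F B.V (b m)).baseSet →
      ContinuousLinearMap.inCoordinates (EuclideanSpace ℝ (Fin d)) (TangentSpace (𝓡 d) (M := X))
        (A.F × B.F) (A.V ×ᵇ B.V) (b m) (b y) (b m) (b y) ((f y).prod (g y)) =
      (ContinuousLinearMap.inl ℝ A.F B.F).comp (ContinuousLinearMap.inCoordinates
        (EuclideanSpace ℝ (Fin d)) (TangentSpace (𝓡 d) (M := X)) A.F A.V (b m) (b y) (b m) (b y)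
          (f y)) +
      (ContinuousLinearMap.inr ℝ A.F B.F).comp (ContinuousLinearMap.inCoordinates
        (EuclideanSpace ℝ (Fin d)) (TangentSpace (𝓡 d) (M := X)) B.F B.V (b m) (b y) (b m) (b y)
          (g y)) := by
    intro y hA hB
    have hAB : b y ∈ (trivializationAt (A.F × B.F) (A.V ×ᵇ B.V) (b m)).baseSet := ⟨hA, hB⟩
    ext z
    · simp [ContinuousLinearMap.inCoordinates, Trivialization.coe_linearMapAt_of_mem, hA, hB]
      rfl
    · simp [ContinuousLinearMap.inCoordinates, Trivialization.coe_linearMapAt_of_mem, hA, hB]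
      rfl
  have eA := hf.1.continuousWithinAt.preimage_mem_nhdsWithin
    ((trivializationAt A.F A.V (b m)).open_baseSet.mem_nhds
      (FiberBundle.mem_baseSet_trivializationAt' (b m)))
  have eB := hf.1.continuousWithinAt.preimage_mem_nhdsWithin
    ((trivializationAt B.F B.V (b m)).open_baseSet.mem_nhds
      (FiberBundle.mem_baseSet_trivializationAt' (b m)))
  refine (h1.add h2).congr_of_eventuallyEq ?_ (key m
    (FiberBundle.mem_baseSet_trivializationAt' (b m))
    (FiberBundle.mem_baseSet_trivializationAt' (b m)))
  filter_upwards [eA, eB] with y hA hB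
  exact key y hA hB

end Prod

/-- The direct sum of two bundles, with the orthogonal sum of the inner products. -/
def EuclideanBundle.sum (A : EuclideanBundle.{v} d X) (B : EuclideanBundle.{w} d X) :
    EuclideanBundle.{max v w} d X where
  F := A.F × B.F
  V := A.V ×ᵇ B.V
  metric :=
    { inner := fun x =>
        (ContinuousLinearMap.precomp ℝ (ContinuousLinearMap.fst ℝ (A.V x) (B.V x))) ∘L
            (A.metric.inner x) ∘L (ContinuousLinearMap.fst ℝ (A.V x) (B.V x)) +
        (ContinuousLinearMap.precomp ℝ (ContinuousLinearMap.snd ℝ (A.V x) (B.V x))) ∘L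
            (B.metric.inner x) ∘L (ContinuousLinearMap.snd ℝ (A.V x) (B.V x))
      symm := fun x u v => by
        simp [A.metric.symm x u.1 v.1, B.metric.symm x u.2 v.2]
      pos := fun x u hu => by
        have hA : ∀ z : A.V x, 0 ≤ A.metric.inner x z z := fun z => by
          by_cases h : z = 0
          · simp [h]
          · exact (A.metric.pos x z h).le
        have hB : ∀ z : B.V x, 0 ≤ B.metric.inner x z z := fun z => by
          by_cases h : z = 0
          · simp [h]
          · exact (B.metric.pos x z h).le
        obtain ⟨a, b⟩ := u
        by_cases h : a = 0
        · have hb : b ≠ 0 := fun h' => hu (by rw [h, h']; rfl)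
          simpa using add_pos_of_nonneg_of_pos (hA a) (B.metric.pos x b hb)
        · simpa using add_pos_of_pos_of_nonneg (A.metric.pos x a h) (hB b)
      isVonNBounded := fun x => by
        have hA : ∀ z : A.V x, 0 ≤ A.metric.inner x z z := fun z => by
          by_cases h : z = 0
          · simp [h]
          · exact (A.metric.pos x z h).le
        have hB : ∀ z : B.V x, 0 ≤ B.metric.inner x z z := fun z => by
          by_cases h : z = 0
          · simp [h]
          · exact (B.metric.pos x z h).le
        refine Bornology.IsVonNBounded.subset ?_
          (((A.metric.isVonNBounded x).image (ContinuousLinearMap.inl ℝ (A.V x) (B.V x))).add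
            ((B.metric.isVonNBounded x).image (ContinuousLinearMap.inr ℝ (A.V x) (B.V x))))
        rintro ⟨a, b⟩ h
        have h' : A.metric.inner x a a + B.metric.inner x b b < 1 := h
        exact ⟨_, ⟨a, lt_of_le_of_lt (le_add_of_nonneg_right (hB b)) h', rfl⟩,
          _, ⟨b, lt_of_le_of_lt (le_add_of_nonneg_left (hA a)) h', rfl⟩, by simp⟩
      contMDiff := by
        intro x
        have h1 := A.metric.contMDiff x
        have h2 := B.metric.contMDiff x
        rw [contMDiffAt_hom_bundle] at h1 h2 ⊢
        refine ⟨h1.1, ?_⟩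
        have k1 := ContMDiffAt.clm_comp (I := 𝓡 d) (n := ∞) (x := x)
          (g := fun _ => ContinuousLinearMap.precomp ℝ (ContinuousLinearMap.fst ℝ A.F B.F))
          contMDiffAt_const (ContMDiffAt.clm_comp (I := 𝓡 d) (n := ∞) (x := x)
          (f := fun _ => ContinuousLinearMap.fst ℝ A.F B.F) h1.2 contMDiffAt_const)
        have k2 := ContMDiffAt.clm_comp (I := 𝓡 d) (n := ∞) (x := x)
          (g := fun _ => ContinuousLinearMap.precomp ℝ (ContinuousLinearMap.snd ℝ A.F B.F))
          contMDiffAt_const (ContMDiffAt.clm_comp (I := 𝓡 d) (n := ∞) (x := x)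
          (f := fun _ => ContinuousLinearMap.snd ℝ A.F B.F) h2.2 contMDiffAt_const)
        refine (k1.add k2).congr_of_eventuallyEq ?_
        filter_upwards [(trivializationAt A.F A.V x).open_baseSet.mem_nhds
          (FiberBundle.mem_baseSet_trivializationAt' x),
          (trivializationAt B.F B.V x).open_baseSet.mem_nhds
          (FiberBundle.mem_baseSet_trivializationAt' x)] with y hA hB
        refine ContinuousLinearMap.ext fun p => ContinuousLinearMap.ext fun q => ?_
        simp [ContinuousLinearMap.inCoordinates, Trivialization.coe_linearMapAt_of_mem, hA, hB,
          hom_trivializationAt_apply, prod_symm] }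


/-- The product bundle `X × ℝⁿ` with the standard inner product. -/
def EuclideanBundle.trivial (d : ℕ) (X : Type*) [TopologicalSpace X]
    [ChartedSpace (EuclideanSpace ℝ (Fin d)) X] [IsManifold (𝓡 d) ∞ X] (n : ℕ) :
    EuclideanBundle.{0} d X where
  F := EuclideanSpace ℝ (Fin n)
  V := Bundle.Trivial X (EuclideanSpace ℝ (Fin n))
  metric :=
    { inner := fun x => innerSL ℝ
      symm := fun x u v => real_inner_comm (F := EuclideanSpace ℝ (Fin n)) v u
      pos := fun x u hu => real_inner_self_pos.2 hu
      isVonNBounded := fun x => by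
        refine (NormedSpace.isVonNBounded_ball ℝ (EuclideanSpace ℝ (Fin n)) 1).subset ?_
        intro z hz
        have hz' : inner ℝ (z : EuclideanSpace ℝ (Fin n)) z < 1 := hz
        rw [real_inner_self_eq_norm_sq] at hz'
        rw [mem_ball_zero_iff]
        nlinarith [norm_nonneg (z : EuclideanSpace ℝ (Fin n))]
      contMDiff := by
        intro x
        simp only [contMDiffAt_section]
        convert! contMDiffAt_const (c := innerSL ℝ)
        ext v w
        simp [hom_trivializationAt_apply, ContinuousLinearMap.inCoordinates] }



lemma EuclideanBundle.mdifferentiableAt_inner (B : EuclideanBundle d X) {s t : (x : X) → B.V x} {x : X}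
    (hs : MDifferentiableAt (𝓡 d) ((𝓡 d).prod 𝓘(ℝ, B.F)) (fun y => TotalSpace.mk' B.F y (s y)) x)
    (ht : MDifferentiableAt (𝓡 d) ((𝓡 d).prod 𝓘(ℝ, B.F)) (fun y => TotalSpace.mk' B.F y (t y)) x) :
    MDifferentiableAt (𝓡 d) 𝓘(ℝ, ℝ) (fun y => B.metric.inner y (s y) (t y)) x := by
  have h := MDifferentiableAt.clm_bundle_apply₂ (F₁ := B.F) (F₂ := B.F) (F₃ := ℝ)
    (E₃ := Bundle.Trivial X ℝ) ((B.metric.contMDiff x).mdifferentiableAt (by simp)) hs ht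
  exact ((mdifferentiableAt_totalSpace _ _).1 h).2

/-- The direct sum of two metric connections: `(∇ ⊕ ∇')(s, t) = (∇ s, ∇' t)`. -/
def MetricConnection.sum {A : EuclideanBundle.{v} d X} {B : EuclideanBundle.{w} d X}
    (D : MetricConnection A) (D' : MetricConnection B) : MetricConnection (A.sum B) where
  cov :=
    { toFun := fun s x => (D.cov (fun y => (s y).1) x).prod (D'.cov (fun y => (s y).2) x)
      isCovariantDerivativeOnUniv :=
        { add := fun {s s' x} hs hs' _ => by
            have h := (mdifferentiableAt_prod_section A B).1 hs
            have h' := (mdifferentiableAt_prod_section A B).1 hs'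
            have e1 := D.cov.isCovariantDerivativeOnUniv.add h.1 h'.1
            have e2 := D'.cov.isCovariantDerivativeOnUniv.add h.2 h'.2
            refine ContinuousLinearMap.ext fun z => Prod.ext ?_ ?_
            · exact DFunLike.congr_fun e1 z
            · exact DFunLike.congr_fun e2 z
          leibniz := fun {s g x} hs hg _ => by
            have h := (mdifferentiableAt_prod_section A B).1 hs
            have e1 := D.cov.isCovariantDerivativeOnUniv.leibniz h.1 hg
            have e2 := D'.cov.isCovariantDerivativeOnUniv.leibniz h.2 hg
            refine ContinuousLinearMap.ext fun z => Prod.ext ?_ ?_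
            · exact DFunLike.congr_fun e1 z
            · exact DFunLike.congr_fun e2 z } }
  smooth := ⟨⟨fun {s} hs x hx => by
    have h := (contMDiffWithinAt_prod_section A B).1 (hs x hx)
    refine contMDiffWithinAt_prod_hom A B (𝓡 d) (b := fun x => x) ?_ ?_
    · exact D.smooth.contMDiff.contMDiff
        (fun y hy => ((contMDiffWithinAt_prod_section A B).1 (hs y hy)).1) x hx
    · exact D'.smooth.contMDiff.contMDiff
        (fun y hy => ((contMDiffWithinAt_prod_section A B).1 (hs y hy)).2) x hx⟩⟩
  metric := fun x s t hs ht v => by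
    have h := (mdifferentiableAt_prod_section A B).1 hs
    have h' := (mdifferentiableAt_prod_section A B).1 ht
    have e1 := D.metric x _ _ h.1 h'.1 v
    have e2 := D'.metric x _ _ h.2 h'.2 v
    have m1 := A.mdifferentiableAt_inner h.1 h'.1
    have m2 := B.mdifferentiableAt_inner h.2 h'.2
    change mvfderiv (𝓡 d) ((fun y => A.metric.inner y (s y).1 (t y).1) +
      fun y => B.metric.inner y (s y).2 (t y).2) x v = _
    rw [mvfderiv_add m1 m2, add_apply, e1, e2]
    exact add_add_add_comm _ _ _ _

lemma contMDiffAt_mvfderiv_section {F : Type*} [NormedAddCommGroup F] [NormedSpace ℝ F]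
    {f : X → F} {x : X} (hf : ContMDiffAt (𝓡 d) 𝓘(ℝ, F) (∞ + 1) f x) :
    ContMDiffAt (𝓡 d) ((𝓡 d).prod 𝓘(ℝ, EuclideanSpace ℝ (Fin d) →L[ℝ] F)) ∞
      (fun y => TotalSpace.mk' (EuclideanSpace ℝ (Fin d) →L[ℝ] F)
        (E := fun y : X => TangentSpace (𝓡 d) y →L[ℝ] Bundle.Trivial X F y) y
          (mvfderiv (𝓡 d) f y)) x := by
  have h' := ContMDiffAt.mfderiv_const (m := ∞) hf le_rfl
  rw [contMDiffAt_hom_bundle]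
  refine ⟨contMDiffAt_id, h'.congr_of_eventuallyEq (Filter.Eventually.of_forall fun y => ?_)⟩
  refine ContinuousLinearMap.ext fun z => ?_
  simp only [inTangentCoordinates, ContinuousLinearMap.inCoordinates]
  simp
  rfl

lemma mvfderiv_inner_apply {F : Type*} [NormedAddCommGroup F] [InnerProductSpace ℝ F]
    {f g : X → F} {x : X} (hf : MDifferentiableAt (𝓡 d) 𝓘(ℝ, F) f x)
    (hg : MDifferentiableAt (𝓡 d) 𝓘(ℝ, F) g x) (v : TangentSpace (𝓡 d) x) :
    mvfderiv (𝓡 d) (fun y => inner ℝ (f y) (g y)) x v =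
      inner ℝ (mvfderiv (𝓡 d) f x v) (g x) + inner ℝ (f x) (mvfderiv (𝓡 d) g x v) := by
  have key : HasMFDerivAt (𝓡 d) 𝓘(ℝ, ℝ) (fun y => inner ℝ (f y) (g y)) x _ :=
    ⟨hf.continuousAt.inner hg.continuousAt, hf.hasMFDerivAt.2.inner ℝ hg.hasMFDerivAt.2⟩
  have e := DFunLike.congr_fun key.mfderiv v
  refine e.trans ?_
  rw [add_comm]
  simp [mvfderiv]
  rfl

/-- The product connection `d` on `X × ℝⁿ`. -/
def MetricConnection.trivial (d : ℕ) (X : Type*) [TopologicalSpace X]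
    [ChartedSpace (EuclideanSpace ℝ (Fin d)) X] [IsManifold (𝓡 d) ∞ X] (n : ℕ) :
    MetricConnection (EuclideanBundle.trivial d X n) where
  cov :=
    { toFun := fun s x => mvfderiv (𝓡 d) (fun y => (s y : EuclideanSpace ℝ (Fin n))) x
      isCovariantDerivativeOnUniv :=
        { add := fun {s s' x} hs hs' _ => by
            have h := ((mdifferentiableAt_totalSpace _ _).1 hs).2
            have h' := ((mdifferentiableAt_totalSpace _ _).1 hs').2
            exact mvfderiv_add h h'
          leibniz := fun {s g x} hs hg _ => by
            have h := ((mdifferentiableAt_totalSpace _ _).1 hs).2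
            exact mvfderiv_smul hg h } }
  smooth := ⟨⟨fun {s} hs => contMDiffOn_univ.2 fun x => by
    have h := (contMDiffAt_totalSpace.1 ((contMDiffOn_univ.1 hs) x)).2
    exact contMDiffAt_mvfderiv_section h⟩⟩
  metric := fun x s t hs ht v => by
    have h := ((mdifferentiableAt_totalSpace _ _).1 hs).2
    have h' := ((mdifferentiableAt_totalSpace _ _).1 ht).2
    exact mvfderiv_inner_apply (F := EuclideanSpace ℝ (Fin n)) h h' v

lemma hasDerivWithinAt_prodMk {E F : Type*} [AddCommGroup E] [Module ℝ E] [TopologicalSpace E]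
    [IsTopologicalAddGroup E] [ContinuousSMul ℝ E]
    [AddCommGroup F] [Module ℝ F] [TopologicalSpace F] [IsTopologicalAddGroup F] [ContinuousSMul ℝ F]
    {f : ℝ → E} {g : ℝ → F} {f' : E} {g' : F} {s : Set ℝ} {t : ℝ}
    (hf : HasDerivWithinAt f f' s t) (hg : HasDerivWithinAt g g' s t) :
    HasDerivWithinAt (fun τ => (f τ, g τ)) (f', g') s t :=
  ⟨hf.isLittleOTVS.prodMk hg.isLittleOTVS⟩

lemma hasDerivWithinAt_const_fiber {F : Type*} [AddCommGroup F] [Module ℝ F] [TopologicalSpace F]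
    [IsTopologicalAddGroup F] [ContinuousSMul ℝ F] (c : F) (s : Set ℝ) (t : ℝ) :
    HasDerivWithinAt (fun _ => c) 0 s t := by
  refine ⟨?_⟩
  have h := Asymptotics.IsLittleOTVS.zero (𝕜 := ℝ) (E := F) (F := ℝ) (fun p : ℝ × ℝ => p.1 - p.2)
    (nhdsWithin t s ×ˢ pure t)
  convert h using 1
  funext p
  simp


lemma tracePow_prodMap {T V W : Type*} [AddCommGroup V] [Module ℝ V] [AddCommGroup W] [Module ℝ W]
    [Module.Finite ℝ V] [Module.Finite ℝ W] (m : ℕ) (B : T → T → Module.End ℝ V)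
    (C : T → T → Module.End ℝ W) (v : Fin (2 * m) → T) :
    tracePow m (fun a b => LinearMap.prodMap (B a b) (C a b)) v =
      tracePow m B v + tracePow m C v := by
  have h : ∀ σ : Equiv.Perm (Fin (2 * m)), (List.ofFn fun j : Fin m =>
      LinearMap.prodMap (B (v (σ ⟨2 * j, by omega⟩)) (v (σ ⟨2 * j + 1, by omega⟩)))
        (C (v (σ ⟨2 * j, by omega⟩)) (v (σ ⟨2 * j + 1, by omega⟩)))).prod =
      LinearMap.prodMap (List.ofFn fun j : Fin m =>
        B (v (σ ⟨2 * j, by omega⟩)) (v (σ ⟨2 * j + 1, by omega⟩))).prod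
      (List.ofFn fun j : Fin m =>
        C (v (σ ⟨2 * j, by omega⟩)) (v (σ ⟨2 * j + 1, by omega⟩))).prod := by
    intro σ
    have key : ∀ l : List (Module.End ℝ V × Module.End ℝ W),
        (l.map fun p => LinearMap.prodMap p.1 p.2).prod =
          LinearMap.prodMap (l.map Prod.fst).prod (l.map Prod.snd).prod := by
      intro l
      induction l with
      | nil => simp [LinearMap.prodMap_one]
      | cons p l ih => simp [ih, LinearMap.prodMap_mul]
    simpa [List.map_ofFn, Function.comp_def] using key (List.ofFn fun j : Fin m =>
      (B (v (σ ⟨2 * j, by omega⟩)) (v (σ ⟨2 * j + 1, by omega⟩)),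
        C (v (σ ⟨2 * j, by omega⟩)) (v (σ ⟨2 * j + 1, by omega⟩))))
  simp only [tracePow, h, LinearMap.trace_prodMap', ← mul_add, ← Finset.sum_add_distrib]

lemma tracePow_eq_zero {T V : Type*} [AddCommGroup V] [Module ℝ V]
    (m : ℕ) (B : T → T → Module.End ℝ V) (v : Fin (2 * m) → T) (i : Fin (2 * m))
    (h : ∀ b, B (v i) b = 0 ∧ B b (v i) = 0) : tracePow m B v = 0 := by
  unfold tracePow
  refine mul_eq_zero_of_right _ (Finset.sum_eq_zero fun σ _ => mul_eq_zero_of_right _ ?_)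
  rw [List.prod_eq_zero, map_zero]
  rw [List.mem_ofFn]
  obtain ⟨j, hj⟩ := σ.surjective i
  refine ⟨⟨j / 2, by omega⟩, ?_⟩
  rcases Nat.even_or_odd' (j : ℕ) with ⟨q, hq | hq⟩
  · have : (⟨2 * ((j : ℕ) / 2), by omega⟩ : Fin (2 * m)) = j := Fin.ext (by simp; omega)
    simp only [this, hj, (h _).1]
  · have : (⟨2 * ((j : ℕ) / 2) + 1, by omega⟩ : Fin (2 * m)) = j := Fin.ext (by simp; omega)
    simp only [this, hj, (h _).2]

lemma extend_tangent_zero (x : X) :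
    ∀ᶠ y in nhds x, FiberBundle.extend (EuclideanSpace ℝ (Fin d)) (0 : TangentSpace (𝓡 d) x) y = 0 := by
  have hx := FiberBundle.mem_baseSet_trivializationAt' (F := EuclideanSpace ℝ (Fin d))
    (E := fun y : X => TangentSpace (𝓡 d) y) x
  have h0 := ((trivializationAt (EuclideanSpace ℝ (Fin d))
    (fun y : X => TangentSpace (𝓡 d) y) x).linear ℝ hx).map_zero
  filter_upwards [(trivializationAt (EuclideanSpace ℝ (Fin d))
    (fun y : X => TangentSpace (𝓡 d) y) x).open_baseSet.mem_nhds hx] with y hy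
  simp only [FiberBundle.extend]
  rw [h0, ← Trivialization.coe_symmₗ (R := ℝ) (hb := hy)]
  exact map_zero _

lemma MetricConnection.cov_extend_zero [T2Space X] {B : EuclideanBundle d X}
    (D : MetricConnection B) {x : X} {s : (x : X) → B.V x} (h : B.SmoothNear s x) :
    D.cov (fun y => D.cov s y
      (FiberBundle.extend (EuclideanSpace ℝ (Fin d)) (0 : TangentSpace (𝓡 d) x) y)) x = 0 := by
  have h0 : D.cov (0 : (y : X) → B.V y) x = 0 :=
    D.cov.isCovariantDerivativeOnUniv.zero (mem_univ x)
  rw [← h0]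
  refine D.cov.isCovariantDerivativeOnUniv.congr_of_eventuallyEq
      (D.mdifferentiableAt_cov_apply h 0) (mdifferentiable_zeroSection ℝ _ x) Filter.univ_mem ?_
  filter_upwards [extend_tangent_zero (d := d) x] with y hy
  rw [hy]
  exact map_zero _

lemma MetricConnection.curvature_zero_left [T2Space X] {B : EuclideanBundle d X}
    (D : MetricConnection B) (x : X) (w : TangentSpace (𝓡 d) x) : D.curvature x 0 w = 0 := by
  ext u
  have h1 := D.cov_extend_zero (B.smoothNear_extend u)
  have h2 : VectorField.mlieBracket (𝓡 d) (FiberBundle.extend (EuclideanSpace ℝ (Fin d)) (0 : TangentSpace (𝓡 d) x))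
    (FiberBundle.extend (EuclideanSpace ℝ (Fin d)) w) x = 0 := by
    refine (Filter.EventuallyEq.mlieBracket_vectorField_eq (extend_tangent_zero (d := d) x) (Filter.EventuallyEq.refl _ _)).trans ?_
    exact congrFun VectorField.mlieBracket_zero_left x
  change D.curvatureAux x 0 w _ = 0
  simp [curvatureAux, h1, h2]

lemma MetricConnection.curvature_zero_right [T2Space X] {B : EuclideanBundle d X}
    (D : MetricConnection B) (x : X) (v : TangentSpace (𝓡 d) x) : D.curvature x v 0 = 0 := by
  ext u
  have h1 := D.cov_extend_zero (B.smoothNear_extend u)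
  have h2 : VectorField.mlieBracket (𝓡 d) (FiberBundle.extend (EuclideanSpace ℝ (Fin d)) v)
    (FiberBundle.extend (EuclideanSpace ℝ (Fin d)) (0 : TangentSpace (𝓡 d) x)) x = 0 := by
    refine (Filter.EventuallyEq.mlieBracket_vectorField_eq (Filter.EventuallyEq.refl _ _) (extend_tangent_zero (d := d) x)).trans ?_
    exact congrFun VectorField.mlieBracket_zero_right x
  change D.curvatureAux x v 0 _ = 0
  simp [curvatureAux, h1, h2]

section Sum
variable {A : EuclideanBundle.{v} d X} {B : EuclideanBundle.{w} d X}

lemma extend_prod_eventually (x : X) (p : A.V x) (q : B.V x) :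
    ∀ᶠ y in nhds x, FiberBundle.extend (A.sum B).F (E := (A.sum B).V) ((p, q) : (A.sum B).V x) y =
      (FiberBundle.extend A.F p y, FiberBundle.extend B.F q y) := by
  have hA := FiberBundle.mem_baseSet_trivializationAt' (F := A.F) (E := A.V) x
  have hB := FiberBundle.mem_baseSet_trivializationAt' (F := B.F) (E := B.V) x
  filter_upwards [(trivializationAt A.F A.V x).open_baseSet.mem_nhds hA,
    (trivializationAt B.F B.V x).open_baseSet.mem_nhds hB] with y hyA hyB
  exact prod_symm A B x hyA hyB _

lemma smoothNear_prod {s : (x : X) → A.V x} {t : (x : X) → B.V x} {x : X}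
    (hs : A.SmoothNear s x) (ht : B.SmoothNear t x) :
    (A.sum B).SmoothNear (fun y => (s y, t y)) x := by
  obtain ⟨U, hU, hs⟩ := hs
  obtain ⟨U', hU', ht⟩ := ht
  exact ⟨U ∩ U', Filter.inter_mem hU hU', fun y hy => (contMDiffWithinAt_prod_section A B).2
    ⟨(hs y hy.1).mono inter_subset_left, (ht y hy.2).mono inter_subset_right⟩⟩

lemma MetricConnection.curvature_sum [T2Space X] (D : MetricConnection A) (D' : MetricConnection B)
    (x : X) (v w : TangentSpace (𝓡 d) x) :
    (D.sum D').curvature x v w =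
      LinearMap.prodMap (D.curvature x v w) (D'.curvature x v w) := by
  refine LinearMap.ext fun u => ?_
  obtain ⟨p, q⟩ := u
  refine ((D.sum D').curvatureAux_congr v w (smoothNear_prod (A.smoothNear_extend p)
    (B.smoothNear_extend q)) (extend_prod_eventually x p q)).trans ?_
  rfl

instance EuclideanBundle.finiteFiber (B : EuclideanBundle d X) (x : X) :
    Module.Finite ℝ (B.V x) :=
  Module.Finite.equiv ((trivializationAt B.F B.V x).continuousLinearEquivAt ℝ x
    (FiberBundle.mem_baseSet_trivializationAt' x)).symm.toLinearEquiv

lemma smoothSection_fst {s : (x : X) → (A.sum B).V x} (hs : (A.sum B).SmoothSection s) :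
    A.SmoothSection fun x => (s x).1 := fun x =>
  ((contMDiffWithinAt_prod_section A B (U := univ)).1 (hs x)).1

lemma smoothSection_snd {s : (x : X) → (A.sum B).V x} (hs : (A.sum B).SmoothSection s) :
    B.SmoothSection fun x => (s x).2 := fun x =>
  ((contMDiffWithinAt_prod_section A B (U := univ)).1 (hs x)).2



/-- The path `γ(t) ⊕ ∇'`. -/
def ConnectionPath.sumRight [T2Space X] {D₀ D₁ : MetricConnection A} (γ : ConnectionPath D₀ D₁)
    (D' : MetricConnection B) : ConnectionPath (D₀.sum D') (D₁.sum D') where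
  conn t := (γ.conn t).sum D'
  conn_zero := by rw [γ.conn_zero]
  conn_one := by rw [γ.conn_one]
  smooth := fun s hs p hp => by
    refine contMDiffWithinAt_prod_hom A B (𝓘(ℝ, ℝ).prod (𝓡 d)) (b := fun p : ℝ × X => p.2) ?_ ?_
    · exact γ.smooth _ (smoothSection_fst hs) p hp
    · have h := (D'.smooth.contMDiff.contMDiff (σ := fun y => (s y).2)
        (smoothSection_snd hs).contMDiffOn).contMDiffAt Filter.univ_mem (x := p.2)
      exact (h.comp p contMDiffAt_snd).contMDiffWithinAt
  velocity t x v := LinearMap.prodMap (γ.velocity t x v) 0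
  hasDerivWithinAt := fun t ht s hs x v =>
    hasDerivWithinAt_prodMk (γ.hasDerivWithinAt t ht _ (smoothSection_fst hs) x v)
      (hasDerivWithinAt_const_fiber _ _ _)

/-- The path `∇ ⊕ γ(t)`. -/
def ConnectionPath.sumLeft [T2Space X] (D : MetricConnection A) {D₀ D₁ : MetricConnection B}
    (γ : ConnectionPath D₀ D₁) : ConnectionPath (D.sum D₀) (D.sum D₁) where
  conn t := D.sum (γ.conn t)
  conn_zero := by rw [γ.conn_zero]
  conn_one := by rw [γ.conn_one]
  smooth := fun s hs p hp => by
    refine contMDiffWithinAt_prod_hom A B (𝓘(ℝ, ℝ).prod (𝓡 d)) (b := fun p : ℝ × X => p.2) ?_ ?_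
    · have h := (D.smooth.contMDiff.contMDiff (σ := fun y => (s y).1)
        (smoothSection_fst hs).contMDiffOn).contMDiffAt Filter.univ_mem (x := p.2)
      exact (h.comp p contMDiffAt_snd).contMDiffWithinAt
    · exact γ.smooth _ (smoothSection_snd hs) p hp
  velocity t x v := LinearMap.prodMap 0 (γ.velocity t x v)
  hasDerivWithinAt := fun t ht s hs x v =>
    hasDerivWithinAt_prodMk (hasDerivWithinAt_const_fiber _ _ _)
      (γ.hasDerivWithinAt t ht _ (smoothSection_snd hs) x v)

lemma ConnectionPath.csForm_sumRight [T2Space X] {D₀ D₁ : MetricConnection A}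
    (γ : ConnectionPath D₀ D₁) (D' : MetricConnection B) (k : ℕ) :
    (γ.sumRight D').csForm k = γ.csForm k := by
  funext x v
  have h : ∀ t, (γ.sumRight D').totalCurvature t x = fun a b =>
      LinearMap.prodMap (γ.totalCurvature t x a b) (D'.curvature x a.2 b.2) := fun t => by
    funext a b
    change ((γ.conn t).sum D').curvature x a.2 b.2
      + a.1 • LinearMap.prodMap (γ.velocity t x b.2) 0
      - b.1 • LinearMap.prodMap (γ.velocity t x a.2) 0 = _
    rw [MetricConnection.curvature_sum]
    refine LinearMap.ext fun u => Prod.ext ?_ ?_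
    · rfl
    · change D'.curvature x a.2 b.2 u.2 + a.1 • 0 - b.1 • 0 = _
      rw [smul_zero, smul_zero, add_zero, sub_zero]
      rfl
  have hz := tracePow_eq_zero (2 * (k + 1))
    (fun a b : ℝ × TangentSpace (𝓡 d) x => D'.curvature x a.2 b.2)
    (Fin.cons (1, 0) fun i => (0, v i)) 0
    (fun b => ⟨D'.curvature_zero_left x b.2, D'.curvature_zero_right x b.2⟩)
  simp only [csForm, h, phForm]
  congr 1
  funext t
  congr 1
  exact (tracePow_prodMap _ _ _ _).trans (by rw [hz, add_zero])

lemma ConnectionPath.csForm_sumLeft [T2Space X] (D : MetricConnection A)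
    {D₀ D₁ : MetricConnection B} (γ : ConnectionPath D₀ D₁) (k : ℕ) :
    (ConnectionPath.sumLeft D γ).csForm k = γ.csForm k := by
  funext x v
  have h : ∀ t, (ConnectionPath.sumLeft D γ).totalCurvature t x = fun a b =>
      LinearMap.prodMap (D.curvature x a.2 b.2) (γ.totalCurvature t x a b) := fun t => by
    funext a b
    change (D.sum (γ.conn t)).curvature x a.2 b.2
      + a.1 • LinearMap.prodMap 0 (γ.velocity t x b.2)
      - b.1 • LinearMap.prodMap 0 (γ.velocity t x a.2) = _
    rw [MetricConnection.curvature_sum]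
    refine LinearMap.ext fun u => Prod.ext ?_ ?_
    · change D.curvature x a.2 b.2 u.1 + a.1 • 0 - b.1 • 0 = _
      rw [smul_zero, smul_zero, add_zero, sub_zero]
      rfl
    · rfl
  have hz := tracePow_eq_zero (2 * (k + 1))
    (fun a b : ℝ × TangentSpace (𝓡 d) x => D.curvature x a.2 b.2)
    (Fin.cons (1, 0) fun i => (0, v i)) 0
    (fun b => ⟨D.curvature_zero_left x b.2, D.curvature_zero_right x b.2⟩)
  simp only [csForm, h, phForm]
  congr 1
  funext t
  congr 1
  exact (tracePow_prodMap _ _ _ _).trans (by rw [hz, zero_add])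

lemma CSEquiv.sum_right [T2Space X] {D₀ D₁ : MetricConnection A} (h : CSEquiv D₀ D₁)
    (D' : MetricConnection B) : CSEquiv (D₀.sum D') (D₁.sum D') := by
  obtain ⟨γ, hγ⟩ := h
  exact ⟨γ.sumRight D', fun k => by rw [γ.csForm_sumRight]; exact hγ k⟩

lemma CSEquiv.sum_left [T2Space X] (D : MetricConnection A) {D₀ D₁ : MetricConnection B}
    (h : CSEquiv D₀ D₁) : CSEquiv (D.sum D₀) (D.sum D₁) := by
  obtain ⟨γ, hγ⟩ := h
  exact ⟨ConnectionPath.sumLeft D γ, fun k => by rw [ConnectionPath.csForm_sumLeft]; exact hγ k⟩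

end Sum

/-- A structured bundle over `X`: a real vector bundle with inner product together with a
Chern-Simons equivalence class of metric connections on it. As Chern-Simons equivalence is an
equivalence relation, the elements of the quotient are exactly the equivalence classes. -/
structure StructuredBundle (d : ℕ) (X : Type*) [TopologicalSpace X] [T2Space X]
    [ChartedSpace (EuclideanSpace ℝ (Fin d)) X] [IsManifold (𝓡 d) ∞ X] where
  bundle : EuclideanBundle.{v} d X
  cls : Quot (CSEquiv (B := bundle))

variable [T2Space X]

/-- The direct sum `[V, {∇}] ⊕ [W, {∇'}] = [V ⊕ W, {∇ ⊕ ∇'}]`; it does not depend on the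
representatives. -/
def StructuredBundle.sum (𝒱 : StructuredBundle.{v} d X) (𝒲 : StructuredBundle.{w} d X) :
    StructuredBundle.{max v w} d X where
  bundle := 𝒱.bundle.sum 𝒲.bundle
  cls := Quot.map₂ (fun D D' => D.sum D') (fun D _ _ h => h.sum_left D)
    (fun _ _ D' h => h.sum_right D') 𝒱.cls 𝒲.cls

/-- The trivial structured bundle `[n]`: the product bundle of rank `n` with the class of the
product connection. -/
def StructuredBundle.trivial (d : ℕ) (X : Type*) [TopologicalSpace X] [T2Space X]
    [ChartedSpace (EuclideanSpace ℝ (Fin d)) X] [IsManifold (𝓡 d) ∞ X] (n : ℕ) :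
    StructuredBundle.{0} d X where
  bundle := EuclideanBundle.trivial d X n
  cls := Quot.mk _ (MetricConnection.trivial d X n)

/-- A smooth isometric isomorphism of bundles over the identity of `X`. -/
structure BundleIsometry (A : EuclideanBundle.{v} d X) (B : EuclideanBundle.{w} d X) where
  toFun : (x : X) → A.V x ≃ₗ[ℝ] B.V x
  isometry : ∀ (x : X) (u u' : A.V x),
    B.metric.inner x (toFun x u) (toFun x u') = A.metric.inner x u u'
  smooth : ContMDiff ((𝓡 d).prod 𝓘(ℝ, A.F)) ((𝓡 d).prod 𝓘(ℝ, B.F)) ∞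
    (fun p : TotalSpace A.F A.V => TotalSpace.mk' B.F p.1 (toFun p.1 p.2))

/-- `∇ = σ^* ∇'`, that is, `σ (∇_v s) = ∇'_v (σ s)` for all smooth sections `s` and tangent vectors
`v`. -/
def BundleIsometry.IsPullback {A : EuclideanBundle.{v} d X} {B : EuclideanBundle.{w} d X}
    (σ : BundleIsometry A B) (D' : MetricConnection B) (D : MetricConnection A) : Prop :=
  ∀ s : (x : X) → A.V x, A.SmoothSection s → ∀ (x : X) (v : TangentSpace (𝓡 d) x),
    σ.toFun x (D.cov s x v) = D'.cov (fun y => σ.toFun y (s y)) x v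

/-- Isomorphism of structured bundles: a bundle isometry `σ : V → W` over the identity with
`σ^* {∇'} = {∇}`, where `σ^* {∇'}` is the class of the connections `σ^* ∇'`. -/
def StructuredBundle.Iso (𝒱 : StructuredBundle.{v} d X) (𝒲 : StructuredBundle.{w} d X) : Prop :=
  ∃ σ : BundleIsometry 𝒱.bundle 𝒲.bundle, ∃ (D : MetricConnection 𝒱.bundle)
    (D' : MetricConnection 𝒲.bundle), Quot.mk _ D = 𝒱.cls ∧ Quot.mk _ D' = 𝒲.cls ∧
      σ.IsPullback D' D


end

end StructKO

open scoped Topology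

namespace StructKO

noncomputable section


/-! ### Generic projections and finite generation -/

/-! Fix a metric connection `D` representing the given class on `V`. The theorem rests on two facts.

(1) `D` is induced from a product bundle. There are finitely many smooth sections `s i` such that `u
↦ (⟨s i, u⟩)ᵢ` embeds `V` isometrically in `X × ℝᴺ` (a Parseval frame) and such that, with `P` the
orthogonal projection onto the image, `D` is the compression `P d` of the product connection. This
is `MetricConnection.exists_isParsevalFrame`. Starting from any Parseval frame `e`, the difference
between `D` and the induced connection is a one-form with values in skew endomorphisms, the total
defect. Replacing pairs `(e p, e q)` by many copies, scaled by `λ` and rotated by an angle `θ`,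
changes the defect by terms `λ² dθ` times the skew form of the pair. Every `a df` is a sum of four
such `λ² dθ` with `∑ λ²` a prescribed positive constant (`exists_sum_sq_smul_differential`), and
finitely many differentials `df` span all cotangent spaces, so the defect can be cancelled exactly
while the Parseval identity is kept.

(2) Let `W` be the orthogonal complement with the compressed connection `(1 - P) d`. On `V ⊕ W = X ×
ℝᴺ` the sum of the two connections is `d + ε dP` with `ε = 2 P - 1`. Since `ε² = 1`, the form `dP`
anticommutes with `ε`. Along the path `d + (1 - t) ε dP` to the product connection the curvature is
a multiple of `[dP, dP]` and commutes with `ε`, while the velocity `-ε dP` anticommutes with it.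
Each trace in the Chern–Simons form has exactly one velocity factor, so it changes sign under
conjugation by `ε` and vanishes: the form is zero, not only exact (`ConnectionPath.csForm_untwist`).

Finiteness on a noncompact `X` comes from general position: over a compact set `d + rank`
functionals separate the points of the fibres, a number independent of the set. Functionals on the
shells of an exhaustion can then be glued, index by index, over three families of disjoint shells
(`exists_separating_of_glue`). This is used both for generating sections and for differentials. -/

/-- The complement of the range of a `C¹` map from a second countable manifold to a vector space of
larger dimension is dense. -/
theorem dense_compl_range_of_contMDiff {E H M F : Type*} [NormedAddCommGroup E] [NormedSpace ℝ E]
    [FiniteDimensional ℝ E] [TopologicalSpace H] {I : ModelWithCorners ℝ E H} [I.Boundaryless]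
    [TopologicalSpace M] [ChartedSpace H M] [SecondCountableTopology M]
    [NormedAddCommGroup F] [NormedSpace ℝ F] [FiniteDimensional ℝ F] {f : M → F}
    (hf : ContMDiff I 𝓘(ℝ, F) 1 f) (h : Module.finrank ℝ E < Module.finrank ℝ F) :
    Dense (range f)ᶜ := by
  -- In a chart the map is locally Lipschitz, so small pieces of the image have Hausdorff dimension
  -- at most `dim E`. By second countability countably many pieces suffice, and the dimension of a
  -- countable union is the supremum.
  have key : ∀ p : M, ∃ N ∈ 𝓝 p, dimH (f '' N) ≤ Module.finrank ℝ E := by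
    intro p
    have h1 : ContDiffAt ℝ 1 (f ∘ (extChartAt I p).symm) (extChartAt I p p) := by
      have := ((contMDiffAt_iff (I := I)).1 (hf p)).2
      rw [I.range_eq_univ, contDiffWithinAt_univ] at this
      exact this
    obtain ⟨K, t, ht, hK⟩ := h1.exists_lipschitzOnWith
    refine ⟨(extChartAt I p).source ∩ extChartAt I p ⁻¹' t, Filter.inter_mem
      (extChartAt_source_mem_nhds p) ((continuousAt_extChartAt p).preimage_mem_nhds ht), ?_⟩
    refine (dimH_mono ?_).trans ((hK.dimH_image_le).trans
      ((dimH_mono (subset_univ t)).trans (Real.dimH_univ_eq_finrank E).le))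
    rintro _ ⟨q, ⟨hq, hqt⟩, rfl⟩
    exact ⟨_, hqt, congrArg f ((extChartAt I p).left_inv hq)⟩
  choose N hN hdim using key
  obtain ⟨s, hs, hsU⟩ := TopologicalSpace.countable_cover_nhds hN
  refine dense_compl_of_dimH_lt_finrank (lt_of_le_of_lt ?_ (Nat.cast_lt.2 h))
  rw [← image_univ, ← hsU, image_iUnion₂, dimH_bUnion hs]
  exact iSup₂_le fun p _ => hdim p

/-- Projection along `c`: the quotient by the line has dimension `k`. Composing with it drops one
functional. -/
lemma exists_linearMap_ker_eq_span {k : ℕ} {c : Fin (k + 1) → ℝ} (hc : c ≠ 0) :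
    ∃ T : (Fin (k + 1) → ℝ) →ₗ[ℝ] (Fin k → ℝ), LinearMap.ker T = ℝ ∙ c := by
  have h : Module.finrank ℝ ((Fin (k + 1) → ℝ) ⧸ (ℝ ∙ c)) = Module.finrank ℝ (Fin k → ℝ) := by
    have := Submodule.finrank_quotient_add_finrank (ℝ ∙ c)
    rw [finrank_span_singleton hc] at this
    simp at this ⊢
    omega
  refine ⟨(LinearEquiv.ofFinrankEq _ _ h).toLinearMap ∘ₗ (ℝ ∙ c).mkQ, ?_⟩
  rw [LinearEquiv.ker_comp, Submodule.ker_mkQ]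

/-- The dimension argument is applied to the total space as a manifold. Countably many base points
suffice for an atlas, since the chart at `(x, 0)` contains the whole fibres over a neighbourhood of
`x`. -/
lemma secondCountable_totalSpace (d : ℕ) {X : Type*} [TopologicalSpace X]
    [ChartedSpace (EuclideanSpace ℝ (Fin d)) X] (F : Type*) [NormedAddCommGroup F]
    [NormedSpace ℝ F] [FiniteDimensional ℝ F] (V : X → Type*) [TopologicalSpace (TotalSpace F V)]
    [∀ x, AddCommGroup (V x)] [∀ x, Module ℝ (V x)] [∀ x, TopologicalSpace (V x)]
    [FiberBundle F V] [VectorBundle ℝ F V] [SecondCountableTopology X] :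
    SecondCountableTopology (TotalSpace F V) := by
  have hcov : ∀ x : X, (chartAt (EuclideanSpace ℝ (Fin d)) x).source ∩
      (trivializationAt F V x).baseSet ∈ 𝓝 x := fun x =>
    Filter.inter_mem ((chartAt _ x).open_source.mem_nhds (mem_chart_source _ x))
      ((trivializationAt F V x).open_baseSet.mem_nhds (FiberBundle.mem_baseSet_trivializationAt' x))
  obtain ⟨s, hs, hsU⟩ := TopologicalSpace.countable_cover_nhds hcov
  have : SecondCountableTopology (ModelProd (EuclideanSpace ℝ (Fin d)) F) :=
    inferInstanceAs (SecondCountableTopology (_ × _))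
  refine ChartedSpace.secondCountable_of_countable_cover
    (ModelProd (EuclideanSpace ℝ (Fin d)) F)
    (s := (fun x : X => (⟨x, 0⟩ : TotalSpace F V)) '' s) ?_ (hs.image _)
  rw [eq_univ_iff_forall]
  intro p
  have hp : p.proj ∈ ⋃ x ∈ s, (chartAt (EuclideanSpace ℝ (Fin d)) x).source ∩
      (trivializationAt F V x).baseSet := hsU ▸ mem_univ _
  simp only [mem_iUnion] at hp ⊢
  obtain ⟨x, hxs, h1, h2⟩ := hp
  refine ⟨⟨x, 0⟩, ⟨x, hxs, rfl⟩, ?_⟩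
  simp [FiberBundle.chartedSpace_chartAt, Trivialization.mem_source, h1, h2,
    Trivialization.coe_fst, prod_univ]

/-! ### Reducing and gluing separating families of functionals -/

section Generic
variable {d : ℕ} {X : Type*} [TopologicalSpace X] [ChartedSpace (EuclideanSpace ℝ (Fin d)) X]
  {F : Type*} [NormedAddCommGroup F] [NormedSpace ℝ F] [FiniteDimensional ℝ F]
  {V : X → Type*} [TopologicalSpace (TotalSpace F V)] [∀ x, AddCommGroup (V x)]
  [∀ x, Module ℝ (V x)] [∀ x, TopologicalSpace (V x)] [FiberBundle F V] [VectorBundle ℝ F V]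

/-- A finite family of functionals which is injective on the fibres over `K` can be reduced to
`d + rank V` functionals by a generic linear projection. -/
theorem exists_linearMap_separating [SecondCountableTopology X] (K : Set X) :
    ∀ (k : ℕ) (Φ : (x : X) → V x →ₗ[ℝ] (Fin k → ℝ)),
    ContMDiff ((𝓡 d).prod 𝓘(ℝ, F)) 𝓘(ℝ, Fin k → ℝ) 1 (fun p : TotalSpace F V => Φ p.1 p.2) →
    (∀ x ∈ K, ∀ u, Φ x u = 0 → u = 0) →
    ∃ T : (Fin k → ℝ) →ₗ[ℝ] (Fin (d + Module.finrank ℝ F) → ℝ),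
      ∀ x ∈ K, ∀ u, T (Φ x u) = 0 → u = 0
  | k, Φ, hΦ, hK => by
    have := secondCountable_totalSpace d F V
    -- If there are few functionals, pad them by zeros.
    by_cases hk : k ≤ d + Module.finrank ℝ F
    · obtain ⟨T, hT⟩ : ∃ T : (Fin k → ℝ) →ₗ[ℝ] (Fin (d + Module.finrank ℝ F) → ℝ),
          Function.Injective T := by
        refine ⟨LinearMap.pi fun j => if h : (j : ℕ) < k then LinearMap.proj ⟨j, h⟩ else 0,
          fun u u' h => funext fun i => ?_⟩
        simpa using congrFun h ⟨i, i.2.trans_le hk⟩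
      exact ⟨T, fun x hx u hu => hK x hx u (hT (by rw [hu, map_zero]))⟩
    · obtain ⟨k, rfl⟩ : ∃ l, k = l + 1 := ⟨k - 1, by omega⟩
      -- The total space has dimension `d + rank < k + 1`, so `Φ` misses some direction `c`.
      have hd := dense_compl_range_of_contMDiff hΦ (by simpa using hk)
      obtain ⟨c, hc⟩ := hd.nonempty
      -- The zero vectors are mapped to `0`, so `c = 0` is missed only if `X` is empty.
      by_cases hc0 : c = 0
      · refine ⟨0, fun x hx u _ => absurd ⟨⟨x, 0⟩, ?_⟩ hc⟩
        simp [hc0]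
      obtain ⟨T, hT⟩ := exists_linearMap_ker_eq_span hc0
      -- If `T (Φ u) = 0`, then `Φ u = a c`. For `a ≠ 0` fibrewise linearity would give `c = Φ (a⁻¹
      -- u)`, contrary to the choice of `c`; so `Φ u = 0`.
      obtain ⟨T', hT'⟩ := exists_linearMap_separating K k (fun x => T ∘ₗ Φ x)
        ((LinearMap.toContinuousLinearMap T).contMDiff.comp hΦ) (fun x hx u hu => by
          have hu' : Φ x u ∈ LinearMap.ker T := hu
          rw [hT, Submodule.mem_span_singleton] at hu'
          obtain ⟨a, ha⟩ := hu'
          by_cases ha0 : a = 0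
          · exact hK x hx u (by rw [← ha, ha0, zero_smul])
          · refine absurd ⟨⟨x, a⁻¹ • u⟩, ?_⟩ hc
            simp [← ha, smul_smul, inv_mul_cancel₀ ha0])
      exact ⟨T' ∘ₗ T, hT'⟩


/-- Local families are concatenated over a finite subcover. The number `k` depends on `K` here,
which would prevent gluing over an exhaustion. -/
lemma exists_separating_of_isCompact (S : Submodule ℝ ((x : X) → V x →ₗ[ℝ] ℝ))
    (hloc : ∀ x₀ : X, ∃ (k : ℕ) (φ : Fin k → (x : X) → V x →ₗ[ℝ] ℝ), (∀ i, φ i ∈ S) ∧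
      ∀ᶠ x in 𝓝 x₀, ∀ u : V x, (∀ i, φ i x u = 0) → u = 0) {K : Set X} (hK : IsCompact K) :
    ∃ (k : ℕ) (φ : Fin k → (x : X) → V x →ₗ[ℝ] ℝ), (∀ i, φ i ∈ S) ∧
      ∀ x ∈ K, ∀ u : V x, (∀ i, φ i x u = 0) → u = 0 := by
  refine hK.induction_on ?_ ?_ ?_ ?_
  · exact ⟨0, fun i => 0, fun i => S.zero_mem, fun x hx => hx.elim⟩
  · rintro s t h ⟨k, φ, hφ, hs⟩
    exact ⟨k, φ, hφ, fun x hx => hs x (h hx)⟩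
  · rintro s t ⟨k, φ, hφ, hs⟩ ⟨k', φ', hφ', hs'⟩
    refine ⟨k + k', Fin.append φ φ', Fin.addCases (by simpa) (by simpa), ?_⟩
    rintro x (hx | hx) u hu
    · exact hs x hx u fun i => by simpa using hu (Fin.castAdd k' i)
    · exact hs' x hx u fun i => by simpa using hu (Fin.natAdd k i)
  · intro x _
    obtain ⟨k, φ, hφ, hs⟩ := hloc x
    exact ⟨_, mem_nhdsWithin_of_mem_nhds hs, k, φ, hφ, fun y hy => hy⟩

/-- On a compact set, `d + rank V` functionals suffice to separate the points of the fibres. -/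
lemma exists_separating_bounded_of_isCompact [SecondCountableTopology X]
    (S : Submodule ℝ ((x : X) → V x →ₗ[ℝ] ℝ))
    (hS : ∀ φ ∈ S, ContMDiff ((𝓡 d).prod 𝓘(ℝ, F)) 𝓘(ℝ) 1 (fun p : TotalSpace F V => φ p.1 p.2))
    (hloc : ∀ x₀ : X, ∃ (k : ℕ) (φ : Fin k → (x : X) → V x →ₗ[ℝ] ℝ), (∀ i, φ i ∈ S) ∧
      ∀ᶠ x in 𝓝 x₀, ∀ u : V x, (∀ i, φ i x u = 0) → u = 0) {K : Set X} (hK : IsCompact K) :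
    ∃ φ : Fin (d + Module.finrank ℝ F) → (x : X) → V x →ₗ[ℝ] ℝ, (∀ i, φ i ∈ S) ∧
      ∀ x ∈ K, ∀ u : V x, (∀ i, φ i x u = 0) → u = 0 := by
  obtain ⟨k, φ, hφ, hs⟩ := exists_separating_of_isCompact S hloc hK
  obtain ⟨T, hT⟩ := exists_linearMap_separating (d := d) (F := F) K k
    (fun x => LinearMap.pi fun i => φ i x) (contMDiff_pi_space.2 fun i => hS _ (hφ i))
    (fun x hx u hu => hs x hx u fun i => congrFun hu i)
  -- The components of `T ∘ Φ`, written as constant linear combinations of the `φ i` so that they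
  -- visibly stay in `S`.
  refine ⟨fun j => ∑ i, T (Pi.single i 1) j • φ i,
    fun j => S.sum_mem fun i _ => S.smul_mem _ (hφ i), fun x hx u hu => hT x hx u ?_⟩
  funext j
  have h := hu j
  rw [T.pi_apply_eq_sum_univ]
  have hsingle : ∀ i : Fin k, (fun j => if i = j then (1 : ℝ) else 0) = Pi.single i 1 :=
    fun i => funext fun j => by simp [Pi.single_apply, eq_comm]
  simpa [Finset.sum_apply, mul_comm, hsingle] using h

/-- A space of functionals on the fibres which separates points locally, and which allows gluing
along locally finite families of disjoint open sets, contains a finite separating family. -/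
theorem exists_separating_of_glue [T2Space X] [SecondCountableTopology X]
    (S : Submodule ℝ ((x : X) → V x →ₗ[ℝ] ℝ))
    (hS : ∀ φ ∈ S, ContMDiff ((𝓡 d).prod 𝓘(ℝ, F)) 𝓘(ℝ) 1 (fun p : TotalSpace F V => φ p.1 p.2))
    (hloc : ∀ x₀ : X, ∃ (k : ℕ) (φ : Fin k → (x : X) → V x →ₗ[ℝ] ℝ), (∀ i, φ i ∈ S) ∧
      ∀ᶠ x in 𝓝 x₀, ∀ u : V x, (∀ i, φ i x u = 0) → u = 0)
    (hglue : ∀ φ : ℕ → (x : X) → V x →ₗ[ℝ] ℝ, (∀ n, φ n ∈ S) → ∀ A U : ℕ → Set X,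
      (∀ n, IsCompact (A n)) → (∀ n, IsOpen (U n)) → (∀ n, A n ⊆ U n) →
      Pairwise (fun m n => Disjoint (U m) (U n)) → LocallyFinite U →
      ∃ ψ ∈ S, ∀ n, ∀ x ∈ A n, ψ x = φ n x) :
    ∃ (k : ℕ) (φ : Fin k → (x : X) → V x →ₗ[ℝ] ℝ), (∀ i, φ i ∈ S) ∧
      ∀ x, ∀ u : V x, (∀ i, φ i x u = 0) → u = 0 := by
  have := ChartedSpace.locallyCompactSpace (EuclideanSpace ℝ (Fin d)) X
  -- The shift makes `K 0` empty, so the shells `A n` cover `X` from `n = 0` on, and the truncated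
  -- `n - 1` in `U 0` is harmless.
  let K : CompactExhaustion X := (CompactExhaustion.choice X).shiftr
  have hK0 : K 0 = ∅ := rfl
  let A : ℕ → Set X := fun n => K (n + 1) \ interior (K n)
  let U : ℕ → Set X := fun n => interior (K (n + 2)) \ K (n - 1)
  have hA : ∀ n, IsCompact (A n) := fun n => (K.isCompact _).diff isOpen_interior
  have hU : ∀ n, IsOpen (U n) := fun n => isOpen_interior.sdiff (K.isCompact _).isClosed
  have hAU : ∀ n, A n ⊆ U n := by
    rintro n x ⟨hx, hx'⟩
    refine ⟨K.subset_interior_succ _ hx, fun h => ?_⟩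
    rcases n with _ | n
    · exact (hK0 ▸ h : x ∈ (∅ : Set X)).elim
    · exact hx' (K.subset_interior_succ _ h)
  -- Only neighbouring shells can meet, so the indices in one residue class modulo `3` give disjoint
  -- sets.
  have hUd : ∀ m n, m + 3 ≤ n → Disjoint (U m) (U n) := by
    intro m n hmn
    refine Set.disjoint_left.2 fun x hx hx' => hx'.2 ?_
    exact K.subset (by omega) (interior_subset hx.1)
  have hUf : LocallyFinite U := by
    intro x
    obtain ⟨N, hN⟩ := K.exists_mem x
    refine ⟨interior (K (N + 1)), isOpen_interior.mem_nhds (K.subset_interior_succ _ hN),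
      (Set.finite_lt_nat (N + 2)).subset ?_⟩
    rintro n ⟨y, hy, hy'⟩
    by_contra hn
    exact hy.2 (K.subset (by have : ¬ n < N + 2 := hn; omega) (interior_subset hy'))
  choose φ hφ hφs using fun n => exists_separating_bounded_of_isCompact S hS hloc (hA n)
  have hinj : ∀ c : ℕ, Function.Injective (fun n : ℕ => 3 * n + c) := fun c m n h => by
    simpa using h
  -- Each shell carries the same number of functionals, so for every residue `c` and every position
  -- `i` the functionals on the shells `3 n + c` glue to one. Altogether `3 (d + rank)` functionals
  -- remain.
  choose ψ hψ hψA using fun (c : Fin 3) (i : Fin (d + Module.finrank ℝ F)) =>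
    hglue (fun n => φ (3 * n + c) i) (fun n => hφ _ i) (fun n => A (3 * n + c))
      (fun n => U (3 * n + c)) (fun n => hA _) (fun n => hU _) (fun n => hAU _)
      (fun m n hmn => by
        rcases lt_or_gt_of_ne hmn with h | h
        · exact hUd _ _ (by omega)
        · exact (hUd _ _ (by omega)).symm)
      (hUf.comp_injective (hinj c))
  let e := Fintype.equivFin (Fin 3 × Fin (d + Module.finrank ℝ F))
  refine ⟨_, fun j => ψ (e.symm j).1 (e.symm j).2, fun j => hψ _ _, fun x u hu => ?_⟩
  -- `K.find x` is the first index with `x ∈ K n`; it is positive because `K 0` is empty.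
  have hx : x ∈ A (K.find x - 1) := by
    have h1 := K.mem_find x
    have h0 : K.find x ≠ 0 := fun h => by rw [h, hK0] at h1; exact h1
    obtain ⟨n, hn⟩ : ∃ n, K.find x = n + 1 := ⟨K.find x - 1, by omega⟩
    rw [hn] at h1
    rw [hn, Nat.add_sub_cancel]
    refine ⟨h1, fun h => ?_⟩
    have := K.mem_iff_find_le.1 (interior_subset h)
    omega
  set n := K.find x - 1
  refine hφs n x hx u fun i => ?_
  have h := hu (e (⟨n % 3, Nat.mod_lt _ (by norm_num)⟩, i))
  have hn : 3 * (n / 3) + n % 3 = n := Nat.div_add_mod n 3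
  have h' := hψA ⟨n % 3, Nat.mod_lt _ (by norm_num)⟩ i (n / 3) x (by simpa [hn] using hx)
  simp only [Equiv.symm_apply_apply, h', hn] at h
  exact h

end Generic


/-! ### Dual frames -/

section DualFrame
variable {d : ℕ} {X : Type*} [TopologicalSpace X] [ChartedSpace (EuclideanSpace ℝ (Fin d)) X]
  [IsManifold (𝓡 d) ∞ X]
  {F : Type*} [NormedAddCommGroup F] [NormedSpace ℝ F] [FiniteDimensional ℝ F]
  {V : X → Type*} [TopologicalSpace (TotalSpace F V)] [∀ x, AddCommGroup (V x)]
  [∀ x, Module ℝ (V x)] [∀ x, TopologicalSpace (V x)] [FiberBundle F V] [VectorBundle ℝ F V]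
  [ContMDiffVectorBundle ∞ F V (𝓡 d)] [∀ x, IsTopologicalAddGroup (V x)]
  [∀ x, ContinuousSMul ℝ (V x)]

/-- A smooth section of the dual bundle. -/
def IsSmoothFunctional (d : ℕ) {X : Type*} [TopologicalSpace X]
    [ChartedSpace (EuclideanSpace ℝ (Fin d)) X]
    (F : Type*) [NormedAddCommGroup F] [NormedSpace ℝ F]
    {V : X → Type*} [TopologicalSpace (TotalSpace F V)] [∀ x, AddCommGroup (V x)]
    [∀ x, Module ℝ (V x)] [∀ x, TopologicalSpace (V x)] [FiberBundle F V] [VectorBundle ℝ F V]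
    (φ : (x : X) → V x →L[ℝ] ℝ) : Prop :=
  ContMDiff (𝓡 d) ((𝓡 d).prod 𝓘(ℝ, F →L[ℝ] ℝ)) ∞ (fun x =>
    TotalSpace.mk' (F →L[ℝ] ℝ) (E := fun y => V y →L[ℝ] Bundle.Trivial X ℝ y) x (φ x))

/-- Stated for sections along a map `b`, so that it serves both for sections over `X` and for the
tautological section over the total space. -/
lemma IsSmoothFunctional.apply {E' H' M : Type*} [NormedAddCommGroup E'] [NormedSpace ℝ E']
    [TopologicalSpace H'] {I' : ModelWithCorners ℝ E' H'} [TopologicalSpace M] [ChartedSpace H' M]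
    {φ : (x : X) → V x →L[ℝ] ℝ} (hφ : IsSmoothFunctional d F φ) {n : WithTop ℕ∞} (hn : n ≤ ∞)
    {b : M → X} {s : (m : M) → V (b m)} {U : Set M} {m : M}
    (hs : ContMDiffWithinAt I' ((𝓡 d).prod 𝓘(ℝ, F)) n (fun m => TotalSpace.mk' F (b m) (s m)) U m) :
    ContMDiffWithinAt I' 𝓘(ℝ) n (fun m => φ (b m) (s m)) U m := by
  have hb : ContMDiffWithinAt I' (𝓡 d) n b U m := (contMDiffWithinAt_totalSpace.1 hs).1
  have h1 := ((hφ (b m)).of_le hn).comp_contMDiffWithinAt m hb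
  have h2 := ContMDiffWithinAt.clm_bundle_apply (E₂ := Bundle.Trivial X ℝ) h1 hs
  exact (contMDiffWithinAt_totalSpace.1 h2).2

/-- The endomorphism of the model fibre given by `u ↦ ∑ φᵢ(u) wᵢ` in a trivialization. -/
def frameOperator {k : ℕ} (φ : Fin k → (x : X) → V x →L[ℝ] ℝ)
    (e : Trivialization F (TotalSpace.proj : TotalSpace F V → X)) [MemTrivializationAtlas e]
    (w : Fin k → F) (x : X) : F →L[ℝ] F :=
  ∑ i, ((φ i x).comp (e.symmL ℝ x)).smulRight (w i)

/-- In a basis of the model fibre the operator is a sum of constant operators whose coefficients are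
the smooth functions `φ i` applied to local frame sections. -/
lemma contMDiffOn_frameOperator {k : ℕ} {φ : Fin k → (x : X) → V x →L[ℝ] ℝ}
    (hφ : ∀ i, IsSmoothFunctional d F (φ i))
    (e : Trivialization F (TotalSpace.proj : TotalSpace F V → X)) [MemTrivializationAtlas e]
    (w : Fin k → F) :
    ContMDiffOn (𝓡 d) 𝓘(ℝ, F →L[ℝ] F) ∞ (frameOperator φ e w) e.baseSet := by
  let b := Module.finBasis ℝ F
  have h : ∀ x, frameOperator φ e w x = ∑ i, ∑ j, (φ i x (e.symmL ℝ x (b j))) •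
      (LinearMap.toContinuousLinearMap (b.coord j)).smulRight (w i) := by
    intro x
    refine ContinuousLinearMap.ext fun u => ?_
    simp only [frameOperator, sum_apply]
    refine Finset.sum_congr rfl fun i _ => ?_
    have hu : φ i x (e.symmL ℝ x u) = ∑ j, φ i x (e.symmL ℝ x (b j)) * b.repr u j := by
      conv_lhs => rw [← b.sum_repr u, map_sum, map_sum]
      exact Finset.sum_congr rfl fun j _ => by rw [map_smul, map_smul, smul_eq_mul, mul_comm]
    rw [ContinuousLinearMap.smulRight_apply, ContinuousLinearMap.comp_apply, hu, Finset.sum_smul]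
    simp [smul_smul, -Trivialization.symmL_apply]
  simp only [funext h]
  refine contMDiffOn_finsetSum fun i _ => contMDiffOn_finsetSum fun j _ =>
    ContMDiffOn.smul (I := 𝓘(ℝ, ℝ)) (f := fun x => φ i x (e.symmL ℝ x (b j))) (g := fun _ =>
      (LinearMap.toContinuousLinearMap (b.coord j)).smulRight (w i)) ?_ contMDiffOn_const
  intro x hx
  have h1 := (e.contMDiffAt_symmL (n := ∞) (IB := 𝓡 d) hx).contMDiffWithinAt (s := e.baseSet)
  have h2 : ContMDiffWithinAt (𝓡 d) ((𝓡 d).prod 𝓘(ℝ, F)) ∞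
      (fun x => TotalSpace.mk' F (E := Bundle.Trivial X F) x (b j)) e.baseSet x :=
    (Bundle.contMDiffWithinAt_section).2 contMDiffWithinAt_const
  exact (hφ i).apply le_rfl (b := fun x => x)
    (ContMDiffWithinAt.clm_bundle_apply (E₁ := Bundle.Trivial X F) h1 h2)

/-- Finitely many smooth functionals which separate the points of `V x₀` have a smooth dual frame
near `x₀`. -/
lemma exists_local_dualFrame {k : ℕ} {φ : Fin k → (x : X) → V x →L[ℝ] ℝ}
    (hφ : ∀ i, IsSmoothFunctional d F (φ i)) (x₀ : X)
    (hsep : ∀ u : V x₀, (∀ i, φ i x₀ u = 0) → u = 0) :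
    ∃ U ∈ 𝓝 x₀, ∃ l : Fin k → (x : X) → V x, (∀ i, ContMDiffOn (𝓡 d) ((𝓡 d).prod 𝓘(ℝ, F)) ∞
      (fun x => TotalSpace.mk' F x (l i x)) U) ∧ ∀ x ∈ U, ∀ u, ∑ i, φ i x u • l i x = u := by
  let e := trivializationAt F V x₀
  have hx₀ : x₀ ∈ e.baseSet := FiberBundle.mem_baseSet_trivializationAt' x₀
  let J : F →ₗ[ℝ] (Fin k → ℝ) := LinearMap.pi fun i => ((φ i x₀).comp (e.symmL ℝ x₀)).toLinearMap
  have hJ : LinearMap.ker J = ⊥ := by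
    refine (LinearMap.ker_eq_bot').2 fun u hu => ?_
    have h := hsep (e.symmL ℝ x₀ u) fun i => congrFun hu i
    have h' := e.continuousLinearMapAt_symmL (R := ℝ) hx₀ u
    rw [h, map_zero] at h'
    exact h'.symm
  obtain ⟨L, hL⟩ := J.exists_leftInverse_of_injective hJ
  -- The columns of a left inverse of the injection `(φ i)` at `x₀`; they make the frame operator
  -- `G` equal to `1` at `x₀`, hence invertible nearby.
  let w : Fin k → F := fun i => L (Pi.single i 1)
  have hG₀ : frameOperator φ e w x₀ = 1 := by
    refine ContinuousLinearMap.ext fun u => ?_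
    have h := LinearMap.congr_fun hL u
    rw [LinearMap.comp_apply, L.pi_apply_eq_sum_univ] at h
    have hsingle : ∀ i : Fin k, (fun j => if i = j then (1 : ℝ) else 0) = Pi.single i 1 :=
      fun i => funext fun j => by simp [Pi.single_apply, eq_comm]
    simpa [frameOperator, hsingle, J, w] using h
  have hG := contMDiffOn_frameOperator hφ e w
  have hGc : ContinuousAt (frameOperator φ e w) x₀ :=
    (hG.continuousOn x₀ hx₀).continuousAt (e.open_baseSet.mem_nhds hx₀)
  have : CompleteSpace F := FiniteDimensional.complete ℝ F
  -- The dual frame is `e⁻¹ G⁻¹ w i`. Indeed `∑ φ i u • w i = G (e u)`, which `e⁻¹ G⁻¹` sends back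
  -- to `u`.
  refine ⟨e.baseSet ∩ frameOperator φ e w ⁻¹' {T | IsUnit T},
    Filter.inter_mem (e.open_baseSet.mem_nhds hx₀)
      (hGc.preimage_mem_nhds (Units.isOpen.mem_nhds (by rw [hG₀]; exact isUnit_one))),
    fun i x => e.symmL ℝ x (Ring.inverse (frameOperator φ e w x) (w i)), fun i x hx => ?_, ?_⟩
  · have h1 := (e.contMDiffAt_symmL (n := ∞) (IB := 𝓡 d) hx.1).contMDiffWithinAt
      (s := e.baseSet ∩ frameOperator φ e w ⁻¹' {T | IsUnit T})
    obtain ⟨g, hg⟩ := hx.2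
    have h2 : ContMDiffWithinAt (𝓡 d) 𝓘(ℝ, F →L[ℝ] F) ∞
        (fun x => Ring.inverse (frameOperator φ e w x))
        (e.baseSet ∩ frameOperator φ e w ⁻¹' {T | IsUnit T}) x := by
      have := (contDiffAt_ringInverse ℝ (n := ∞) g).contMDiffAt
      rw [hg] at this
      exact this.comp_contMDiffWithinAt x ((hG x hx.1).mono inter_subset_left)
    have h3 : ContMDiffWithinAt (𝓡 d) ((𝓡 d).prod 𝓘(ℝ, F)) ∞
        (fun x => TotalSpace.mk' F (E := Bundle.Trivial X F) x
          (Ring.inverse (frameOperator φ e w x) (w i)))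
        (e.baseSet ∩ frameOperator φ e w ⁻¹' {T | IsUnit T}) x :=
      (Bundle.contMDiffWithinAt_section).2 (h2.clm_apply contMDiffWithinAt_const)
    exact ContMDiffWithinAt.clm_bundle_apply (E₁ := Bundle.Trivial X F) h1 h3
  · rintro x ⟨hx, hxu⟩ u
    have h1 : e.symmL ℝ x (e.continuousLinearMapAt ℝ x u) = u :=
      e.symmL_continuousLinearMapAt (R := ℝ) hx u
    have h2 : ∑ i, φ i x u • w i = frameOperator φ e w x (e.continuousLinearMapAt ℝ x u) := by
      simp [frameOperator, -Trivialization.continuousLinearMapAt_apply, -Trivialization.symmL_apply,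
        h1]
    simp only [← map_smul, ← map_sum]
    rw [h2, ← mul_apply_eq_comp, Ring.inverse_mul_cancel _ hxu]
    exact h1

/-- Finitely many smooth functionals which separate the points of all fibres have a global smooth
dual frame. -/
theorem exists_dualFrame [T2Space X] [SecondCountableTopology X] {k : ℕ} {φ : Fin k → (x : X) → V x →L[ℝ] ℝ}
    (hφ : ∀ i, IsSmoothFunctional d F (φ i))
    (hsep : ∀ x, ∀ u : V x, (∀ i, φ i x u = 0) → u = 0) :
    ∃ l : Fin k → (x : X) → V x, (∀ i, ContMDiff (𝓡 d) ((𝓡 d).prod 𝓘(ℝ, F)) ∞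
      (fun x => TotalSpace.mk' F x (l i x))) ∧ ∀ x, ∀ u, ∑ i, φ i x u • l i x = u := by
  have := ChartedSpace.locallyCompactSpace (EuclideanSpace ℝ (Fin d)) X
  choose W hW l hl hlφ using fun x₀ => exists_local_dualFrame hφ x₀ (hsep x₀)
  obtain ⟨ρ, hρ⟩ := SmoothPartitionOfUnity.exists_isSubordinate (𝓡 d) isClosed_univ
    (fun x => interior (W x)) (fun _ => isOpen_interior)
    (fun x _ => mem_iUnion.2 ⟨x, mem_interior_iff_mem_nhds.2 (hW x)⟩)
  refine ⟨fun i x => ∑ᶠ j, ρ j x • l j i x, fun i => ?_, fun x u => ?_⟩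
  · refine ContMDiff.finsum_section_of_locallyFinite ?_ fun j => ?_
    · refine ρ.locallyFinite.subset fun j x hx => ?_
      exact left_ne_zero_of_smul hx
    · exact ContMDiffOn.smul_section_of_tsupport (ψ := ρ j) ((ρ j).contMDiff.contMDiffOn)
        isOpen_interior (hρ j) ((hl j i).mono interior_subset)
  -- Being a dual frame is an affine condition on the family `l`, so it survives averaging with a
  -- partition of unity.
  · have hc : Convex ℝ {m : Fin k → V x | ∑ i, φ i x u • m i = u} := by
      intro m hm m' hm' a b _ _ hab
      change ∑ i, φ i x u • (a • m i + b • m' i) = u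
      simp only [smul_add, Finset.sum_add_distrib, smul_comm _ a, smul_comm _ b, ← Finset.smul_sum]
      rw [show ∑ i, φ i x u • m i = u from hm, show ∑ i, φ i x u • m' i = u from hm', ← add_smul,
        hab, one_smul]
    have h := hc.finsum_mem (w := fun j => ρ j x) (z := fun j i => l j i x)
      (fun j => ρ.nonneg j x) (ρ.sum_eq_one (mem_univ x)) fun j hj =>
        hlφ j x (interior_subset (hρ j (subset_closure hj))) u
    have hfin : (Function.support fun j => ρ j x • fun i => l j i x).Finite := by
      refine (ρ.locallyFinite.point_finite x).subset fun j hj => ?_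
      exact left_ne_zero_of_smul hj
    have h' : (∑ᶠ j, ρ j x • fun i => l j i x) = fun i => ∑ᶠ j, ρ j x • l j i x := by
      funext i
      exact finsum_apply hfin i
    rw [h'] at h
    exact h

end DualFrame


/-! ### Finitely many generating sections and coordinate functions -/

section FiniteGeneration
variable {d : ℕ} {X : Type*} [TopologicalSpace X] [ChartedSpace (EuclideanSpace ℝ (Fin d)) X]
  [IsManifold (𝓡 d) ∞ X]

lemma EuclideanBundle.isSmoothFunctional_inner (B : EuclideanBundle d X) {s : (x : X) → B.V x}
    (hs : B.SmoothSection s) : IsSmoothFunctional d B.F (fun x => B.metric.inner x (s x)) := by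
  intro x
  exact ContMDiffAt.clm_bundle_apply (E₂ := fun y => B.V y →L[ℝ] Bundle.Trivial X ℝ y)
    (B.metric.contMDiff x) (hs x)

lemma isSmoothFunctional_mvfderiv {f : X → ℝ} (hf : ContMDiff (𝓡 d) 𝓘(ℝ) ∞ f) :
    IsSmoothFunctional d (EuclideanSpace ℝ (Fin d)) (V := TangentSpace (𝓡 d))
      (mvfderiv (𝓡 d) f) := fun x => contMDiffAt_mvfderiv_section (hf x)

lemma IsSmoothFunctional.contMDiff_totalSpace {F : Type*} [NormedAddCommGroup F] [NormedSpace ℝ F]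
    {V : X → Type*} [TopologicalSpace (TotalSpace F V)] [∀ x, AddCommGroup (V x)]
    [∀ x, Module ℝ (V x)] [∀ x, TopologicalSpace (V x)] [FiberBundle F V] [VectorBundle ℝ F V]
    [FiniteDimensional ℝ F]
    [ContMDiffVectorBundle ∞ F V (𝓡 d)] [∀ x, IsTopologicalAddGroup (V x)]
    [∀ x, ContinuousSMul ℝ (V x)]
    {φ : (x : X) → V x →L[ℝ] ℝ} (hφ : IsSmoothFunctional d F φ) :
    ContMDiff ((𝓡 d).prod 𝓘(ℝ, F)) 𝓘(ℝ) ∞ (fun p : TotalSpace F V => φ p.1 p.2) := fun _ =>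
  hφ.apply le_rfl (b := fun p : TotalSpace F V => p.1) (s := fun p => p.2) contMDiffWithinAt_id

variable [T2Space X] [SecondCountableTopology X]

/-- The value `1` is attained near `A n` and not just on it, so that multiplication by the cutoff
also preserves differentials on `A n`. -/
lemma exists_cutoffs {A U : ℕ → Set X} (hA : ∀ n, IsCompact (A n)) (hU : ∀ n, IsOpen (U n))
    (hAU : ∀ n, A n ⊆ U n) : ∃ χ : ℕ → X → ℝ, (∀ n, ContMDiff (𝓡 d) 𝓘(ℝ) ∞ (χ n)) ∧
      (∀ n, ∀ x ∈ A n, ∀ᶠ y in 𝓝 x, χ n y = 1) ∧ ∀ n, ∀ x ∉ U n, χ n x = 0 := by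
  have := ChartedSpace.locallyCompactSpace (EuclideanSpace ℝ (Fin d)) X
  choose χ h1 h0 _ using fun n => exists_contMDiffMap_one_nhds_of_subset_interior (n := ⊤)
    (𝓡 d) (hA n).isClosed (t := U n) ((hAU n).trans (hU n).interior_eq.symm.subset)
  refine ⟨fun n => χ n, fun n => (χ n).contMDiff, fun n x hx => ?_, h0⟩
  exact (Filter.Eventually.filter_mono (nhds_le_nhdsSet hx) (h1 n))

/-- Finitely many smooth sections span every fibre. -/
theorem EuclideanBundle.exists_generating (B : EuclideanBundle d X) :
    ∃ (k : ℕ) (s : Fin k → (x : X) → B.V x), (∀ i, B.SmoothSection (s i)) ∧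
      ∀ x u, (∀ i, B.metric.inner x (s i x) u = 0) → u = 0 := by
  -- Functionals represented through the metric by smooth sections; separation of points by them is
  -- spanning by the sections.
  let S : Submodule ℝ ((x : X) → B.V x →ₗ[ℝ] ℝ) :=
    { carrier := {φ | ∃ s, B.SmoothSection s ∧ ∀ x u, φ x u = B.metric.inner x (s x) u}
      add_mem' := by
        rintro φ ψ ⟨s, hs, h⟩ ⟨t, ht, h'⟩
        exact ⟨s + t, ContMDiff.add_section hs ht, fun x u => by simp [h, h']⟩
      zero_mem' := ⟨0, contMDiff_zeroSection ℝ B.V, fun x u => by simp⟩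
      smul_mem' := by
        rintro a φ ⟨s, hs, h⟩
        exact ⟨a • s, ContMDiff.const_smul_section hs, fun x u => by simp [h]⟩ }
  refine (exists_separating_of_glue (d := d) (F := B.F) S ?_ ?_ ?_).elim fun k h => ?_
  · rintro φ ⟨s, hs, h⟩
    simp only [h]
    exact (B.isSmoothFunctional_inner hs).contMDiff_totalSpace.of_le (by simp)
  · intro x₀
    let e := trivializationAt B.F B.V x₀
    have hx₀ : x₀ ∈ e.baseSet := FiberBundle.mem_baseSet_trivializationAt' x₀
    let b := Module.finBasis ℝ B.F
    -- Sections constant in the trivialization at `x₀`, cut off to global ones. Near `x₀` a vector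
    -- orthogonal to all of them is orthogonal to itself.
    choose s hs hsb using fun i => exists_smooth_cutoff B (B.smoothNear_extend (e.symmL ℝ x₀ (b i)))
    refine ⟨_, fun i x => (B.metric.inner x (s i x)).toLinearMap, fun i => ⟨s i, hs i, fun _ _ => rfl⟩,
      ?_⟩
    filter_upwards [e.open_baseSet.mem_nhds hx₀, Filter.eventually_all.2 hsb] with x hx hsx u hu
    have h1 : ∀ i, s i x = e.symmL ℝ x (b i) := fun i => by
      rw [hsx i, FiberBundle.extend, e.symmL_apply hx]
      congr 1
      have h := e.continuousLinearMapAt_symmL (R := ℝ) hx₀ (b i)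
      rwa [e.continuousLinearMapAt_apply (R := ℝ), e.coe_linearMapAt_of_mem hx₀] at h
    have h2 : ∀ w, B.metric.inner x (e.symmL ℝ x w) u = 0 := fun w => by
      rw [← b.sum_repr w]
      simp only [map_sum, map_smul, sum_apply, smul_apply]
      exact Finset.sum_eq_zero fun i _ => by rw [← h1, show B.metric.inner x (s i x) u = 0 from hu i,
        smul_zero]
    by_contra hne
    have h3 := h2 (e.continuousLinearMapAt ℝ x u)
    rw [e.symmL_continuousLinearMapAt (R := ℝ) hx u] at h3
    exact (B.metric.pos x u hne).ne' h3
  · intro φ hφ A U hA hU hAU hUd hUf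
    choose s hs hφs using hφ
    obtain ⟨χ, hχ, hχ1, hχ0⟩ := exists_cutoffs (d := d) hA hU hAU
    have hsupp : ∀ n x, χ n x ≠ 0 → x ∈ U n := fun n x h => by
      by_contra h'
      exact h (hχ0 n x h')
    -- Glue the representing sections as `∑ χ n • s n`. On `A n` only the `n`-th term survives,
    -- since the sets `U m` are disjoint.
    refine ⟨fun x => ∑ n ∈ (hUf.point_finite x).toFinset, χ n x • φ n x,
      ⟨fun x => ∑ᶠ n, χ n x • s n x, ?_, fun x u => ?_⟩, fun n x hx => ?_⟩
    · refine ContMDiff.finsum_section_of_locallyFinite (hUf.subset fun n x hx => ?_) fun n => ?_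
      · exact hsupp n x (left_ne_zero_of_smul hx)
      · exact ContMDiff.smul_section (hχ n) (hs n)
    · dsimp only
      rw [finsum_eq_sum_of_support_subset (s := (hUf.point_finite x).toFinset)]
      · simp [hφs]
      · intro n hn
        have := hsupp n x (left_ne_zero_of_smul hn)
        simpa using this
    · dsimp only
      rw [Finset.sum_eq_single n]
      · rw [(hχ1 n x hx).self_of_nhds, one_smul]
      · intro m _ hm
        rw [hχ0 m x (Set.disjoint_left.1 (hUd hm.symm) (hAU n hx)), zero_smul]
      · intro h
        exact absurd (hAU n hx) (by simpa using h)
  · obtain ⟨φ, hφ, hsep⟩ := h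
    choose s hs hφs using hφ
    exact ⟨k, s, hs, fun x u hu => hsep x u fun i => (hφs i x u).trans (hu i)⟩

variable (d X) in
/-- Finitely many smooth functions whose differentials span every cotangent space. -/
theorem exists_differentials_separating :
    ∃ (k : ℕ) (f : Fin k → X → ℝ), (∀ i, ContMDiff (𝓡 d) 𝓘(ℝ) ∞ (f i)) ∧
      ∀ (x : X) (v : TangentSpace (𝓡 d) x), (∀ i, mvfderiv (𝓡 d) (f i) x v = 0) → v = 0 := by
  have hmd : ∀ {f : X → ℝ}, ContMDiff (𝓡 d) 𝓘(ℝ) ∞ f → ∀ x, MDifferentiableAt (𝓡 d) 𝓘(ℝ) f x :=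
    fun hf x => (hf x).mdifferentiableAt (by simp)
  let S : Submodule ℝ ((x : X) → TangentSpace (𝓡 d) x →ₗ[ℝ] ℝ) :=
    { carrier := {φ | ∃ f, ContMDiff (𝓡 d) 𝓘(ℝ) ∞ f ∧ ∀ x v, φ x v = mvfderiv (𝓡 d) f x v}
      add_mem' := by
        rintro φ ψ ⟨s, hs, h⟩ ⟨t, ht, h'⟩
        exact ⟨s + t, hs.add ht, fun x u => by
          rw [mvfderiv_add (hmd hs x) (hmd ht x)]; simp [h, h']⟩
      zero_mem' := ⟨0, contMDiff_const, fun x u => by rw [mvfderiv_zero]; rfl⟩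
      smul_mem' := by
        rintro a φ ⟨s, hs, h⟩
        refine ⟨(fun _ => a) • s, ContMDiff.smul (I := 𝓘(ℝ, ℝ)) contMDiff_const hs, fun x u => ?_⟩
        rw [mvfderiv_smul mdifferentiableAt_const (hmd hs x), mvfderiv_const]
        simp [h] }
  refine (exists_separating_of_glue (d := d) (F := EuclideanSpace ℝ (Fin d)) S ?_ ?_ ?_).elim
    fun k h => ?_
  · rintro φ ⟨s, hs, h⟩
    simp only [h]
    exact (isSmoothFunctional_mvfderiv hs).contMDiff_totalSpace.of_le (by simp)
  · intro x₀
    obtain ⟨χ⟩ : Nonempty (SmoothBumpFunction (𝓡 d) x₀) := inferInstance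
    let pr : Fin d → EuclideanSpace ℝ (Fin d) →L[ℝ] ℝ := fun i => EuclideanSpace.proj i
    -- Chart coordinates times a bump function; near `x₀` their differentials are the components of
    -- the derivative of the chart, which is injective.
    let f : Fin d → X → ℝ := fun i x => χ x • (extChartAt (𝓡 d) x₀ x) i
    have hcoord : ∀ i, ContMDiffOn (𝓡 d) 𝓘(ℝ) ∞ (fun x => (extChartAt (𝓡 d) x₀ x) i)
        (chartAt (EuclideanSpace ℝ (Fin d)) x₀).source := fun i =>
      (pr i).contMDiff.comp_contMDiffOn
        contMDiffOn_extChartAt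
    have hf : ∀ i, ContMDiff (𝓡 d) 𝓘(ℝ) ∞ (f i) := fun i => χ.contMDiff_smul (hcoord i)
    refine ⟨d, fun i x => (mvfderiv (𝓡 d) (f i) x).toLinearMap, fun i => ⟨f i, hf i, fun _ _ => rfl⟩,
      ?_⟩
    filter_upwards [χ.eventuallyEq_one.eventually_nhds, extChartAt_source_mem_nhds (I := 𝓡 d) x₀]
      with x hx hxs v hv
    have hinv := isInvertible_mfderiv_extChartAt (I := 𝓡 d) hxs
    refine hinv.injective ?_
    rw [map_zero]
    have hmdx : MDifferentiableAt (𝓡 d) 𝓘(ℝ, EuclideanSpace ℝ (Fin d)) (extChartAt (𝓡 d) x₀) x :=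
      mdifferentiableAt_extChartAt (by simpa using hxs)
    refine PiLp.ext fun i => ?_
    have h1 : f i =ᶠ[𝓝 x] (pr i) ∘
        extChartAt (𝓡 d) x₀ := by
      filter_upwards [hx] with y hy
      simp [f, pr, hy]
    have h2 : mvfderiv (𝓡 d) (f i) x v = 0 := hv i
    have h3 : mfderiv (𝓡 d) 𝓘(ℝ) (f i) x v = 0 := h2
    rw [h1.mfderiv_eq, mfderiv_comp x
      (pr i).mdifferentiableAt hmdx,
      ContinuousLinearMap.mfderiv_eq] at h3
    exact h3
  · intro φ hφ A U hA hU hAU hUd hUf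
    choose f hf hφf using hφ
    obtain ⟨χ, hχ, hχ1, hχ0⟩ := exists_cutoffs (d := d) hA hU hAU
    have hsupp : ∀ n x, χ n x ≠ 0 → x ∈ U n := fun n x h => by
      by_contra h'
      exact h (hχ0 n x h')
    -- The functions are glued, not their differentials, so that the result is again a differential.
    -- Near `A n` the function `g` agrees with `f n`.
    let g : X → ℝ := fun x => ∑ᶠ n, χ n x • f n x
    have hg : ContMDiff (𝓡 d) 𝓘(ℝ) ∞ g := by
      refine contMDiff_finsum (fun n => (hχ n).smul (hf n)) (hUf.subset fun n x hx => ?_)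
      exact hsupp n x (left_ne_zero_of_smul hx)
    refine ⟨fun x => (mvfderiv (𝓡 d) g x).toLinearMap, ⟨g, hg, fun _ _ => rfl⟩, fun n x hx => ?_⟩
    have h1 : g =ᶠ[𝓝 x] f n := by
      filter_upwards [hχ1 n x hx, (hU n).mem_nhds (hAU n hx)] with y hy hyU
      refine (finsum_eq_single _ n fun m hm => ?_).trans (by rw [hy, one_smul])
      rw [hχ0 m y (Set.disjoint_left.1 (hUd hm.symm) hyU), zero_smul]
    refine LinearMap.ext fun v => ?_
    rw [hφf]
    change mfderiv (𝓡 d) 𝓘(ℝ) g x v = mfderiv (𝓡 d) 𝓘(ℝ) (f n) x v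
    rw [h1.mfderiv_eq]
    rfl
  · obtain ⟨φ, hφ, hsep⟩ := h
    choose s hs hφs using hφ
    exact ⟨k, s, hs, fun x u hu => hsep x u fun i => (hφs i x u).trans (hu i)⟩

end FiniteGeneration


/-! ### Parseval frames -/

section Parseval
variable {d : ℕ} {X : Type*} [TopologicalSpace X] [ChartedSpace (EuclideanSpace ℝ (Fin d)) X]

/-- Smooth Cholesky decomposition of a smooth positive definite matrix. -/
theorem exists_smooth_cholesky : ∀ (n : ℕ) (h : Fin n → Fin n → X → ℝ),
    (∀ i j, ContMDiff (𝓡 d) 𝓘(ℝ) ∞ (h i j)) → (∀ i j x, h i j x = h j i x) →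
    (∀ x, ∀ u : Fin n → ℝ, u ≠ 0 → 0 < ∑ i, ∑ j, h i j x * (u i * u j)) →
    ∃ c : Fin n → Fin n → X → ℝ, (∀ i j, ContMDiff (𝓡 d) 𝓘(ℝ) ∞ (c i j)) ∧
      ∀ i j x, ∑ l, c l i x * c l j x = h i j x
  | 0, _, _, _, _ => ⟨fun _ _ _ => 0, fun i => i.elim0, fun i => i.elim0⟩
  | n + 1, h, hs, hsymm, hpos => by
    have h0 : ∀ x, 0 < h 0 0 x := fun x => by
      have := hpos x (Pi.single 0 1) (by simp)
      simpa [Pi.single_apply, Finset.sum_ite_eq'] using this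
    -- Induction on the Schur complement of the upper left entry.
    obtain ⟨c, hc, hch⟩ := exists_smooth_cholesky n
      (fun i j x => h i.succ j.succ x - h 0 i.succ x * h 0 j.succ x / h 0 0 x)
      (fun i j => (hs _ _).sub (((hs _ _).mul (hs _ _)).div₀ (hs _ _) fun x => (h0 x).ne'))
      (fun i j x => by rw [hsymm i.succ j.succ, mul_comm (h 0 i.succ x)])
      (fun x u hu => by
        -- The Schur complement at `u` is the value of the full form at `u` extended by the zeroth
        -- coordinate that minimizes it, hence positive.
        have hne : (Fin.cons (-(∑ j, h 0 j.succ x * u j) / h 0 0 x) u : Fin (n + 1) → ℝ) ≠ 0 :=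
          fun h' => hu (funext fun i => by simpa using congrFun h' i.succ)
        have key := hpos x _ hne
        simp only [Fin.sum_univ_succ, Fin.cons_zero, Fin.cons_succ] at key
        have e1 : ∑ j : Fin n, h 0 j.succ x * (-(∑ j, h 0 j.succ x * u j) / h 0 0 x * u j) =
            (-(∑ j, h 0 j.succ x * u j) / h 0 0 x) * ∑ j, h 0 j.succ x * u j := by
          rw [Finset.mul_sum]
          exact Finset.sum_congr rfl fun j _ => by ring
        have e2 : ∑ i : Fin n, h i.succ 0 x * (u i * (-(∑ j, h 0 j.succ x * u j) / h 0 0 x)) =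
            (-(∑ j, h 0 j.succ x * u j) / h 0 0 x) * ∑ j, h 0 j.succ x * u j := by
          rw [Finset.mul_sum]
          exact Finset.sum_congr rfl fun j _ => by rw [hsymm j.succ 0]; ring
        have e3 : ∑ i : Fin n, ∑ j : Fin n,
            (h i.succ j.succ x - h 0 i.succ x * h 0 j.succ x / h 0 0 x) * (u i * u j) =
            ∑ i : Fin n, ∑ j : Fin n, h i.succ j.succ x * (u i * u j) -
              (∑ j, h 0 j.succ x * u j) * (∑ j, h 0 j.succ x * u j) / h 0 0 x := by
          rw [Finset.sum_mul_sum, Finset.sum_div, ← Finset.sum_sub_distrib]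
          refine Finset.sum_congr rfl fun i _ => ?_
          rw [Finset.sum_div, ← Finset.sum_sub_distrib]
          exact Finset.sum_congr rfl fun j _ => by ring
        rw [Finset.sum_add_distrib, e1, e2] at key
        rw [e3]
        have h00 := (h0 x).ne'
        convert key using 1
        field_simp
        ring)
    have hsqrt : ContMDiff (𝓡 d) 𝓘(ℝ) ∞ (fun x => √(h 0 0 x)) := fun x =>
      (Real.contDiffAt_sqrt (h0 x).ne').contMDiffAt.comp x (hs 0 0 x)
    have hsq : ∀ x, √(h 0 0 x) * √(h 0 0 x) = h 0 0 x := fun x => Real.mul_self_sqrt (h0 x).le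
    have hsq0 : ∀ x, √(h 0 0 x) ≠ 0 := fun x => (Real.sqrt_pos.2 (h0 x)).ne'
    -- The new first row is `h 0 j / √(h 0 0)`; the other rows begin with `0` and continue with the
    -- factor of the Schur complement.
    refine ⟨Fin.cons (fun j x => h 0 j x / √(h 0 0 x))
      (fun l => Fin.cons (fun _ => 0) (fun j => c l j)), ?_, ?_⟩
    · refine Fin.cases (fun j => ?_) (fun l => Fin.cases ?_ fun j => ?_)
      · exact (hs 0 j).div₀ hsqrt hsq0
      · simpa using contMDiff_const
      · simpa using hc l j
    · have e : ∀ a b x, a / √(h 0 0 x) * (b / √(h 0 0 x)) = a * b / h 0 0 x := fun a b x => by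
        rw [div_mul_div_comm, hsq]
      refine Fin.cases (Fin.cases (fun x => ?_) fun j x => ?_)
        (fun i => Fin.cases (fun x => ?_) fun j x => ?_)
      · have := (h0 x).ne'
        simp [Fin.sum_univ_succ, hsq]
      · have := (h0 x).ne'
        simp only [Fin.sum_univ_succ, Fin.cons_zero, Fin.cons_succ, e]
        simp [this]
      · have := (h0 x).ne'
        simp only [Fin.sum_univ_succ, Fin.cons_zero, Fin.cons_succ, e]
        simp [this, hsymm i.succ 0]
      · simp only [Fin.sum_univ_succ, Fin.cons_zero, Fin.cons_succ, e, hch]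
        ring

variable [IsManifold (𝓡 d) ∞ X]

lemma EuclideanBundle.ext_inner (B : EuclideanBundle d X) {x : X} {u v : B.V x}
    (h : ∀ w, B.metric.inner x u w = B.metric.inner x v w) : u = v := by
  by_contra hne
  have h2 := B.metric.pos x (u - v) (sub_ne_zero.2 hne)
  rw [map_sub, B.metric.symm x _ u, B.metric.symm x _ v, h, sub_self] at h2
  exact lt_irrefl _ h2

lemma EuclideanBundle.inner_self_nonneg (B : EuclideanBundle d X) {x : X} (u : B.V x) :
    0 ≤ B.metric.inner x u u := by
  by_cases h : u = 0
  · simp [h]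
  · exact (B.metric.pos x u h).le

lemma EuclideanBundle.contMDiff_inner (B : EuclideanBundle d X) {s t : (x : X) → B.V x}
    (hs : B.SmoothSection s) (ht : B.SmoothSection t) :
    ContMDiff (𝓡 d) 𝓘(ℝ) ∞ (fun x => B.metric.inner x (s x) (t x)) := fun x =>
  (B.isSmoothFunctional_inner hs).apply le_rfl (b := fun x => x) (ht x)

/-- Smooth sections `sᵢ` of a Euclidean bundle with `∑ sᵢ ⊗ sᵢ` the inverse of the metric, that is,
such that `u ↦ (⟨sᵢ, u⟩)ᵢ` is an isometric embedding of the bundle in a product bundle. -/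
structure EuclideanBundle.IsParsevalFrame (B : EuclideanBundle d X) {ι : Type*} [Fintype ι]
    (s : ι → (x : X) → B.V x) : Prop where
  smooth : ∀ i, B.SmoothSection (s i)
  sum_inner : ∀ x u u', ∑ i, B.metric.inner x (s i x) u * B.metric.inner x (s i x) u' =
    B.metric.inner x u u'

/-- Pairing both sides with `w` turns this reconstruction formula into the Parseval identity. -/
lemma EuclideanBundle.IsParsevalFrame.sum_smul {B : EuclideanBundle d X} {ι : Type*} [Fintype ι]
    {s : ι → (x : X) → B.V x} (h : B.IsParsevalFrame s) (x : X) (u : B.V x) :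
    ∑ i, B.metric.inner x (s i x) u • s i x = u :=
  B.ext_inner fun w => by simp [h.sum_inner x u w]

/-- Every Euclidean bundle has a finite Parseval frame. -/
theorem EuclideanBundle.exists_isParsevalFrame [T2Space X] [SecondCountableTopology X]
    (B : EuclideanBundle d X) :
    ∃ (k : ℕ) (s : Fin k → (x : X) → B.V x), B.IsParsevalFrame s := by
  obtain ⟨k, s, hs, hsep⟩ := B.exists_generating
  obtain ⟨l, hl, hls⟩ := exists_dualFrame (d := d) (F := B.F)
    (fun i => B.isSmoothFunctional_inner (hs i)) hsep
  -- Write `S u = (⟨s i, u⟩)ᵢ` and `L y = ∑ y i • l i`, so that `L S = 1`. Then `M = 1 - S L` is the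
  -- projection onto `ker L` which vanishes on the image of `S`.
  let M : Fin k → Fin k → X → ℝ := fun a i x =>
    (if a = i then 1 else 0) - B.metric.inner x (s a x) (l i x)
  have hMs : ∀ a i, ContMDiff (𝓡 d) 𝓘(ℝ) ∞ (M a i) := fun a i =>
    contMDiff_const.sub (B.contMDiff_inner (hs a) (hl i))
  have hM : ∀ a x (u : Fin k → ℝ), ∑ i, M a i x * u i =
      u a - B.metric.inner x (s a x) (∑ i, u i • l i x) := fun a x u => by
    simp only [M, sub_mul, Finset.sum_sub_distrib, ite_mul, one_mul, zero_mul, map_sum, map_smul,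
      smul_eq_mul, Finset.sum_ite_eq, Finset.mem_univ, if_true]
    exact congrArg _ (Finset.sum_congr rfl fun i _ => mul_comm _ _)
  -- `h = Lᵀ L + Mᵀ M` is positive definite because `y = S L y + M y`, and on the image of `S` it
  -- restricts to the metric of the bundle.
  let h : Fin k → Fin k → X → ℝ := fun i j x =>
    B.metric.inner x (l i x) (l j x) + ∑ a, M a i x * M a j x
  have hh : ∀ x (u w : Fin k → ℝ), ∑ i, ∑ j, h i j x * (u i * w j) =
      B.metric.inner x (∑ i, u i • l i x) (∑ i, w i • l i x) +
        ∑ a, (∑ i, M a i x * u i) * (∑ i, M a i x * w i) := fun x u w => by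
    have e1 : B.metric.inner x (∑ i, u i • l i x) (∑ i, w i • l i x) =
        ∑ i, ∑ j, B.metric.inner x (l i x) (l j x) * (u i * w j) := by
      simp only [map_sum, map_smul, sum_apply, smul_apply, smul_eq_mul, Finset.mul_sum]
      rw [Finset.sum_comm]
      exact Finset.sum_congr rfl fun i _ => Finset.sum_congr rfl fun j _ => by ring
    have e2 : ∑ a, (∑ i, M a i x * u i) * (∑ i, M a i x * w i) =
        ∑ i, ∑ j, (∑ a, M a i x * M a j x) * (u i * w j) := by
      simp only [Finset.sum_mul_sum]
      simp only [Finset.sum_mul]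
      rw [Finset.sum_comm]
      refine Finset.sum_congr rfl fun i _ => ?_
      rw [Finset.sum_comm]
      exact Finset.sum_congr rfl fun j _ => Finset.sum_congr rfl fun a _ => by ring
    rw [e1, e2, ← Finset.sum_add_distrib]
    refine Finset.sum_congr rfl fun i _ => ?_
    rw [← Finset.sum_add_distrib]
    exact Finset.sum_congr rfl fun j _ => by simp only [h]; ring
  obtain ⟨c, hc, hch⟩ := exists_smooth_cholesky (d := d) k h
    (fun i j => (B.contMDiff_inner (hl i) (hl j)).add
      (contMDiff_finsetSum fun a _ => (hMs a i).mul (hMs a j)))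
    (fun i j x => by simp only [h, B.metric.symm x (l i x), mul_comm])
    (fun x u hu => by
      rw [hh]
      have n1 := B.inner_self_nonneg (∑ i, u i • l i x)
      have n2 : 0 ≤ ∑ a, (∑ i, M a i x * u i) * (∑ i, M a i x * u i) :=
        Finset.sum_nonneg fun a _ => mul_self_nonneg _
      refine (add_nonneg n1 n2).lt_of_ne' fun h0 => hu ?_
      have z1 : B.metric.inner x (∑ i, u i • l i x) (∑ i, u i • l i x) = 0 := by linarith
      have z2 : ∑ a, (∑ i, M a i x * u i) * (∑ i, M a i x * u i) = 0 := by linarith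
      have z3 : ∑ i, u i • l i x = 0 := by
        by_contra hne
        exact (B.metric.pos x _ hne).ne' z1
      funext a
      have z4 := (Finset.sum_eq_zero_iff_of_nonneg fun a _ => mul_self_nonneg _).1 z2 a
        (Finset.mem_univ a)
      rw [mul_self_eq_zero, hM, z3, map_zero, sub_zero] at z4
      exact z4)
  -- With `h = cᵀ c` the new sections satisfy `∑ ⟨c s, u⟩ ⟨c s, u'⟩ = h (S u, S u') = ⟨L S u, L S
  -- u'⟩ = ⟨u, u'⟩`.
  refine ⟨k, fun a x => ∑ i, c a i x • s i x, fun a => ?_, fun x u u' => ?_⟩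
  · exact ContMDiff.sum_section fun i _ => ContMDiff.smul_section (hc a i) (hs i)
  · have e1 : ∀ (w : B.V x), ∑ i, B.metric.inner x (s i x) w • l i x = w := hls x
    have e2 := hh x (fun i => B.metric.inner x (s i x) u) (fun i => B.metric.inner x (s i x) u')
    simp only [hM, e1, sub_self, mul_zero, Finset.sum_const_zero, add_zero] at e2
    rw [← e2]
    simp only [map_sum, map_smul, sum_apply, smul_apply, smul_eq_mul]
    simp only [Finset.sum_mul_sum, ← hch]
    simp only [Finset.sum_mul]
    rw [Finset.sum_comm]
    refine Finset.sum_congr rfl fun i _ => ?_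
    rw [Finset.sum_comm]
    exact Finset.sum_congr rfl fun j _ => Finset.sum_congr rfl fun a _ => by ring

end Parseval


/-! ### Frames adapted to a metric connection -/

section AdaptedFrame
variable {d : ℕ} {X : Type*} [TopologicalSpace X] [ChartedSpace (EuclideanSpace ℝ (Fin d)) X]

lemma mvfderiv_comp_real {φ : ℝ → ℝ} {φ' : ℝ} {f : X → ℝ} {x : X} (hφ : HasDerivAt φ φ' (f x))
    (hf : MDifferentiableAt (𝓡 d) 𝓘(ℝ) f x) (v : TangentSpace (𝓡 d) x) :
    mvfderiv (𝓡 d) (fun y => φ (f y)) x v = φ' * mvfderiv (𝓡 d) f x v := by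
  have h := (hφ.hasFDerivAt.hasMFDerivAt.comp x hf.hasMFDerivAt).mfderiv
  refine (DFunLike.congr_fun h v).trans ?_
  exact mul_comm (mvfderiv (𝓡 d) f x v) φ'

lemma mvfderiv_fun_sum {ι : Type} (s : Finset ι) {f : ι → X → ℝ} {x : X}
    (hf : ∀ i ∈ s, MDifferentiableAt (𝓡 d) 𝓘(ℝ) (f i) x) :
    mvfderiv (𝓡 d) (fun y => ∑ i ∈ s, f i y) x = ∑ i ∈ s, mvfderiv (𝓡 d) (f i) x := by
  have h := (HasMFDerivAt.sum (t := s) (f := f) (f' := fun i => mvfderiv (𝓡 d) (f i) x)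
    fun i hi => (hf i hi).hasMFDerivAt).mfderiv
  rw [Finset.sum_fn] at h
  exact h

/-- The one-form `a df` is a combination `∑ λⱼ² dθⱼ` with `∑ λⱼ²` an arbitrarily small constant. -/
theorem exists_sum_sq_smul_differential {a f : X → ℝ} (ha : ContMDiff (𝓡 d) 𝓘(ℝ) ∞ a)
    (hf : ContMDiff (𝓡 d) 𝓘(ℝ) ∞ f) {κ : ℝ} (hκ : 0 < κ) :
    ∃ l θ : Fin 4 → X → ℝ, (∀ j, ContMDiff (𝓡 d) 𝓘(ℝ) ∞ (l j)) ∧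
      (∀ j, ContMDiff (𝓡 d) 𝓘(ℝ) ∞ (θ j)) ∧ (∀ x, ∑ j, l j x * l j x = κ) ∧
      ∀ x v, ∑ j, l j x * l j x * mvfderiv (𝓡 d) (θ j) x v = a x * mvfderiv (𝓡 d) f x v := by
  -- Large enough that `κ / 4 + b / (2 g)` is positive for `b = ± a` and `b = ± a f`; its square
  -- root is then smooth.
  let g : X → ℝ := fun x => 2 / κ * (1 + a x * a x + (a x * f x) * (a x * f x))
  have hg : ContMDiff (𝓡 d) 𝓘(ℝ) ∞ g :=
    contMDiff_const.mul ((contMDiff_const.add (ha.mul ha)).add ((ha.mul hf).mul (ha.mul hf)))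
  have hg0 : ∀ x, 0 < g x := fun x => mul_pos (by positivity) (by
    nlinarith [mul_self_nonneg (a x), mul_self_nonneg (a x * f x)])
  have key : ∀ b : X → ℝ, ContMDiff (𝓡 d) 𝓘(ℝ) ∞ b →
      (∀ x, b x * b x ≤ a x * a x + (a x * f x) * (a x * f x)) →
      ∃ l : X → ℝ, ContMDiff (𝓡 d) 𝓘(ℝ) ∞ l ∧ ∀ x, l x * l x = κ / 4 + b x / g x / 2 := by
    intro b hb hba
    have hpos : ∀ x, 0 < κ / 4 + b x / g x / 2 := fun x => by
      have h1 : -(κ / 2) < b x / g x := by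
        rw [lt_div_iff₀ (hg0 x)]
        have : κ / 2 * g x = 1 + a x * a x + (a x * f x) * (a x * f x) := by
          simp only [g]; field_simp
        nlinarith [hba x, sq_nonneg (b x + 1)]
      linarith
    refine ⟨fun x => √(κ / 4 + b x / g x / 2), fun x => ?_, fun x => Real.mul_self_sqrt (hpos x).le⟩
    have h2 : ContMDiff (𝓡 d) 𝓘(ℝ) ∞ (fun x => κ / 4 + b x / g x / 2) :=
      contMDiff_const.add ((hb.div₀ hg fun x => (hg0 x).ne').div₀ contMDiff_const fun _ => two_ne_zero)
    exact (Real.contDiffAt_sqrt (hpos x).ne').contMDiffAt.comp x (h2 x)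
  have hneg : ∀ {b : X → ℝ}, ContMDiff (𝓡 d) 𝓘(ℝ) ∞ b → ContMDiff (𝓡 d) 𝓘(ℝ) ∞ (-b) :=
    fun {b} hb => hb.neg
  have haf := ha.mul hf
  have hgf := hg.mul hf
  obtain ⟨l0, s0, e0⟩ := key a ha fun x => by nlinarith [mul_self_nonneg (a x * f x)]
  obtain ⟨l1, s1, e1⟩ := key (-a) (hneg ha) fun x => by
    simp only [Pi.neg_apply]; nlinarith [mul_self_nonneg (a x * f x)]
  obtain ⟨l2, s2, e2⟩ := key (-(a * f)) (hneg haf) fun x => by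
    simp only [Pi.neg_apply, Pi.mul_apply]; nlinarith [mul_self_nonneg (a x)]
  obtain ⟨l3, s3, e3⟩ := key (a * f) haf fun x => by
    simp only [Pi.mul_apply]; nlinarith [mul_self_nonneg (a x)]
  have hmd : ∀ {h : X → ℝ}, ContMDiff (𝓡 d) 𝓘(ℝ) ∞ h → ∀ x, MDifferentiableAt (𝓡 d) 𝓘(ℝ) h x :=
    fun hh x => (hh x).mdifferentiableAt (by simp)
  -- `a df = (a / g) d(g f) - (a f / g) dg`. Each coefficient is the difference of two positive
  -- functions `κ / 4 ± b / (2 g)`, used with angles of opposite sign, and the four squares add up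
  -- to `κ`.
  refine ⟨![l0, l1, l2, l3], ![g * f, -(g * f), g, -g], ?_, ?_, fun x => ?_, fun x v => ?_⟩
  · simp [Fin.forall_fin_succ, s0, s1, s2, s3]
  · simp [Fin.forall_fin_succ, hgf, hneg hgf, hg, hneg hg]
  · simp [Fin.sum_univ_four, e0, e1, e2, e3]
    ring
  · have := (hg0 x).ne'
    simp [Fin.sum_univ_four, e0, e1, e2, e3, mvfderiv_mul (hmd hg x) (hmd hf x)]
    field_simp
    ring

/-! ### The defect of a Parseval frame and its cancellation by rotations -/

variable [IsManifold (𝓡 d) ∞ X] {B : EuclideanBundle d X}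

lemma EuclideanBundle.SmoothSection.mdifferentiableAt {s : (x : X) → B.V x} (hs : B.SmoothSection s)
    (x : X) : MDifferentiableAt (𝓡 d) ((𝓡 d).prod 𝓘(ℝ, B.F))
      (fun y => TotalSpace.mk' B.F y (s y)) x :=
  (hs x).mdifferentiableAt (by simp)

lemma EuclideanBundle.SmoothSection.add {s t : (x : X) → B.V x} (hs : B.SmoothSection s)
    (ht : B.SmoothSection t) : B.SmoothSection (fun x => s x + t x) := fun x =>
  (hs x).add_section (ht x)

lemma EuclideanBundle.SmoothSection.smul {g : X → ℝ} {s : (x : X) → B.V x}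
    (hg : ContMDiff (𝓡 d) 𝓘(ℝ) ∞ g) (hs : B.SmoothSection s) :
    B.SmoothSection (fun x => g x • s x) :=
  ContMDiff.smul_section hg hs

lemma MetricConnection.cov_fun_add (D : MetricConnection B) {s t : (x : X) → B.V x}
    (hs : B.SmoothSection s) (ht : B.SmoothSection t) (x : X) (v : TangentSpace (𝓡 d) x) :
    D.cov (fun y => s y + t y) x v = D.cov s x v + D.cov t x v :=
  DFunLike.congr_fun (D.cov.isCovariantDerivativeOnUniv.add (hs.mdifferentiableAt x)
    (ht.mdifferentiableAt x)) v

lemma MetricConnection.cov_fun_smul (D : MetricConnection B) {g : X → ℝ} {s : (x : X) → B.V x}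
    (hg : ContMDiff (𝓡 d) 𝓘(ℝ) ∞ g) (hs : B.SmoothSection s) (x : X) (v : TangentSpace (𝓡 d) x) :
    D.cov (fun y => g y • s y) x v = g x • D.cov s x v + mvfderiv (𝓡 d) g x v • s x :=
  DFunLike.congr_fun (D.cov.isCovariantDerivativeOnUniv.leibniz (hs.mdifferentiableAt x)
    ((hg x).mdifferentiableAt (by simp))) v

/-- The contribution of a section `s` to the difference between the connection `D` and the
connection that a Parseval frame induces. -/
def MetricConnection.defect (D : MetricConnection B) (s : (x : X) → B.V x) (x : X)
    (v : TangentSpace (𝓡 d) x) (u u' : B.V x) : ℝ :=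
  B.metric.inner x (D.cov s x v) u * B.metric.inner x (s x) u'

/-- Differentiate `∑ ⟨s i, U⟩ ⟨s i, U'⟩ = ⟨U, U'⟩`. The terms containing derivatives of `U` and `U'`
cancel by the Parseval identity, and the rest is the symmetric part of the defect. -/
lemma EuclideanBundle.IsParsevalFrame.sum_defect_antisymm {ι : Type} [Fintype ι]
    {s : ι → (x : X) → B.V x} (hs : B.IsParsevalFrame s) (D : MetricConnection B) (x : X)
    (v : TangentSpace (𝓡 d) x) (u u' : B.V x) :
    ∑ i, D.defect (s i) x v u u' = - ∑ i, D.defect (s i) x v u' u := by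
  let U := FiberBundle.extend B.F u
  let U' := FiberBundle.extend B.F u'
  have hU : MDifferentiableAt (𝓡 d) ((𝓡 d).prod 𝓘(ℝ, B.F)) (fun y => TotalSpace.mk' B.F y (U y)) x :=
    FiberBundle.mdifferentiableAt_extend (𝓡 d) B.F u
  have hU' : MDifferentiableAt (𝓡 d) ((𝓡 d).prod 𝓘(ℝ, B.F))
      (fun y => TotalSpace.mk' B.F y (U' y)) x :=
    FiberBundle.mdifferentiableAt_extend (𝓡 d) B.F u'
  have hUx : U x = u := FiberBundle.extend_apply_self B.F u
  have hUx' : U' x = u' := FiberBundle.extend_apply_self B.F u'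
  have hsd := fun i => (hs.smooth i).mdifferentiableAt x
  have h1 : (fun y => B.metric.inner y (U y) (U' y)) = fun y => ∑ i,
      B.metric.inner y (s i y) (U y) * B.metric.inner y (s i y) (U' y) := by
    funext y
    rw [hs.sum_inner]
  have h2 := D.metric x U U' hU hU' v
  rw [h1, mvfderiv_fun_sum _ (f := fun i y => B.metric.inner y (s i y) (U y) *
      B.metric.inner y (s i y) (U' y)) fun i _ => (B.mdifferentiableAt_inner (hsd i) hU).mul
    (B.mdifferentiableAt_inner (hsd i) hU'), sum_apply] at h2
  have h3 : ∀ i, mvfderiv (𝓡 d) (fun y => B.metric.inner y (s i y) (U y) *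
      B.metric.inner y (s i y) (U' y)) x v = D.defect (s i) x v u u' + D.defect (s i) x v u' u +
      B.metric.inner x (s i x) (D.cov U x v) * B.metric.inner x (s i x) u' +
      B.metric.inner x (s i x) u * B.metric.inner x (s i x) (D.cov U' x v) := fun i => by
    rw [mvfderiv_fun_mul (B.mdifferentiableAt_inner (hsd i) hU)
      (B.mdifferentiableAt_inner (hsd i) hU')]
    simp only [add_apply, smul_apply, smul_eq_mul, D.metric x _ _ (hsd i) hU v,
      D.metric x _ _ (hsd i) hU' v, hUx, hUx', MetricConnection.defect]
    ring
  simp only [h3, Finset.sum_add_distrib, hs.sum_inner, hUx, hUx'] at h2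
  linarith

/-- Scaling and rotating a pair of sections. -/
lemma MetricConnection.defect_rotation (D : MetricConnection B) {e e' : (x : X) → B.V x}
    (he : B.SmoothSection e) (he' : B.SmoothSection e') {l θ : X → ℝ}
    (hl : ContMDiff (𝓡 d) 𝓘(ℝ) ∞ l) (hθ : ContMDiff (𝓡 d) 𝓘(ℝ) ∞ θ) :
    ∃ f : Bool → (x : X) → B.V x, (∀ b, B.SmoothSection (f b)) ∧
      (∀ x u u', ∑ b, B.metric.inner x (f b x) u * B.metric.inner x (f b x) u' =
        l x * l x * (B.metric.inner x (e x) u * B.metric.inner x (e x) u' +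
          B.metric.inner x (e' x) u * B.metric.inner x (e' x) u')) ∧
      ∀ x v u u', ∑ b, D.defect (f b) x v u u' =
        l x * l x * (D.defect e x v u u' + D.defect e' x v u u') +
        l x * mvfderiv (𝓡 d) l x v * (B.metric.inner x (e x) u * B.metric.inner x (e x) u' +
          B.metric.inner x (e' x) u * B.metric.inner x (e' x) u') +
        l x * l x * mvfderiv (𝓡 d) θ x v * (B.metric.inner x (e' x) u * B.metric.inner x (e x) u' -
          B.metric.inner x (e x) u * B.metric.inner x (e' x) u') := by
  have hθd := fun x => (hθ x).mdifferentiableAt (n := ∞) (by simp)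
  have hc : ContMDiff (𝓡 d) 𝓘(ℝ) ∞ (fun x => Real.cos (θ x)) := fun x =>
    Real.contDiff_cos.contDiffAt.contMDiffAt.comp x (hθ x)
  have hs : ContMDiff (𝓡 d) 𝓘(ℝ) ∞ (fun x => Real.sin (θ x)) := fun x =>
    Real.contDiff_sin.contDiffAt.contMDiffAt.comp x (hθ x)
  have hns : ContMDiff (𝓡 d) 𝓘(ℝ) ∞ (fun x => -Real.sin (θ x)) := hs.neg
  have dc : ∀ x v, mvfderiv (𝓡 d) (fun x => Real.cos (θ x)) x v =
      -Real.sin (θ x) * mvfderiv (𝓡 d) θ x v :=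
    fun x v => mvfderiv_comp_real (Real.hasDerivAt_cos _) (hθd x) v
  have ds : ∀ x v, mvfderiv (𝓡 d) (fun x => Real.sin (θ x)) x v =
      Real.cos (θ x) * mvfderiv (𝓡 d) θ x v :=
    fun x v => mvfderiv_comp_real (Real.hasDerivAt_sin _) (hθd x) v
  have dns : ∀ x v, mvfderiv (𝓡 d) (fun x => -Real.sin (θ x)) x v =
      -Real.cos (θ x) * mvfderiv (𝓡 d) θ x v :=
    fun x v => mvfderiv_comp_real (φ := fun t => -Real.sin t) (Real.hasDerivAt_sin _).neg (hθd x) v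
  have h1 : B.SmoothSection (fun x => Real.cos (θ x) • e x + Real.sin (θ x) • e' x) :=
    (he.smul hc).add (he'.smul hs)
  have h2 : B.SmoothSection (fun x => -Real.sin (θ x) • e x + Real.cos (θ x) • e' x) :=
    (he.smul hns).add (he'.smul hc)
  -- A pointwise rotation leaves `e ⊗ e + e' ⊗ e'` unchanged, but its derivative adds `dθ` times the
  -- skew form of the pair to the defect. All identities reduce to `sin² + cos² = 1`.
  refine ⟨fun b => bif b then fun x => l x • (Real.cos (θ x) • e x + Real.sin (θ x) • e' x)
    else fun x => l x • (-Real.sin (θ x) • e x + Real.cos (θ x) • e' x), ?_, ?_, ?_⟩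
  · rintro (_ | _)
    · exact h2.smul hl
    · exact h1.smul hl
  · intro x u u'
    simp only [Fintype.sum_bool, cond_true, cond_false, map_smul, map_add, smul_apply, add_apply,
      smul_eq_mul]
    linear_combination (l x * l x * (B.metric.inner x (e x) u * B.metric.inner x (e x) u' +
          B.metric.inner x (e' x) u * B.metric.inner x (e' x) u')) * Real.sin_sq_add_cos_sq (θ x)
  · intro x v u u'
    simp only [Fintype.sum_bool, cond_true, cond_false, MetricConnection.defect,
      D.cov_fun_smul hl h1, D.cov_fun_smul hl h2, D.cov_fun_add (he.smul hc) (he'.smul hs),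
      D.cov_fun_add (he.smul hns) (he'.smul hc), D.cov_fun_smul hc he, D.cov_fun_smul hs he',
      D.cov_fun_smul hns he, D.cov_fun_smul hc he', dc, ds, dns, map_smul, map_add, smul_apply,
      add_apply, smul_eq_mul]
    linear_combination (l x * l x * (B.metric.inner x (D.cov e x v) u * B.metric.inner x (e x) u' + B.metric.inner x (D.cov e' x v) u * B.metric.inner x (e' x) u') +
        l x * mvfderiv (𝓡 d) l x v * (B.metric.inner x (e x) u * B.metric.inner x (e x) u' +
          B.metric.inner x (e' x) u * B.metric.inner x (e' x) u') +
        l x * l x * mvfderiv (𝓡 d) θ x v * (B.metric.inner x (e' x) u * B.metric.inner x (e x) u' -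
          B.metric.inner x (e x) u * B.metric.inner x (e' x) u')) * Real.sin_sq_add_cos_sq (θ x)

/-- Every metric connection is induced by a Parseval frame. -/
theorem MetricConnection.exists_isParsevalFrame [T2Space X] [SecondCountableTopology X]
    (D : MetricConnection B) :
    ∃ (k : ℕ) (s : Fin k → (x : X) → B.V x), B.IsParsevalFrame s ∧
      ∀ x v u u', ∑ i, D.defect (s i) x v u u' = 0 := by
  obtain ⟨k, e, he⟩ := B.exists_isParsevalFrame
  -- The empty frame is set aside because the weight `κ` below divides by `k`.
  rcases k.eq_zero_or_pos with rfl | hk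
  · exact ⟨0, e, he, fun x v u u' => Finset.sum_empty⟩
  obtain ⟨m, f, hf, hsep⟩ := exists_differentials_separating d X
  obtain ⟨Y, hY, hfY⟩ := exists_dualFrame (d := d) (F := EuclideanSpace ℝ (Fin d))
    (V := TangentSpace (𝓡 d)) (fun i => isSmoothFunctional_mvfderiv (hf i)) hsep
  -- Coefficients of the one-forms `⟨D (e p), e q⟩` in the spanning differentials `df t`.
  let β : Fin k → Fin k → Fin m → X → ℝ := fun p q t x =>
    B.metric.inner x (e q x) (D.cov (e p) x (Y t x))
  have hβ : ∀ p q t, ContMDiff (𝓡 d) 𝓘(ℝ) ∞ (β p q t) := fun p q t => by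
    refine B.contMDiff_inner (he.smooth q) fun x => ?_
    exact ContMDiffAt.clm_bundle_apply ((D.smooth.contMDiff.contMDiff (σ := e p)
      (he.smooth p).contMDiffOn).contMDiffAt Filter.univ_mem) (hY t x)
  have hβs : ∀ p q x v, ∑ t, β p q t x * mvfderiv (𝓡 d) (f t) x v =
      B.metric.inner x (D.cov (e p) x v) (e q x) := fun p q x v => by
    conv_rhs => rw [← hfY x v]
    simp only [β, map_sum, map_smul, sum_apply, smul_apply, smul_eq_mul]
    exact Finset.sum_congr rfl fun t _ => by rw [B.metric.symm, mul_comm]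
  -- Each `e p` occurs in `2 k` of the ordered pairs `(p, q)`, counted with both positions, and each
  -- pair in `m + 1` terms of weight `κ`. This value makes the total weight `1`.
  let κ : ℝ := 1 / (2 * k * (m + 1))
  have hk' : (0 : ℝ) < k := by exact_mod_cast hk
  have hκ : 0 < κ := by positivity
  -- The factor `-1/2` appears because skew-symmetrizing the defect doubles it. The index `none`
  -- carries the zero form and keeps the family nonempty if `m = 0`.
  let a : Fin k → Fin k → Option (Fin m) → X → ℝ := fun p q t x => t.elim 0 fun t => -(1 / 2) * β p q t x
  let g : Option (Fin m) → X → ℝ := fun t x => t.elim 0 fun t => f t x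
  have ha : ∀ p q t, ContMDiff (𝓡 d) 𝓘(ℝ) ∞ (a p q t) := fun p q t => by
    cases t with
    | none => exact contMDiff_const
    | some t => exact contMDiff_const.mul (hβ p q t)
  have hg : ∀ t, ContMDiff (𝓡 d) 𝓘(ℝ) ∞ (g t) := fun t => by
    cases t with
    | none => exact contMDiff_const
    | some t => exact hf t
  choose l θ hl hθ hlκ hlθ using fun p q t => exists_sum_sq_smul_differential (ha p q t) (hg t) hκ
  -- Because `∑ λ²` is constant, the radial terms `λ dλ` of `defect_rotation` cancel in the sum over
  -- `j`.
  have hld : ∀ p q t x v, ∑ j, l p q t j x * mvfderiv (𝓡 d) (l p q t j) x v = 0 := fun p q t x v => by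
    have hd := fun j => (hl p q t j x).mdifferentiableAt (n := ∞) (by simp)
    have h1 : mvfderiv (𝓡 d) (fun y => ∑ j, l p q t j y * l p q t j y) x v = 0 := by
      simp only [hlκ]
      rw [mvfderiv_const]
      rfl
    rw [mvfderiv_fun_sum _ (f := fun j y => l p q t j y * l p q t j y)
      fun j _ => (hd j).mul (hd j), sum_apply] at h1
    simp only [mvfderiv_fun_mul (hd _) (hd _), add_apply, smul_apply, smul_eq_mul, ← two_mul,
      ← Finset.mul_sum] at h1
    linarith
  choose F hF hFs hFd using fun p q t j =>
    D.defect_rotation (he.smooth p) (he.smooth q) (hl p q t j) (hθ p q t j)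
  have hcard : κ * (2 * k * (m + 1)) = 1 := one_div_mul_cancel (by positivity)
  have hsumκ : ∀ c : Fin k → ℝ, ∑ p, ∑ q, (∑ _t : Option (Fin m), κ) * (c p + c q) = ∑ p, c p :=
    fun c => by
      simp only [Finset.sum_const, Finset.card_univ, Fintype.card_option, Fintype.card_fin,
        nsmul_eq_mul, mul_add, Finset.sum_add_distrib, ← Finset.mul_sum]
      push_cast
      linear_combination (∑ p, c p) * hcard
  let s : Fin k × Fin k × Option (Fin m) × Fin 4 × Bool → (x : X) → B.V x :=
    fun i => F i.1 i.2.1 i.2.2.1 i.2.2.2.1 i.2.2.2.2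
  have hs : B.IsParsevalFrame s := by
    refine ⟨fun i => hF _ _ _ _ _, fun x u u' => ?_⟩
    simp only [s, Fintype.sum_prod_type, hFs, ← Finset.sum_mul, hlκ]
    exact (hsumκ fun p => B.metric.inner x (e p x) u * B.metric.inner x (e p x) u').trans
      (he.sum_inner x u u')
  have hsd : ∀ x v u u', ∑ i, D.defect (s i) x v u u' = 0 := fun x v u u' => by
    simp only [s, Fintype.sum_prod_type, hFd, Finset.sum_add_distrib, ← Finset.sum_mul, hlκ, hld,
      zero_mul, add_zero, hlθ]
    rw [hsumκ fun p => D.defect (e p) x v u u']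
    have h1 : ∀ p q, ∑ t, a p q t x * mvfderiv (𝓡 d) (g t) x v =
        -(1 / 2) * B.metric.inner x (D.cov (e p) x v) (e q x) := fun p q => by
      rw [← hβs, Fintype.sum_option, Finset.mul_sum]
      simp only [a, g, Option.elim, zero_mul, zero_add, mul_assoc]
    simp only [h1]
    have h2 : ∀ w w', ∑ p, ∑ q, B.metric.inner x (D.cov (e p) x v) (e q x) *
        (B.metric.inner x (e q x) w * B.metric.inner x (e p x) w') =
        ∑ p, D.defect (e p) x v w w' := fun w w' => by
      refine Finset.sum_congr rfl fun p _ => ?_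
      rw [MetricConnection.defect, ← he.sum_inner x _ w, Finset.sum_mul]
      exact Finset.sum_congr rfl fun q _ => by rw [B.metric.symm x (e q x) (D.cov (e p) x v)]; ring
    -- The rotations contribute `-(1/2)` times the defect minus its transpose. By antisymmetry this
    -- is the negative of the original defect.
    have h3 : ∑ p, ∑ q, -(1 / 2) * B.metric.inner x (D.cov (e p) x v) (e q x) *
        (B.metric.inner x (e q x) u * B.metric.inner x (e p x) u' -
          B.metric.inner x (e p x) u * B.metric.inner x (e q x) u') =
        -(1 / 2) * (∑ p, D.defect (e p) x v u u' - ∑ p, D.defect (e p) x v u' u) := by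
      rw [← h2, ← h2, ← Finset.sum_sub_distrib, Finset.mul_sum]
      refine Finset.sum_congr rfl fun p _ => ?_
      rw [← Finset.sum_sub_distrib, Finset.mul_sum]
      exact Finset.sum_congr rfl fun q _ => by ring
    rw [h3]
    linarith [he.sum_defect_antisymm D x v u u']
  let i := Fintype.equivFin (Fin k × Fin k × Option (Fin m) × Fin 4 × Bool)
  refine ⟨_, fun j => s (i.symm j), ⟨fun j => hs.smooth _, fun x u u' => ?_⟩, fun x v u u' => ?_⟩
  · rw [← hs.sum_inner]
    exact Equiv.sum_comp i.symm fun j => B.metric.inner x (s j x) u * B.metric.inner x (s j x) u'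
  · rw [← hsd x v u u']
    exact Equiv.sum_comp i.symm fun j => D.defect (s j) x v u u'

end AdaptedFrame


/-! ### The bundle of ranges of a smooth family of orthogonal projections -/

section Projection
variable {d : ℕ} {X : Type*} [TopologicalSpace X] [ChartedSpace (EuclideanSpace ℝ (Fin d)) X]

/-- A smooth family of orthogonal projections of rank `r` in `ℝᴺ`. -/
structure IsProjectionField (d : ℕ) {X : Type*} [TopologicalSpace X]
    [ChartedSpace (EuclideanSpace ℝ (Fin d)) X] {N : ℕ}
    (Q : X → EuclideanSpace ℝ (Fin N) →L[ℝ] EuclideanSpace ℝ (Fin N)) (r : ℕ) : Prop where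
  smooth : ContMDiff (𝓡 d) 𝓘(ℝ, EuclideanSpace ℝ (Fin N) →L[ℝ] EuclideanSpace ℝ (Fin N)) ∞ Q
  idem : ∀ x y, Q x (Q x y) = Q x y
  symm : ∀ x y z, inner ℝ (Q x y) z = inner ℝ y (Q x z)
  rank : ∀ x, Module.finrank ℝ (LinearMap.range (Q x).toLinearMap) = r

namespace IsProjectionField
variable {N r : ℕ} {Q : X → EuclideanSpace ℝ (Fin N) →L[ℝ] EuclideanSpace ℝ (Fin N)}

lemma compl (hQ : IsProjectionField d Q r) : IsProjectionField d (fun x => 1 - Q x) (N - r) := by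
  refine ⟨contMDiff_const.sub hQ.smooth, fun x y => ?_, fun x y z => ?_, fun x => ?_⟩
  · simp [hQ.idem]
  · simp [inner_sub_left, inner_sub_right, hQ.symm]
  · have h : (1 - Q x).toLinearMap.range = (Q x).toLinearMap.ker := by
      ext y
      constructor
      · rintro ⟨z, rfl⟩
        simp [hQ.idem]
      · intro hy
        have hy' : Q x y = 0 := hy
        exact ⟨y, by simp [hy']⟩
    have h1 := LinearMap.finrank_range_add_finrank_ker (Q x).toLinearMap
    rw [hQ.rank, finrank_euclideanSpace_fin] at h1
    rw [h]
    omega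

/-- Take an orthonormal basis of the range; symmetry of `Q x` makes the adjoint factor through `Q
x`. The choice is made point by point and need not be continuous in `x`: smoothness enters only
through `frame` and `coord`. -/
lemma exists_isometry (hQ : IsProjectionField d Q r) (x : X) :
    ∃ A : EuclideanSpace ℝ (Fin r) →L[ℝ] EuclideanSpace ℝ (Fin N),
      (∀ u, Q x (A u) = A u) ∧ (∀ u, A.adjoint (A u) = u) ∧ ∀ y, A (A.adjoint y) = Q x y := by
  let R := LinearMap.range (Q x).toLinearMap
  let b := (stdOrthonormalBasis ℝ R).reindex (finCongr (hQ.rank x))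
  let A : EuclideanSpace ℝ (Fin r) →L[ℝ] EuclideanSpace ℝ (Fin N) :=
    R.subtypeL ∘L (b.repr.symm.toContinuousLinearEquiv : EuclideanSpace ℝ (Fin r) →L[ℝ] R)
  have hA1 : ∀ u, Q x (A u) = A u := fun u => by
    obtain ⟨y, hy⟩ := (b.repr.symm u).2
    change Q x (b.repr.symm u : EuclideanSpace ℝ (Fin N)) = (b.repr.symm u : EuclideanSpace ℝ (Fin N))
    rw [← hy]
    exact hQ.idem x y
  have hA2 : ∀ u, A.adjoint (A u) = u := fun u => by
    refine ext_inner_right ℝ fun z => ?_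
    rw [ContinuousLinearMap.adjoint_inner_left]
    exact b.repr.symm.inner_map_map u z
  refine ⟨A, hA1, hA2, fun y => ?_⟩
  have h1 : A.adjoint y = A.adjoint (Q x y) := ext_inner_right ℝ fun z => by
    rw [ContinuousLinearMap.adjoint_inner_left, ContinuousLinearMap.adjoint_inner_left, hQ.symm, hA1]
  obtain ⟨u, hu⟩ : ∃ u, A u = Q x y := by
    refine ⟨b.repr ⟨Q x y, y, rfl⟩, ?_⟩
    change ((b.repr.symm (b.repr ⟨Q x y, y, rfl⟩) : R) : EuclideanSpace ℝ (Fin N)) = Q x y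
    rw [LinearIsometryEquiv.symm_apply_apply]
  rw [h1, ← hu, hA2]

variable (hQ : IsProjectionField d Q r)

/-- An isometry of `ℝʳ` onto the range of the projection at a point. -/
def iso (x : X) : EuclideanSpace ℝ (Fin r) →L[ℝ] EuclideanSpace ℝ (Fin N) :=
  (hQ.exists_isometry x).choose

lemma apply_iso (x : X) (u : EuclideanSpace ℝ (Fin r)) : Q x (hQ.iso x u) = hQ.iso x u :=
  (hQ.exists_isometry x).choose_spec.1 u

lemma adjoint_iso (x : X) (u : EuclideanSpace ℝ (Fin r)) : (hQ.iso x).adjoint (hQ.iso x u) = u :=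
  (hQ.exists_isometry x).choose_spec.2.1 u

lemma iso_adjoint (x : X) (y : EuclideanSpace ℝ (Fin N)) : hQ.iso x ((hQ.iso x).adjoint y) = Q x y :=
  (hQ.exists_isometry x).choose_spec.2.2 y

lemma inner_iso (x : X) (u u' : EuclideanSpace ℝ (Fin r)) :
    inner ℝ (hQ.iso x u) (hQ.iso x u') = inner ℝ u u' := by
  rw [← ContinuousLinearMap.adjoint_inner_left, adjoint_iso]

/-- The local frame obtained by projecting the range at `i`. -/
def frame (i x : X) : EuclideanSpace ℝ (Fin r) →L[ℝ] EuclideanSpace ℝ (Fin N) :=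
  (Q x).comp (hQ.iso i)

/-- The Gram operator of the local frame. -/
def gram (i x : X) : EuclideanSpace ℝ (Fin r) →L[ℝ] EuclideanSpace ℝ (Fin r) :=
  (hQ.iso i).adjoint.comp (hQ.frame i x)

/-- The coordinates with respect to the local frame. -/
def coord (i x : X) : EuclideanSpace ℝ (Fin N) →L[ℝ] EuclideanSpace ℝ (Fin r) :=
  (Ring.inverse (hQ.gram i x)).comp ((hQ.iso i).adjoint.comp (Q x))

lemma frame_self (x : X) : hQ.frame x x = hQ.iso x := by
  ext1 u
  exact hQ.apply_iso x u

lemma gram_self (x : X) : hQ.gram x x = 1 := by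
  ext1 u
  simp [gram, frame_self, adjoint_iso]

lemma apply_frame (i x : X) (u : EuclideanSpace ℝ (Fin r)) :
    Q x (hQ.frame i x u) = hQ.frame i x u := hQ.idem _ _

lemma inner_frame (i x : X) (u u' : EuclideanSpace ℝ (Fin r)) :
    inner ℝ (hQ.frame i x u) (hQ.frame i x u') = inner ℝ (hQ.gram i x u) u' := by
  rw [gram, ContinuousLinearMap.comp_apply, ContinuousLinearMap.adjoint_inner_left, frame,
    ContinuousLinearMap.comp_apply, ContinuousLinearMap.comp_apply, ← hQ.symm, hQ.idem]

/-- The set on which the local frame is a frame. -/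
def dom (i : X) : Set X := {x | IsUnit (hQ.gram i x)}

lemma mem_dom (x : X) : x ∈ hQ.dom x := by simp [dom, gram_self]

lemma contMDiff_frame (i : X) : ContMDiff (𝓡 d)
    𝓘(ℝ, EuclideanSpace ℝ (Fin r) →L[ℝ] EuclideanSpace ℝ (Fin N)) ∞ (hQ.frame i) :=
  hQ.smooth.clm_comp contMDiff_const

lemma contMDiff_gram (i : X) : ContMDiff (𝓡 d)
    𝓘(ℝ, EuclideanSpace ℝ (Fin r) →L[ℝ] EuclideanSpace ℝ (Fin r)) ∞ (hQ.gram i) :=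
  contMDiff_const.clm_comp (hQ.contMDiff_frame i)

lemma isOpen_dom (i : X) : IsOpen (hQ.dom i) :=
  Units.isOpen.preimage (hQ.contMDiff_gram i).continuous

lemma contMDiffOn_coord (i : X) : ContMDiffOn (𝓡 d)
    𝓘(ℝ, EuclideanSpace ℝ (Fin N) →L[ℝ] EuclideanSpace ℝ (Fin r)) ∞ (hQ.coord i) (hQ.dom i) := by
  intro x hx
  have h1 : ContMDiffAt (𝓡 d) 𝓘(ℝ, EuclideanSpace ℝ (Fin r) →L[ℝ] EuclideanSpace ℝ (Fin r)) ∞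
      (fun x => Ring.inverse (hQ.gram i x)) x := by
    obtain ⟨g, hg⟩ := hx
    have h2 := contDiffAt_ringInverse (n := ∞) ℝ g
    rw [hg] at h2
    exact h2.contMDiffAt.comp x (hQ.contMDiff_gram i x)
  exact (h1.clm_comp (contMDiffAt_const.clm_comp (hQ.smooth x))).contMDiffWithinAt

lemma coord_frame {i x : X} (hx : x ∈ hQ.dom i) (u : EuclideanSpace ℝ (Fin r)) :
    hQ.coord i x (hQ.frame i x u) = u := by
  have h : hQ.coord i x (hQ.frame i x u) = (Ring.inverse (hQ.gram i x) * hQ.gram i x) u := by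
    simp [coord, gram, apply_frame]
  rw [h, Ring.inverse_mul_cancel _ hx]
  rfl

/-- The local frame is injective into the range of `Q x`, which has the same dimension `r`, hence it
is onto. This is where the constant rank matters. -/
lemma frame_coord {i x : X} (hx : x ∈ hQ.dom i) (y : EuclideanSpace ℝ (Fin N)) :
    hQ.frame i x (hQ.coord i x (Q x y)) = Q x y := by
  have hinj : Function.Injective (hQ.frame i x).toLinearMap :=
    Function.LeftInverse.injective (g := hQ.coord i x) (hQ.coord_frame hx)
  have hle : LinearMap.range (hQ.frame i x).toLinearMap ≤
      LinearMap.range (Q x).toLinearMap := by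
    rintro _ ⟨u, rfl⟩
    exact ⟨_, rfl⟩
  have heq := Submodule.eq_of_le_of_finrank_eq hle (by
    rw [LinearMap.finrank_range_of_inj hinj, hQ.rank, finrank_euclideanSpace_fin])
  obtain ⟨u, hu⟩ : Q x y ∈ LinearMap.range (hQ.frame i x).toLinearMap := by
    rw [heq]
    exact ⟨y, rfl⟩
  rw [← hu]
  exact congrArg _ (hQ.coord_frame hx u)

lemma frame_coord_frame {i j x : X} (hx : x ∈ hQ.dom j) (v : EuclideanSpace ℝ (Fin r)) :
    hQ.frame j x (hQ.coord j x (hQ.frame i x v)) = hQ.frame i x v := by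
  have h := hQ.frame_coord hx (hQ.frame i x v)
  rwa [apply_frame] at h

/-- The bundle of ranges of a smooth family of projections. -/
def core : VectorBundleCore ℝ X (EuclideanSpace ℝ (Fin r)) X where
  baseSet := hQ.dom
  isOpen_baseSet := hQ.isOpen_dom
  -- With this index the fibre over `x` is `ℝʳ` embedded by `frame x x = iso x`, an isometry, so the
  -- induced metric is the standard inner product of `ℝʳ`.
  indexAt x := x
  mem_baseSet_at := hQ.mem_dom
  coordChange i j x := (hQ.coord j x).comp (hQ.frame i x)
  coordChange_self i x hx v := hQ.coord_frame hx v
  continuousOn_coordChange i j := ((hQ.contMDiffOn_coord j).continuousOn.mono inter_subset_right).clm_comp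
    (hQ.contMDiff_frame i).continuous.continuousOn
  coordChange_comp i j k x hx v := by
    simp only [ContinuousLinearMap.comp_apply]
    rw [hQ.frame_coord_frame hx.1.2]

instance : hQ.core.IsContMDiff (𝓡 d) ∞ where
  contMDiffOn_coordChange i j := ((hQ.contMDiffOn_coord j).mono inter_subset_right).clm_comp
    (hQ.contMDiff_frame i).contMDiffOn

instance (x : X) : IsTopologicalAddGroup (hQ.core.Fiber x) :=
  inferInstanceAs (IsTopologicalAddGroup (EuclideanSpace ℝ (Fin r)))

instance (x : X) : ContinuousSMul ℝ (hQ.core.Fiber x) :=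
  inferInstanceAs (ContinuousSMul ℝ (EuclideanSpace ℝ (Fin r)))

variable [IsManifold (𝓡 d) ∞ X]

/-- The bundle of ranges of a smooth family of projections, with the metric induced from `ℝᴺ`. -/
def bundle : EuclideanBundle.{0} d X where
  F := EuclideanSpace ℝ (Fin r)
  V := hQ.core.Fiber
  metric :=
    { inner := fun x => (innerSL ℝ : EuclideanSpace ℝ (Fin r) →L[ℝ] EuclideanSpace ℝ (Fin r) →L[ℝ] ℝ)
      symm := fun x u v => real_inner_comm (F := EuclideanSpace ℝ (Fin r)) v u
      pos := fun x u hu => (real_inner_self_pos (F := EuclideanSpace ℝ (Fin r)) (x := u)).2 hu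
      isVonNBounded := (EuclideanBundle.trivial d X r).metric.isVonNBounded
      contMDiff := by
        intro x
        rw [contMDiffAt_hom_bundle]
        refine ⟨contMDiffAt_id, ?_⟩
        -- In the trivialization at `x` the metric is given by the Gram operator of the local frame.
        have h := (hQ.contMDiff_gram x x)
        have h1 := ContMDiffAt.clm_comp (I := 𝓡 d) (n := ∞) (x := x)
          (g := fun _ => (innerSL ℝ : EuclideanSpace ℝ (Fin r) →L[ℝ] EuclideanSpace ℝ (Fin r) →L[ℝ] ℝ))
          contMDiffAt_const h
        refine h1.congr_of_eventuallyEq ?_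
        filter_upwards [(hQ.isOpen_dom x).mem_nhds (hQ.mem_dom x)] with y hy
        refine ContinuousLinearMap.ext fun p => ContinuousLinearMap.ext fun q => ?_
        have hy' : y ∈ (trivializationAt (EuclideanSpace ℝ (Fin r)) hQ.core.Fiber x).baseSet := hy
        simp [ContinuousLinearMap.inCoordinates, Trivialization.coe_linearMapAt_of_mem, hy',
          hom_trivializationAt_apply]
        change inner ℝ (hQ.coord y y (hQ.frame x y p)) (hQ.coord y y (hQ.frame x y q)) =
          inner ℝ (hQ.gram x y p) q
        rw [← hQ.inner_iso y, ← frame_self, hQ.frame_coord_frame (hQ.mem_dom y),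
          hQ.frame_coord_frame (hQ.mem_dom y), inner_frame] }

/-- Local coordinates of the section are obtained by applying the smooth `coord` to its image in
`ℝᴺ`; the embeddings `iso y` themselves need not depend smoothly on `y`. -/
lemma smoothSection_of_contMDiff {s : (x : X) → EuclideanSpace ℝ (Fin r)}
    (hs : ContMDiff (𝓡 d) 𝓘(ℝ, EuclideanSpace ℝ (Fin N)) ∞ (fun x => hQ.iso x (s x))) :
    hQ.bundle.SmoothSection s := by
  intro x
  refine contMDiffAt_totalSpace.2 ⟨contMDiffAt_id, ?_⟩
  have h1 : ContMDiffAt (𝓡 d) 𝓘(ℝ, EuclideanSpace ℝ (Fin r)) ∞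
      (fun y => hQ.coord x y (hQ.iso y (s y))) x :=
    ((hQ.contMDiffOn_coord x).contMDiffAt ((hQ.isOpen_dom x).mem_nhds (hQ.mem_dom x))).clm_apply
      (hs x)
  refine h1.congr_of_eventuallyEq (Filter.Eventually.of_forall fun y => ?_)
  change hQ.coord x y (hQ.frame y y (s y)) = _
  rw [frame_self]

/-- The projection of a standard basis vector of `ℝᴺ`. -/
def projSingle (i : Fin N) (x : X) : hQ.bundle.V x :=
  ((hQ.iso x).adjoint (EuclideanSpace.single i 1) : EuclideanSpace ℝ (Fin r))

lemma inner_projSingle (i : Fin N) (x : X) (u : EuclideanSpace ℝ (Fin r)) :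
    hQ.bundle.metric.inner x (hQ.projSingle i x) u = hQ.iso x u i :=
  (ContinuousLinearMap.adjoint_inner_left (hQ.iso x) u (EuclideanSpace.single i 1)).trans (by
    simp [EuclideanSpace.inner_single_left])

/-- The projections of the standard basis of `ℝᴺ` form a Parseval frame. -/
lemma isParsevalFrame : hQ.bundle.IsParsevalFrame hQ.projSingle := by
  refine ⟨fun i => hQ.smoothSection_of_contMDiff ?_, fun x u u' => ?_⟩
  · simp only [projSingle, iso_adjoint]
    exact hQ.smooth.clm_apply contMDiff_const
  · have h2 : hQ.bundle.metric.inner x u u' = inner ℝ (hQ.iso x u) (hQ.iso x u') :=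
      (hQ.inner_iso x u u').symm
    rw [h2, PiLp.inner_apply]
    exact Finset.sum_congr rfl fun i _ => by
      rw [hQ.inner_projSingle i x u, hQ.inner_projSingle i x u']
      exact mul_comm _ _

/-- Passing from a projection to its complement thus replaces the Gram matrix of the frame by `1`
minus it. -/
lemma inner_projSingle_projSingle (x : X) (i j : Fin N) :
    hQ.bundle.metric.inner x (hQ.projSingle i x) (hQ.projSingle j x) =
      Q x (EuclideanSpace.single j 1) i :=
  (hQ.inner_projSingle i x _).trans
    (congrArg (fun z : EuclideanSpace ℝ (Fin N) => z i)
      (hQ.iso_adjoint x (EuclideanSpace.single j 1)))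

end IsProjectionField

/-! ### The projection and the complement of an embedded bundle -/

variable [IsManifold (𝓡 d) ∞ X]

lemma EuclideanBundle.finrank_fiber (B : EuclideanBundle d X) (x : X) :
    Module.finrank ℝ (B.V x) = Module.finrank ℝ B.F :=
  ((trivializationAt B.F B.V x).continuousLinearEquivAt ℝ x
    (FiberBundle.mem_baseSet_trivializationAt' x)).toLinearEquiv.finrank_eq

/-- The projections of the product bundle onto a bundle embedded in it by a Parseval frame. -/
def EuclideanBundle.frameProjection (B : EuclideanBundle d X) {N : ℕ}
    (s : Fin N → (x : X) → B.V x) (x : X) :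
    EuclideanSpace ℝ (Fin N) →L[ℝ] EuclideanSpace ℝ (Fin N) :=
  ∑ i, ∑ j, B.metric.inner x (s i x) (s j x) •
    (innerSL ℝ (EuclideanSpace.single j (1 : ℝ) : EuclideanSpace ℝ (Fin N))).smulRight
      (EuclideanSpace.single i 1 : EuclideanSpace ℝ (Fin N))

lemma EuclideanBundle.frameProjection_apply (B : EuclideanBundle d X) {N : ℕ}
    (s : Fin N → (x : X) → B.V x) (x : X) (y : EuclideanSpace ℝ (Fin N)) (i : Fin N) :
    B.frameProjection s x y i = B.metric.inner x (s i x) (∑ j, y j • s j x) := by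
  simp [frameProjection, EuclideanSpace.inner_single_left]
  rw [Finset.sum_comm]
  simp [Pi.single_apply]
  exact Finset.sum_congr rfl fun j _ => mul_comm _ _

theorem EuclideanBundle.IsParsevalFrame.isProjectionField {B : EuclideanBundle d X} {N : ℕ}
    {s : Fin N → (x : X) → B.V x} (hs : B.IsParsevalFrame s) :
    IsProjectionField d (B.frameProjection s) (Module.finrank ℝ B.F) := by
  -- `T` is the adjoint of the isometric embedding `S u = (⟨s i, u⟩)ᵢ`, and the projection is `S T`.
  -- From `T S = 1` follow idempotence, symmetry and `ker (S T) = ker T`, hence the rank.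
  let T : (x : X) → EuclideanSpace ℝ (Fin N) →ₗ[ℝ] B.V x := fun x =>
    { toFun := fun y => ∑ j, y j • s j x
      map_add' := fun y z => by simp [add_smul, Finset.sum_add_distrib]
      map_smul' := fun a y => by simp [mul_smul, Finset.smul_sum] }
  have hT : ∀ x y, T x y = ∑ j, y j • s j x := fun x y => rfl
  have hP : ∀ x y i, B.frameProjection s x y i = B.metric.inner x (s i x) (T x y) :=
    B.frameProjection_apply s
  have hTP : ∀ x y, T x (B.frameProjection s x y) = T x y := fun x y => by
    simp only [hT x (B.frameProjection s x y), hP]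
    exact hs.sum_smul x _
  have hTs : ∀ x, Function.Surjective (T x) := fun x u =>
    ⟨WithLp.toLp 2 fun i => B.metric.inner x (s i x) u, hs.sum_smul x u⟩
  have hPT : ∀ x y z, inner ℝ (B.frameProjection s x y) z = B.metric.inner x (T x y) (T x z) :=
    fun x y z => by
      rw [B.metric.symm, hT x z, PiLp.inner_apply]
      simp [hP, map_sum, map_smul]
  refine ⟨contMDiff_finsetSum fun i _ => contMDiff_finsetSum fun j _ =>
      (B.contMDiff_inner (hs.smooth i) (hs.smooth j)).smul (I := 𝓘(ℝ, ℝ)) contMDiff_const,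
      fun x y => ?_, fun x y z => ?_, fun x => ?_⟩
  · ext i
    rw [hP, hTP, hP]
  · rw [hPT, B.metric.symm, ← hPT, real_inner_comm]
  · have h : (B.frameProjection s x).toLinearMap.ker = (T x).ker := by
      ext y
      refine ⟨fun hy => ?_, fun hy => ?_⟩
      · have hy' : B.frameProjection s x y = 0 := hy
        rw [LinearMap.mem_ker, ← hTP, hy', map_zero]
      · refine LinearMap.mem_ker.2 (PiLp.ext fun i => ?_)
        change B.frameProjection s x y i = 0
        rw [hP, LinearMap.mem_ker.1 hy, map_zero]
    have h1 := LinearMap.finrank_range_add_finrank_ker (T x)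
    have h2 := LinearMap.finrank_range_add_finrank_ker (B.frameProjection s x).toLinearMap
    rw [LinearMap.range_eq_top.2 (hTs x), finrank_top, B.finrank_fiber] at h1
    rw [h] at h2
    omega

/-- The orthogonal complement of a bundle in the product bundle in which it is embedded by a
Parseval frame. -/
theorem EuclideanBundle.IsParsevalFrame.exists_complement {B : EuclideanBundle d X} {N : ℕ}
    {s : Fin N → (x : X) → B.V x} (hs : B.IsParsevalFrame s) :
    ∃ (W : EuclideanBundle.{0} d X) (w : Fin N → (x : X) → W.V x), W.IsParsevalFrame w ∧
      ∀ x i j, W.metric.inner x (w i x) (w j x) =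
        (if i = j then 1 else 0) - B.metric.inner x (s i x) (s j x) := by
  refine ⟨hs.isProjectionField.compl.bundle, _, hs.isProjectionField.compl.isParsevalFrame,
    fun x i j => (hs.isProjectionField.compl.inner_projSingle_projSingle x i j).trans ?_⟩
  have h : ∑ k, (EuclideanSpace.single j (1 : ℝ) : EuclideanSpace ℝ (Fin N)) k • s k x = s j x := by
    simp
  rw [sub_apply, PiLp.sub_apply, B.frameProjection_apply, h]
  simp

end Projection


/-! ### Coordinate vector fields -/

section Coordinates
variable {d : ℕ} {X : Type*} [TopologicalSpace X] [ChartedSpace (EuclideanSpace ℝ (Fin d)) X]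
  [IsManifold (𝓡 d) ∞ X]

lemma two_le_infty : (2 : WithTop ℕ∞) ≤ ∞ :=
  WithTop.coe_le_coe.2 (le_top : (2 : ℕ∞) ≤ ⊤)

/-- The preferred trivialization of the tangent bundle is the derivative of the chart, so the
extensions used to define curvature are coordinate vector fields. -/
lemma extend_tangent_apply {x y : X} (hy : y ∈ (extChartAt (𝓡 d) x).source)
    (w : TangentSpace (𝓡 d) x) : FiberBundle.extend (EuclideanSpace ℝ (Fin d)) w y =
      mfderivWithin 𝓘(ℝ, EuclideanSpace ℝ (Fin d)) (𝓡 d) (extChartAt (𝓡 d) x).symm (range (𝓡 d))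
        (extChartAt (𝓡 d) x y) w := by
  have : IsManifold (𝓡 d) 1 X := IsManifold.of_le (n := ∞) (by simp)
  have hy' : y ∈ (chartAt (EuclideanSpace ℝ (Fin d)) x).source := by
    simpa only [extChartAt_source] using hy
  have h1 := DFunLike.congr_fun (TangentBundle.symmL_trivializationAt (I := 𝓡 d) (𝕜 := ℝ) hy') w
  have h2 := DFunLike.congr_fun (TangentBundle.continuousLinearMapAt_trivializationAt (I := 𝓡 d)
    (𝕜 := ℝ) (mem_chart_source (EuclideanSpace ℝ (Fin d)) x)) w
  rw [mfderiv_extChartAt_self] at h2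
  have hb : ∀ {z : X}, z ∈ (chartAt (EuclideanSpace ℝ (Fin d)) x).source →
    z ∈ (trivializationAt (EuclideanSpace ℝ (Fin d)) (TangentSpace (𝓡 d)) x).baseSet := fun h => h
  rw [Trivialization.continuousLinearMapAt_apply, Trivialization.coe_linearMapAt_of_mem _
    (hb (mem_chart_source _ x))] at h2
  have h3 := (trivializationAt (EuclideanSpace ℝ (Fin d)) (TangentSpace (𝓡 d)) x).symmL_apply
    (R := ℝ) (hb hy') (w : EuclideanSpace ℝ (Fin d))
  exact (congrArg _ h2).trans (h3.symm.trans h1)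

lemma lieBracketWithin_univ_eq_zero {E : Type*} [NormedAddCommGroup E] [NormedSpace ℝ E]
    {V W : E → E} {z v w : E} (hV : V =ᶠ[𝓝 z] fun _ => v) (hW : W =ᶠ[𝓝 z] fun _ => w) :
    VectorField.lieBracketWithin ℝ V W univ z = 0 := by
  rw [VectorField.lieBracketWithin_univ, hV.lieBracket_vectorField_eq hW]
  simp [VectorField.lieBracket]

/-- In the chart at `x` both fields are constant. Hence the bracket term drops out of the curvature.
-/
lemma mlieBracket_extend (x : X) (v w : TangentSpace (𝓡 d) x) :
    VectorField.mlieBracket (𝓡 d) (FiberBundle.extend (EuclideanSpace ℝ (Fin d)) v)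
      (FiberBundle.extend (EuclideanSpace ℝ (Fin d)) w) x = 0 := by
  have : IsManifold (𝓡 d) 1 X := IsManifold.of_le (n := ∞) (by simp)
  have key : ∀ u : TangentSpace (𝓡 d) x, VectorField.mpullbackWithin 𝓘(ℝ, EuclideanSpace ℝ (Fin d))
      (𝓡 d) (extChartAt (𝓡 d) x).symm (FiberBundle.extend (EuclideanSpace ℝ (Fin d)) u)
      (range (𝓡 d)) =ᶠ[𝓝 (extChartAt (𝓡 d) x x)]
      fun _ => (u : EuclideanSpace ℝ (Fin d)) := fun u => by
    filter_upwards [extChartAt_target_mem_nhds (I := 𝓡 d) x] with z hz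
    rw [VectorField.mpullbackWithin_apply, extend_tangent_apply ((extChartAt (𝓡 d) x).map_target hz),
      (extChartAt (𝓡 d) x).right_inv hz]
    exact (isInvertible_mfderivWithin_extChartAt_symm hz).inverse_apply_self _
  rw [← VectorField.mlieBracketWithin_univ, VectorField.mlieBracketWithin_apply]
  have h0 : VectorField.lieBracketWithin ℝ
      (VectorField.mpullbackWithin 𝓘(ℝ, EuclideanSpace ℝ (Fin d)) (𝓡 d) (extChartAt (𝓡 d) x).symm
        (FiberBundle.extend (EuclideanSpace ℝ (Fin d)) v) (range (𝓡 d)))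
      (VectorField.mpullbackWithin 𝓘(ℝ, EuclideanSpace ℝ (Fin d)) (𝓡 d) (extChartAt (𝓡 d) x).symm
        (FiberBundle.extend (EuclideanSpace ℝ (Fin d)) w) (range (𝓡 d)))
      ((extChartAt (𝓡 d) x).symm ⁻¹' univ ∩ range (𝓡 d)) (extChartAt (𝓡 d) x x) = 0 := by
    have hs : (extChartAt (𝓡 d) x).symm ⁻¹' univ ∩ range (𝓡 d) = univ := by simp
    rw [hs]
    exact lieBracketWithin_univ_eq_zero (key v) (key w)
  rw [h0]
  exact map_zero _

variable {G : Type*} [NormedAddCommGroup G] [NormedSpace ℝ G] {f : X → G}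

lemma mvfderiv_extend_symm (hf : ContMDiff (𝓡 d) 𝓘(ℝ, G) ∞ f) {x : X}
    {z : EuclideanSpace ℝ (Fin d)} (hz : z ∈ (extChartAt (𝓡 d) x).target)
    (w : TangentSpace (𝓡 d) x) :
    mvfderiv (𝓡 d) f ((extChartAt (𝓡 d) x).symm z)
        (FiberBundle.extend (EuclideanSpace ℝ (Fin d)) w ((extChartAt (𝓡 d) x).symm z)) =
      fderiv ℝ (f ∘ (extChartAt (𝓡 d) x).symm) z w := by
  have : IsManifold (𝓡 d) 1 X := IsManifold.of_le (n := ∞) (by simp)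
  rw [extend_tangent_apply ((extChartAt (𝓡 d) x).map_target hz), (extChartAt (𝓡 d) x).right_inv hz]
  have h1 := ((hf ((extChartAt (𝓡 d) x).symm z)).mdifferentiableAt (by simp)).hasMFDerivAt
  have h2 := (mdifferentiableWithinAt_extChartAt_symm (I := 𝓡 d) hz).hasMFDerivWithinAt
  have h3 := h1.comp_hasMFDerivWithinAt z h2
  have hs : range (𝓡 d) = (univ : Set (EuclideanSpace ℝ (Fin d))) := by simp
  let L : EuclideanSpace ℝ (Fin d) →L[ℝ] G :=
    (mfderiv (𝓡 d) 𝓘(ℝ, G) f ((extChartAt (𝓡 d) x).symm z)).comp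
      (mfderivWithin 𝓘(ℝ, EuclideanSpace ℝ (Fin d)) (𝓡 d) (extChartAt (𝓡 d) x).symm (range (𝓡 d)) z)
  have h4 : HasFDerivWithinAt (f ∘ (extChartAt (𝓡 d) x).symm) L (range (𝓡 d)) z :=
    hasMFDerivWithinAt_iff_hasFDerivWithinAt.1 h3
  rw [hs, hasFDerivWithinAt_univ] at h4
  exact (DFunLike.congr_fun h4.fderiv (w : EuclideanSpace ℝ (Fin d))).symm

lemma mvfderiv_extend (hf : ContMDiff (𝓡 d) 𝓘(ℝ, G) ∞ f) {x y : X}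
    (hy : y ∈ (extChartAt (𝓡 d) x).source) (w : TangentSpace (𝓡 d) x) :
    mvfderiv (𝓡 d) f y (FiberBundle.extend (EuclideanSpace ℝ (Fin d)) w y) =
      fderiv ℝ (f ∘ (extChartAt (𝓡 d) x).symm) (extChartAt (𝓡 d) x y) w := by
  have h := mvfderiv_extend_symm hf ((extChartAt (𝓡 d) x).map_source hy) w
  rwa [(extChartAt (𝓡 d) x).left_inv hy] at h

/-- Iterated derivatives along coordinate fields are second derivatives in the chart, where symmetry
is available. -/
lemma mdifferentiableAt_mvfderiv_extend (hf : ContMDiff (𝓡 d) 𝓘(ℝ, G) ∞ f) (x : X)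
    (v w : TangentSpace (𝓡 d) x) :
    MDifferentiableAt (𝓡 d) 𝓘(ℝ, G) (fun y => mvfderiv (𝓡 d) f y
      (FiberBundle.extend (EuclideanSpace ℝ (Fin d)) w y)) x ∧
    mvfderiv (𝓡 d) (fun y => mvfderiv (𝓡 d) f y
      (FiberBundle.extend (EuclideanSpace ℝ (Fin d)) w y)) x v =
    fderiv ℝ (fderiv ℝ (f ∘ (extChartAt (𝓡 d) x).symm)) (extChartAt (𝓡 d) x x) v w := by
  have hg : ContDiffOn ℝ ∞ (f ∘ (extChartAt (𝓡 d) x).symm) (extChartAt (𝓡 d) x).target :=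
    (hf.comp_contMDiffOn (contMDiffOn_extChartAt_symm x)).contDiffOn
  have hgx := hg.contDiffAt (extChartAt_target_mem_nhds (I := 𝓡 d) x)
  have hg' : DifferentiableAt ℝ (fderiv ℝ (f ∘ (extChartAt (𝓡 d) x).symm)) (extChartAt (𝓡 d) x x) :=
    (hgx.fderiv_right (m := 1) (le_of_eq_of_le one_add_one_eq_two two_le_infty)).differentiableAt (by simp)
  have h1 := (hg'.hasFDerivAt.clm_apply (hasFDerivAt_const (w : EuclideanSpace ℝ (Fin d)) _))
  have h2 := h1.hasMFDerivAt.comp x (mdifferentiableAt_extChartAt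
    (I := 𝓡 d) (mem_chart_source _ x)).hasMFDerivAt
  have h3 : HasMFDerivAt (𝓡 d) 𝓘(ℝ, G) (fun y => mvfderiv (𝓡 d) f y
      (FiberBundle.extend (EuclideanSpace ℝ (Fin d)) w y)) x _ := h2.congr_of_eventuallyEq (by
    filter_upwards [extChartAt_source_mem_nhds (I := 𝓡 d) x] with y hy
    exact mvfderiv_extend hf hy w)
  refine ⟨h3.mdifferentiableAt, (DFunLike.congr_fun h3.mfderiv v).trans ?_⟩
  rw [mfderiv_extChartAt_self]
  exact (congrArg₂ (· + ·) (map_zero (fderiv ℝ (f ∘ (extChartAt (𝓡 d) x).symm)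
    (extChartAt (𝓡 d) x x))) rfl).trans (zero_add _)

/-- The second derivatives along coordinate vector fields commute. -/
lemma mvfderiv_mvfderiv_extend_comm (hf : ContMDiff (𝓡 d) 𝓘(ℝ, G) ∞ f) (x : X)
    (v w : TangentSpace (𝓡 d) x) :
    mvfderiv (𝓡 d) (fun y => mvfderiv (𝓡 d) f y
      (FiberBundle.extend (EuclideanSpace ℝ (Fin d)) w y)) x v =
    mvfderiv (𝓡 d) (fun y => mvfderiv (𝓡 d) f y
      (FiberBundle.extend (EuclideanSpace ℝ (Fin d)) v y)) x w := by
  have hg : ContDiffOn ℝ ∞ (f ∘ (extChartAt (𝓡 d) x).symm) (extChartAt (𝓡 d) x).target :=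
    (hf.comp_contMDiffOn (contMDiffOn_extChartAt_symm x)).contDiffOn
  have hgx := hg.contDiffAt (extChartAt_target_mem_nhds (I := 𝓡 d) x)
  rw [(mdifferentiableAt_mvfderiv_extend hf x v w).2, (mdifferentiableAt_mvfderiv_extend hf x w v).2]
  exact (hgx.isSymmSndFDerivAt (by simpa using two_le_infty)).eq v w

end Coordinates


/-! ### The connection of a projection field on the product bundle -/

section Twist
variable {d : ℕ} {X : Type*} [TopologicalSpace X] [ChartedSpace (EuclideanSpace ℝ (Fin d)) X]
  [IsManifold (𝓡 d) ∞ X]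

lemma mvfderiv_clm_apply {G E : Type*} [NormedAddCommGroup G] [NormedSpace ℝ G]
    [NormedAddCommGroup E] [NormedSpace ℝ E] {L : X → G →L[ℝ] E} {g : X → G} {x : X}
    (hL : MDifferentiableAt (𝓡 d) 𝓘(ℝ, G →L[ℝ] E) L x) (hg : MDifferentiableAt (𝓡 d) 𝓘(ℝ, G) g x)
    (v : TangentSpace (𝓡 d) x) :
    mvfderiv (𝓡 d) (fun y => L y (g y)) x v =
      mvfderiv (𝓡 d) L x v (g x) + L x (mvfderiv (𝓡 d) g x v) := by
  have key : HasMFDerivAt (𝓡 d) 𝓘(ℝ, E) (fun y => L y (g y)) x _ :=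
    ⟨hL.continuousAt.clm_apply hg.continuousAt, hL.hasMFDerivAt.2.clm_apply hg.hasMFDerivAt.2⟩
  refine (DFunLike.congr_fun key.mfderiv v).trans ?_
  rw [add_comm]
  simp [mvfderiv]
  rfl

/-! ### Derivatives of a projection field and its reflection -/

namespace IsProjectionField
variable {N r : ℕ} {P : X → EuclideanSpace ℝ (Fin N) →L[ℝ] EuclideanSpace ℝ (Fin N)}

lemma mdifferentiableAt (hP : IsProjectionField d P r) (x : X) :
    MDifferentiableAt (𝓡 d) 𝓘(ℝ, EuclideanSpace ℝ (Fin N) →L[ℝ] EuclideanSpace ℝ (Fin N)) P x :=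
  (hP.smooth x).mdifferentiableAt (by simp)

lemma mvfderiv_apply (hP : IsProjectionField d P r) (x : X) (v : TangentSpace (𝓡 d) x)
    (y : EuclideanSpace ℝ (Fin N)) :
    mvfderiv (𝓡 d) (fun z => P z y) x v = mvfderiv (𝓡 d) P x v y := by
  rw [mvfderiv_clm_apply (hP.mdifferentiableAt x) mdifferentiableAt_const, mvfderiv_const]
  simp

/-- Differentiate `P² = P`. -/
lemma mvfderiv_idem (hP : IsProjectionField d P r) (x : X) (v : TangentSpace (𝓡 d) x)
    (y : EuclideanSpace ℝ (Fin N)) :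
    mvfderiv (𝓡 d) P x v (P x y) + P x (mvfderiv (𝓡 d) P x v y) = mvfderiv (𝓡 d) P x v y := by
  have hy : MDifferentiableAt (𝓡 d) 𝓘(ℝ, EuclideanSpace ℝ (Fin N)) (fun z => P z y) x :=
    ((hP.smooth.clm_apply contMDiff_const) x).mdifferentiableAt (n := ∞) (by simp)
  have h := mvfderiv_clm_apply (hP.mdifferentiableAt x) hy v
  simp only [hP.idem, hP.mvfderiv_apply] at h
  exact h.symm

lemma mvfderiv_symm (hP : IsProjectionField d P r) (x : X) (v : TangentSpace (𝓡 d) x)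
    (y z : EuclideanSpace ℝ (Fin N)) :
    inner ℝ (mvfderiv (𝓡 d) P x v y) z = inner ℝ y (mvfderiv (𝓡 d) P x v z) := by
  have hy : ∀ y, MDifferentiableAt (𝓡 d) 𝓘(ℝ, EuclideanSpace ℝ (Fin N)) (fun z => P z y) x :=
    fun y => ((hP.smooth.clm_apply contMDiff_const) x).mdifferentiableAt (n := ∞) (by simp)
  have h1 := mvfderiv_inner_apply (hy y) (mdifferentiableAt_const (c := z)) v
  have h2 := mvfderiv_inner_apply (mdifferentiableAt_const (c := y)) (hy z) v
  simp only [hP.mvfderiv_apply, mvfderiv_const, zero_apply, inner_zero_right, inner_zero_left,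
    add_zero, zero_add] at h1 h2
  rw [← h1, ← h2]
  simp only [hP.symm]

variable (P) in
/-- The reflection which is `1` on the range and `-1` on the kernel of the projection. -/
def reflection (x : X) : EuclideanSpace ℝ (Fin N) →L[ℝ] EuclideanSpace ℝ (Fin N) :=
  (2 : ℝ) • P x - 1

lemma reflection_apply (x : X) (y : EuclideanSpace ℝ (Fin N)) :
    reflection P x y = (2 : ℝ) • P x y - y := rfl

lemma reflection_reflection (hP : IsProjectionField d P r) (x : X) (y : EuclideanSpace ℝ (Fin N)) :
    reflection P x (reflection P x y) = y := by
  simp only [reflection_apply, map_sub, map_smul, hP.idem]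
  module

lemma reflection_symm (hP : IsProjectionField d P r) (x : X) (y z : EuclideanSpace ℝ (Fin N)) :
    inner ℝ (reflection P x y) z = inner ℝ y (reflection P x z) := by
  simp [reflection_apply, inner_sub_left, inner_sub_right, inner_smul_left, inner_smul_right, hP.symm]

/-- For `ε = 2 P - 1` the relation `dP P + P dP = dP` says exactly that `dP ε = -ε dP`: the form
`dP` exchanges range and kernel of `P`. The vanishing of the Chern–Simons form rests on this sign.
-/
lemma mvfderiv_reflection_comm (hP : IsProjectionField d P r) (x : X) (v : TangentSpace (𝓡 d) x)
    (y : EuclideanSpace ℝ (Fin N)) :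
    mvfderiv (𝓡 d) P x v (reflection P x y) = -reflection P x (mvfderiv (𝓡 d) P x v y) := by
  have h := hP.mvfderiv_idem x v y
  simp only [reflection_apply, map_sub, map_smul]
  rw [← sub_eq_zero]
  calc _ = (2 : ℝ) • (mvfderiv (𝓡 d) P x v (P x y) + P x (mvfderiv (𝓡 d) P x v y)) -
        (2 : ℝ) • mvfderiv (𝓡 d) P x v y := by module
    _ = 0 := by rw [h, sub_self]

lemma contMDiff_reflection (hP : IsProjectionField d P r) : ContMDiff (𝓡 d)
    𝓘(ℝ, EuclideanSpace ℝ (Fin N) →L[ℝ] EuclideanSpace ℝ (Fin N)) ∞ (reflection P) :=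
  ((contMDiff_const (c := (2 : ℝ))).smul (I := 𝓘(ℝ, ℝ)) hP.smooth).sub contMDiff_const

lemma mvfderiv_reflection (hP : IsProjectionField d P r) (x : X) (v : TangentSpace (𝓡 d) x) :
    mvfderiv (𝓡 d) (reflection P) x v = (2 : ℝ) • mvfderiv (𝓡 d) P x v := by
  have h := mvfderiv_fun_sub (I := 𝓡 d) (x := x) (g := fun y => (2 : ℝ) • P y) (g' := fun _ => 1)
    (mdifferentiableAt_const.smul (hP.mdifferentiableAt x)) mdifferentiableAt_const
  rw [mvfderiv_fun_smul mdifferentiableAt_const (hP.mdifferentiableAt x), mvfderiv_const,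
    mvfderiv_const] at h
  refine (DFunLike.congr_fun h v).trans ?_
  simp

end IsProjectionField

/-- Smoothness of a one-form composed from a differential. -/
lemma contMDiffWithinAt_clm_comp_mvfderiv {E' H' M G E : Type*}
    [NormedAddCommGroup E'] [NormedSpace ℝ E'] [TopologicalSpace H'] {I' : ModelWithCorners ℝ E' H'}
    [TopologicalSpace M] [ChartedSpace H' M] [NormedAddCommGroup G] [NormedSpace ℝ G]
    [NormedAddCommGroup E] [NormedSpace ℝ E] {f : X → G} (hf : ContMDiff (𝓡 d) 𝓘(ℝ, G) ∞ f)
    {b : M → X} {L : M → G →L[ℝ] E} {U : Set M} {m : M}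
    (hb : ContMDiffWithinAt I' (𝓡 d) ∞ b U m)
    (hL : ContMDiffWithinAt I' 𝓘(ℝ, G →L[ℝ] E) ∞ L U m) :
    ContMDiffWithinAt I' ((𝓡 d).prod 𝓘(ℝ, EuclideanSpace ℝ (Fin d) →L[ℝ] E)) ∞
      (fun m => TotalSpace.mk' (EuclideanSpace ℝ (Fin d) →L[ℝ] E)
        (E := fun y : X => TangentSpace (𝓡 d) y →L[ℝ] Bundle.Trivial X E y) (b m)
        ((L m).comp (mvfderiv (𝓡 d) f (b m)))) U m := by
  have h1 := (contMDiffAt_mvfderiv_section (hf (b m))).comp_contMDiffWithinAt m hb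
  have h2 := (contMDiffWithinAt_hom_bundle _).1 h1
  refine (contMDiffWithinAt_hom_bundle _).2 ⟨hb, ?_⟩
  refine (hL.clm_comp h2.2).congr (fun y _ => ?_) ?_
  · ext z
    simp [ContinuousLinearMap.inCoordinates]
  · ext z
    simp [ContinuousLinearMap.inCoordinates]

set_option synthInstance.maxHeartbeats 200000 in
/-- Smoothness of `ds + c ε dP(s)`. -/
lemma contMDiffWithinAt_mvfderiv_add_smul {E E' H' M : Type*} [NormedAddCommGroup E]
    [NormedSpace ℝ E] [NormedAddCommGroup E'] [NormedSpace ℝ E'] [TopologicalSpace H']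
    {I' : ModelWithCorners ℝ E' H'} [TopologicalSpace M] [ChartedSpace H' M] {s : X → E}
    {ε P : X → E →L[ℝ] E} (hs : ContMDiff (𝓡 d) 𝓘(ℝ, E) ∞ s)
    (hε : ContMDiff (𝓡 d) 𝓘(ℝ, E →L[ℝ] E) ∞ ε) (hP : ContMDiff (𝓡 d) 𝓘(ℝ, E →L[ℝ] E) ∞ P)
    {b : M → X} {c : M → ℝ} {U : Set M} {m : M} (hb : ContMDiffWithinAt I' (𝓡 d) ∞ b U m)
    (hc : ContMDiffWithinAt I' 𝓘(ℝ) ∞ c U m) :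
    ContMDiffWithinAt I' ((𝓡 d).prod 𝓘(ℝ, EuclideanSpace ℝ (Fin d) →L[ℝ] E)) ∞
      (fun m => TotalSpace.mk' (EuclideanSpace ℝ (Fin d) →L[ℝ] E)
        (E := fun y : X => TangentSpace (𝓡 d) y →L[ℝ] Bundle.Trivial X E y) (b m)
        (mvfderiv (𝓡 d) s (b m) + c m • (ε (b m)).comp ((ContinuousLinearMap.apply ℝ E (s (b m))).comp
          (mvfderiv (𝓡 d) P (b m))))) U m := by
  -- Both `ds` and `dP` are components of the differential of `(s, P)`, so the whole one-form is a
  -- single smooth linear map applied to one differential.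
  let L : M → (E × (E →L[ℝ] E)) →L[ℝ] E := fun m => ContinuousLinearMap.fst ℝ _ _ +
    c m • (ε (b m)).comp ((ContinuousLinearMap.apply ℝ E (s (b m))).comp
      (ContinuousLinearMap.snd ℝ _ _))
  have hL : ContMDiffWithinAt I' 𝓘(ℝ, (E × (E →L[ℝ] E)) →L[ℝ] E) ∞ L U m := by
    have h1 := (hε (b m)).comp_contMDiffWithinAt m hb
    have h2 := (hs (b m)).comp_contMDiffWithinAt m hb
    have hA : ContDiff ℝ ∞ (ContinuousLinearMap.apply ℝ E : E → (E →L[ℝ] E) →L[ℝ] E) := by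
      apply ContinuousLinearMap.contDiff
    have h3 : ContMDiffWithinAt I' 𝓘(ℝ, (E →L[ℝ] E) →L[ℝ] E) ∞
        (fun m => ContinuousLinearMap.apply ℝ E (s (b m))) U m :=
      hA.contDiffAt.contMDiffAt.comp_contMDiffWithinAt m h2
    exact contMDiffWithinAt_const.add
      (hc.smul (I := 𝓘(ℝ, ℝ)) (h1.clm_comp (h3.clm_comp contMDiffWithinAt_const)))
  have key : ∀ y, (L y).comp (mvfderiv (𝓡 d) (fun x => (s x, P x)) (b y)) =
      mvfderiv (𝓡 d) s (b y) + c y • (ε (b y)).comp ((ContinuousLinearMap.apply ℝ E (s (b y))).comp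
          (mvfderiv (𝓡 d) P (b y))) := fun y => by
    have h1 := ((hs (b y)).mdifferentiableAt (n := ∞) (by simp)).hasMFDerivAt
    have h2 := ((hP (b y)).mdifferentiableAt (n := ∞) (by simp)).hasMFDerivAt
    have h : HasMFDerivAt (𝓡 d) 𝓘(ℝ, E × (E →L[ℝ] E)) (fun x => (s x, P x)) (b y) _ :=
      ⟨h1.1.prodMk h2.1, h1.2.prodMk h2.2⟩
    ext1 v
    exact congrArg (L y) (DFunLike.congr_fun h.mfderiv v)
  simp only [← key]
  exact contMDiffWithinAt_clm_comp_mvfderiv (hs.prodMk_space hP) hb hL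

open IsProjectionField

variable {N r : ℕ} {P : X → EuclideanSpace ℝ (Fin N) →L[ℝ] EuclideanSpace ℝ (Fin N)}

variable (d P) in
/-- The one-form `ε dP = [P, dP]`, where `ε = 2 P - 1`. -/
def twistForm (x : X) (u : EuclideanSpace ℝ (Fin N)) :
    TangentSpace (𝓡 d) x →L[ℝ] EuclideanSpace ℝ (Fin N) :=
  (reflection P x).comp ((ContinuousLinearMap.apply ℝ (EuclideanSpace ℝ (Fin N)) u).comp
    (mvfderiv (𝓡 d) P x))

lemma twistForm_apply (x : X) (u : EuclideanSpace ℝ (Fin N)) (v : TangentSpace (𝓡 d) x) :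
    twistForm d P x u v = reflection P x (mvfderiv (𝓡 d) P x v u) := rfl

/-- `ε` and `dP` are symmetric and anticommute, so their product is skew; hence `d + c ε dP` is
metric. -/
lemma twistForm_skew (hP : IsProjectionField d P r) (x : X) (u u' : EuclideanSpace ℝ (Fin N))
    (v : TangentSpace (𝓡 d) x) :
    inner ℝ (twistForm d P x u v) u' = -inner ℝ u (twistForm d P x u' v) := by
  rw [twistForm_apply, twistForm_apply, hP.reflection_symm, hP.mvfderiv_symm,
    hP.mvfderiv_reflection_comm, inner_neg_right]

variable (d P) in
/-- The covariant derivative `d + c ε dP`. -/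
def twistCov (c : ℝ) (s : X → EuclideanSpace ℝ (Fin N)) (x : X) :
    TangentSpace (𝓡 d) x →L[ℝ] EuclideanSpace ℝ (Fin N) :=
  mvfderiv (𝓡 d) s x + c • twistForm d P x (s x)

lemma twistCov_apply (c : ℝ) (s : X → EuclideanSpace ℝ (Fin N)) (x : X)
    (v : TangentSpace (𝓡 d) x) : twistCov d P c s x v =
      mvfderiv (𝓡 d) s x v + c • reflection P x (mvfderiv (𝓡 d) P x v (s x)) := rfl

lemma twistCov_add (c : ℝ) {s s' : X → EuclideanSpace ℝ (Fin N)} {x : X}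
    (hs : MDifferentiableAt (𝓡 d) 𝓘(ℝ, EuclideanSpace ℝ (Fin N)) s x)
    (hs' : MDifferentiableAt (𝓡 d) 𝓘(ℝ, EuclideanSpace ℝ (Fin N)) s' x) :
    twistCov d P c (s + s') x = twistCov d P c s x + twistCov d P c s' x := by
  ext1 v
  rw [add_apply, twistCov_apply, twistCov_apply, twistCov_apply, mvfderiv_add hs hs', Pi.add_apply,
    map_add, map_add, add_apply]
  module

lemma twistCov_smul (c : ℝ) {g : X → ℝ} {s : X → EuclideanSpace ℝ (Fin N)} {x : X}
    (hs : MDifferentiableAt (𝓡 d) 𝓘(ℝ, EuclideanSpace ℝ (Fin N)) s x)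
    (hg : MDifferentiableAt (𝓡 d) 𝓘(ℝ) g x) :
    twistCov d P c (g • s) x = g x • twistCov d P c s x + (mvfderiv (𝓡 d) g x).smulRight (s x) := by
  ext1 v
  rw [add_apply, smul_apply, twistCov_apply, twistCov_apply, mvfderiv_smul hg hs, Pi.smul_apply',
    map_smul, map_smul, add_apply, smul_apply]
  module

lemma twistCov_metric (hP : IsProjectionField d P r) (c : ℝ) {s t : X → EuclideanSpace ℝ (Fin N)}
    {x : X} (hs : MDifferentiableAt (𝓡 d) 𝓘(ℝ, EuclideanSpace ℝ (Fin N)) s x)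
    (ht : MDifferentiableAt (𝓡 d) 𝓘(ℝ, EuclideanSpace ℝ (Fin N)) t x) (v : TangentSpace (𝓡 d) x) :
    mvfderiv (𝓡 d) (fun y => inner ℝ (s y) (t y)) x v =
      inner ℝ (twistCov d P c s x v) (t x) + inner ℝ (s x) (twistCov d P c t x v) := by
  have h := twistForm_skew hP x (s x) (t x) v
  rw [twistForm_apply, twistForm_apply] at h
  rw [mvfderiv_inner_apply hs ht v, twistCov_apply, twistCov_apply, inner_add_left, inner_add_right,
    real_inner_smul_left, real_inner_smul_right, h]
  ring

/-- Smooth dependence of `d + c ε dP` on all data. -/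
lemma contMDiffWithinAt_twistCov (hP : IsProjectionField d P r) {E' H' M : Type*}
    [NormedAddCommGroup E'] [NormedSpace ℝ E'] [TopologicalSpace H'] {I' : ModelWithCorners ℝ E' H'}
    [TopologicalSpace M] [ChartedSpace H' M] {b : M → X} {c : M → ℝ}
    {s : X → EuclideanSpace ℝ (Fin N)} (hs : ContMDiff (𝓡 d) 𝓘(ℝ, EuclideanSpace ℝ (Fin N)) ∞ s)
    {U : Set M} {m : M} (hb : ContMDiffWithinAt I' (𝓡 d) ∞ b U m)
    (hc : ContMDiffWithinAt I' 𝓘(ℝ) ∞ c U m) :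
    ContMDiffWithinAt I' ((𝓡 d).prod 𝓘(ℝ, EuclideanSpace ℝ (Fin d) →L[ℝ] EuclideanSpace ℝ (Fin N)))
      ∞ (fun m => TotalSpace.mk' (EuclideanSpace ℝ (Fin d) →L[ℝ] EuclideanSpace ℝ (Fin N))
        (E := fun y : X => TangentSpace (𝓡 d) y →L[ℝ] Bundle.Trivial X (EuclideanSpace ℝ (Fin N)) y)
        (b m) (twistCov d P (c m) s (b m))) U m := by
  exact contMDiffWithinAt_mvfderiv_add_smul hs hP.contMDiff_reflection hP.smooth hb hc

/-- The connection `d + c [P, dP] = d + c ε dP` on the product bundle, where `ε = 2 P - 1`. -/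
def MetricConnection.twist (hP : IsProjectionField d P r) (c : ℝ) :
    MetricConnection (EuclideanBundle.trivial d X N) where
  cov :=
    { toFun := fun s x => twistCov d P c s x
      isCovariantDerivativeOnUniv :=
        { add := fun {s s' x} hs hs' _ =>
            twistCov_add c ((mdifferentiableAt_totalSpace _ _).1 hs).2
              ((mdifferentiableAt_totalSpace _ _).1 hs').2
          leibniz := fun {s g x} hs hg _ =>
            twistCov_smul c ((mdifferentiableAt_totalSpace _ _).1 hs).2 hg } }
  smooth := ⟨⟨fun {s} hs => contMDiffOn_univ.2 fun x => by
    have h : ContMDiff (𝓡 d) 𝓘(ℝ, EuclideanSpace ℝ (Fin N)) ∞ (s : X → EuclideanSpace ℝ (Fin N)) :=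
      fun x => (contMDiffAt_totalSpace.1 ((contMDiffOn_univ.1 hs) x)).2
    exact contMDiffWithinAt_twistCov hP h (b := fun x => x) (c := fun _ => c) contMDiffWithinAt_id
      contMDiffWithinAt_const⟩⟩
  metric := fun x s t hs ht v => by
    have h := ((mdifferentiableAt_totalSpace _ _).1 hs).2
    have h' := ((mdifferentiableAt_totalSpace _ _).1 ht).2
    exact twistCov_metric hP c h h' v

end Twist


/-! ### The path of connections contracting a projection field -/

section TwistPath
variable {d : ℕ} {X : Type*} [TopologicalSpace X] [ChartedSpace (EuclideanSpace ℝ (Fin d)) X]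
  [IsManifold (𝓡 d) ∞ X] {N r : ℕ}
  {P : X → EuclideanSpace ℝ (Fin N) →L[ℝ] EuclideanSpace ℝ (Fin N)}

open IsProjectionField

lemma twistCov_const (c : ℝ) (u : EuclideanSpace ℝ (Fin N)) (x : X) (v : TangentSpace (𝓡 d) x) :
    twistCov d P c (fun _ => u) x v = c • reflection P x (mvfderiv (𝓡 d) P x v u) := by
  rw [twistCov_apply, mvfderiv_const]
  simp

lemma extend_tangent_self (x : X) (w : TangentSpace (𝓡 d) x) :
    FiberBundle.extend (EuclideanSpace ℝ (Fin d)) w x = w := by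
  simp [FiberBundle.extend_apply_self]

/-- Since `dε = 2 dP`, differentiating `ε` contributes `2 c dP dP`. The quadratic term is `c² ε dP ε
dP = -c² dP dP`. The remaining term contains a second derivative of `P` and will cancel in the
curvature. -/
lemma twistCov_twistCov_const (hP : IsProjectionField d P r) (c : ℝ) (u : EuclideanSpace ℝ (Fin N))
    (x : X) (v w : TangentSpace (𝓡 d) x) :
    twistCov d P c (fun y => twistCov d P c (fun _ => u) y
      (FiberBundle.extend (EuclideanSpace ℝ (Fin d)) w y)) x v =
    (2 * c - c ^ 2) • mvfderiv (𝓡 d) P x v (mvfderiv (𝓡 d) P x w u) +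
      c • reflection P x (mvfderiv (𝓡 d) (fun y => mvfderiv (𝓡 d) P y
        (FiberBundle.extend (EuclideanSpace ℝ (Fin d)) w y)) x v u) := by
  have hg := (mdifferentiableAt_mvfderiv_extend hP.smooth x v w).1
  have hgu : MDifferentiableAt (𝓡 d) 𝓘(ℝ, EuclideanSpace ℝ (Fin N)) (fun y => mvfderiv (𝓡 d) P y
      (FiberBundle.extend (EuclideanSpace ℝ (Fin d)) w y) u) x :=
    hg.clm_apply mdifferentiableAt_const
  have hε := ((hP.contMDiff_reflection) x).mdifferentiableAt (n := ∞) (by simp)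
  have h1 : mvfderiv (𝓡 d) (fun y => mvfderiv (𝓡 d) P y
      (FiberBundle.extend (EuclideanSpace ℝ (Fin d)) w y) u) x v = mvfderiv (𝓡 d) (fun y =>
      mvfderiv (𝓡 d) P y (FiberBundle.extend (EuclideanSpace ℝ (Fin d)) w y)) x v u := by
    rw [mvfderiv_clm_apply hg mdifferentiableAt_const, mvfderiv_const]
    simp
  have h2 := mvfderiv_clm_apply hε hgu v
  rw [h1, hP.mvfderiv_reflection, extend_tangent_self] at h2
  simp only [twistCov_const]
  rw [twistCov_apply, mvfderiv_fun_smul mdifferentiableAt_const (hε.clm_apply hgu), mvfderiv_const,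
    extend_tangent_self, map_smul, hP.mvfderiv_reflection_comm]
  simp only [add_apply, smul_apply, h2, map_smul, map_neg, hP.reflection_reflection]
  simp
  module

lemma extend_trivial (x : X) (u : EuclideanSpace ℝ (Fin N)) (y : X) :
    FiberBundle.extend (E := Bundle.Trivial X (EuclideanSpace ℝ (Fin N)))
      (EuclideanSpace ℝ (Fin N)) (x := x) u y = u := by
  simp [FiberBundle.extend]

variable [T2Space X]

/-- The curvature of `d + c ε dP` is `(2 c - c²) [dP, dP]`. -/
lemma MetricConnection.curvature_twist (hP : IsProjectionField d P r) (c : ℝ) (x : X)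
    (v w : TangentSpace (𝓡 d) x) (u : EuclideanSpace ℝ (Fin N)) :
    (MetricConnection.twist hP c).curvature x v w u = (2 * c - c ^ 2) •
      (mvfderiv (𝓡 d) P x v (mvfderiv (𝓡 d) P x w u) -
        mvfderiv (𝓡 d) P x w (mvfderiv (𝓡 d) P x v u)) := by
  have h1 := twistCov_twistCov_const hP c u x v w
  have h2 := twistCov_twistCov_const hP c u x w v
  -- By symmetry of second derivatives the last terms of `h1` and `h2` agree and cancel.
  rw [mvfderiv_mvfderiv_extend_comm hP.smooth x w v] at h2
  have he : FiberBundle.extend (E := Bundle.Trivial X (EuclideanSpace ℝ (Fin N)))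
      (EuclideanSpace ℝ (Fin N)) (x := x) u = fun _ => u := funext (extend_trivial x u)
  have h3 : (MetricConnection.twist hP c).curvature x v w u =
      twistCov d P c (fun y => twistCov d P c (fun _ => u) y
        (FiberBundle.extend (EuclideanSpace ℝ (Fin d)) w y)) x v -
      twistCov d P c (fun y => twistCov d P c (fun _ => u) y
        (FiberBundle.extend (EuclideanSpace ℝ (Fin d)) v y)) x w -
      twistCov d P c (fun _ => u) x (VectorField.mlieBracket (𝓡 d)
        (FiberBundle.extend (EuclideanSpace ℝ (Fin d)) v)
        (FiberBundle.extend (EuclideanSpace ℝ (Fin d)) w) x) := by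
    rw [← he]
    rfl
  refine h3.trans (Eq.trans (b := ((_ : EuclideanSpace ℝ (Fin N)))) ?_
    (smul_sub (2 * c - c ^ 2) (mvfderiv (𝓡 d) P x v (mvfderiv (𝓡 d) P x w u))
      (mvfderiv (𝓡 d) P x w (mvfderiv (𝓡 d) P x v u))).symm)
  rw [h1, h2, mlieBracket_extend, map_zero, sub_zero, add_sub_add_right_eq_sub]


/-- The curvature commutes with the reflection. -/
lemma MetricConnection.curvature_twist_reflection (hP : IsProjectionField d P r) (c : ℝ) (x : X)
    (v w : TangentSpace (𝓡 d) x) (u : EuclideanSpace ℝ (Fin N)) :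
    (MetricConnection.twist hP c).curvature x v w (reflection P x u) =
      reflection P x ((MetricConnection.twist hP c).curvature x v w u) := by
  have h : ∀ y : EuclideanSpace ℝ (Fin N), mvfderiv (𝓡 d) P x v (mvfderiv (𝓡 d) P x w
      (reflection P x y)) = reflection P x (mvfderiv (𝓡 d) P x v (mvfderiv (𝓡 d) P x w y)) ∧
      mvfderiv (𝓡 d) P x w (mvfderiv (𝓡 d) P x v (reflection P x y)) =
        reflection P x (mvfderiv (𝓡 d) P x w (mvfderiv (𝓡 d) P x v y)) := fun y => by
    simp only [hP.mvfderiv_reflection_comm, map_neg, neg_neg, and_self]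
  refine (curvature_twist hP c x v w _).trans (Eq.trans ?_
    (congrArg (reflection P x) (curvature_twist hP c x v w u)).symm)
  rw [(h u).1, (h u).2, ← map_sub]
  exact (map_smul (reflection P x) _ _).symm

lemma MetricConnection.ext_cov {B : EuclideanBundle d X} {D D' : MetricConnection B}
    (h : ∀ s x v, D.cov s x v = D'.cov s x v) : D = D' := by
  obtain ⟨⟨f, hf⟩, h1, h2⟩ := D
  obtain ⟨⟨f', hf'⟩, h1', h2'⟩ := D'
  have : f = f' := funext fun s => funext fun x => ContinuousLinearMap.ext fun v => h s x v
  subst this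
  rfl

lemma MetricConnection.twist_zero (hP : IsProjectionField d P r) :
    MetricConnection.twist hP 0 = MetricConnection.trivial d X N :=
  MetricConnection.ext_cov fun s x v => (twistCov_apply 0 s x v).trans (by rw [zero_smul, add_zero]; rfl)

lemma hasDerivWithinAt_twistCov (s : X → EuclideanSpace ℝ (Fin N)) (x : X)
    (v : TangentSpace (𝓡 d) x) {t : ℝ} {S : Set ℝ} :
    HasDerivWithinAt (fun τ : ℝ => twistCov d P (1 - τ) s x v)
      (-reflection P x (mvfderiv (𝓡 d) P x v (s x))) S t := by
  have h := (((hasDerivAt_id t).const_sub 1).smul_const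
    (reflection P x (mvfderiv (𝓡 d) P x v (s x)))).const_add (mvfderiv (𝓡 d) s x v)
  rw [neg_one_smul] at h
  exact h.hasDerivWithinAt

/-- The path `d + (1 - t) ε dP` from `d + ε dP` to the product connection. -/
def ConnectionPath.untwist (hP : IsProjectionField d P r) :
    ConnectionPath (MetricConnection.twist hP 1) (MetricConnection.trivial d X N) where
  conn t := MetricConnection.twist hP (1 - t)
  conn_zero := by rw [sub_zero]
  conn_one := by rw [sub_self, MetricConnection.twist_zero]
  smooth := fun s hs p _ => by
    have h : ContMDiff (𝓡 d) 𝓘(ℝ, EuclideanSpace ℝ (Fin N)) ∞ (s : X → EuclideanSpace ℝ (Fin N)) :=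
      fun x => (contMDiffAt_totalSpace.1 (hs x)).2
    exact contMDiffWithinAt_twistCov hP h (b := Prod.snd) (c := fun p : ℝ × X => 1 - p.1)
      contMDiffWithinAt_snd (contMDiffWithinAt_const.sub contMDiffWithinAt_fst)
  velocity _ x v := -((reflection P x).comp (mvfderiv (𝓡 d) P x v)).toLinearMap
  hasDerivWithinAt := fun t _ s _ x v => hasDerivWithinAt_twistCov s x v

/-- Moving `e` through the product passes exactly one anticommuting factor. -/
lemma list_prod_anticomm {R : Type*} [Ring R] {e : R} {m : ℕ} {f : Fin m → R} {j : Fin m}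
    (hj : e * f j = -(f j * e)) (h : ∀ i, i ≠ j → Commute e (f i)) :
    e * (List.ofFn f).prod = -((List.ofFn f).prod * e) := by
  induction m with
  | zero => exact j.elim0
  | succ m ih =>
    rw [List.ofFn_succ, List.prod_cons]
    induction j using Fin.cases with
    | zero =>
      have h1 : Commute e (List.ofFn fun i : Fin m => f i.succ).prod :=
        Commute.list_prod_right _ _ fun y hy => by
          obtain ⟨i, rfl⟩ := List.mem_ofFn.1 hy
          exact h _ (Fin.succ_ne_zero i)
      rw [← mul_assoc, hj, neg_mul, mul_assoc, h1.eq, mul_assoc]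
    | succ j =>
      have h1 := ih hj fun i hi => h _ fun h' => hi (Fin.succ_injective _ h')
      rw [← mul_assoc, (h 0 (Fin.succ_ne_zero j).symm).eq, mul_assoc, h1, mul_neg, mul_assoc]

/-- `tr A = tr (e e A) = -tr (e A e) = -tr A`. -/
lemma trace_eq_zero_of_anticomm {V : Type*} [AddCommGroup V] [Module ℝ V] {e A : Module.End ℝ V}
    (he : e * e = 1) (h : e * A = -(A * e)) : LinearMap.trace ℝ V A = 0 := by
  have h1 : LinearMap.trace ℝ V A = -LinearMap.trace ℝ V A := by
    conv_lhs => rw [← one_mul A, ← he, mul_assoc, h, mul_neg, map_neg, LinearMap.trace_mul_comm,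
      mul_assoc, he, mul_one]
  linarith

/-- If an involution anticommutes with the curvature in the direction `v i` and commutes with it in
all the other directions, the traces vanish. -/
lemma tracePow_eq_zero_of_anticomm {T V : Type*} [AddCommGroup V] [Module ℝ V]
    {m : ℕ} {B : T → T → Module.End ℝ V} {v : Fin (2 * m) → T} {i : Fin (2 * m)}
    {e : Module.End ℝ V} (he : e * e = 1) (h : ∀ a b, a ≠ i → b ≠ i → Commute e (B (v a) (v b)))
    (hl : ∀ b, b ≠ i → e * B (v i) (v b) = -(B (v i) (v b) * e))
    (hr : ∀ b, b ≠ i → e * B (v b) (v i) = -(B (v b) (v i) * e)) : tracePow m B v = 0 := by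
  unfold tracePow
  refine mul_eq_zero_of_right _ (Finset.sum_eq_zero fun σ _ => mul_eq_zero_of_right _ ?_)
  -- The special vector occupies exactly one slot `j` of the permuted tuple, so only the factor
  -- number `j / 2` anticommutes with `e`; the parity of `j` tells on which side it stands.
  obtain ⟨j, rfl⟩ := σ.surjective i
  have hne : ∀ k : Fin (2 * m), (k : ℕ) ≠ j → σ k ≠ σ j := fun k hk h =>
    hk (congrArg Fin.val (σ.injective h))
  refine trace_eq_zero_of_anticomm he (list_prod_anticomm (j := ⟨j / 2, by omega⟩) ?_ fun k hk => ?_)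
  · rcases Nat.even_or_odd' (j : ℕ) with ⟨q, hq | hq⟩
    · have : (⟨2 * ((j : ℕ) / 2), by omega⟩ : Fin (2 * m)) = j := Fin.ext (by simp; omega)
      simp only [this]
      exact hl _ (hne _ (by simp; omega))
    · have : (⟨2 * ((j : ℕ) / 2) + 1, by omega⟩ : Fin (2 * m)) = j := Fin.ext (by simp; omega)
      simp only [this]
      exact hr _ (hne _ (by simp; omega))
  · have hk' : (k : ℕ) ≠ j / 2 := fun h' => hk (Fin.ext h')
    exact h _ _ (hne _ (by simp; omega)) (hne _ (by simp; omega))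

lemma isExactForm_zero (n : ℕ) :
    IsExactForm (d := d) (X := X) (n := n) fun _ _ => 0 := by
  have h : ∀ c : X, formInChart (fun x : X => (0 : TangentSpace (𝓡 d) x [⋀^Fin n]→L[ℝ] ℝ)) c = 0 :=
    fun c => rfl
  refine ⟨fun _ => 0, fun c => ?_, fun c y _ v => ?_⟩
  · rw [h c]
    exact contDiffOn_const
  · rw [h c]
    rw [extDeriv, fderiv_zero]
    change ContinuousAlternatingMap.alternatizeUncurryFin 0 v = 0
    simp [ContinuousAlternatingMap.alternatizeUncurryFin_apply]

lemma reflection_twist (hP : IsProjectionField d P r) (x : X) (w : TangentSpace (𝓡 d) x)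
    (u : EuclideanSpace ℝ (Fin N)) :
    reflection P x (-reflection P x (mvfderiv (𝓡 d) P x w u)) =
      - -reflection P x (mvfderiv (𝓡 d) P x w (reflection P x u)) := by
  rw [hP.mvfderiv_reflection_comm, map_neg, neg_neg]

/-- The integrand vanishes for every `t`. The factor containing `∂_t` is, up to sign, the velocity
`-ε dP`, which anticommutes with `ε`; all others are curvatures of the connections on `X`, which
commute with it. -/
lemma ConnectionPath.csForm_untwist (hP : IsProjectionField d P r) (k : ℕ) :
    (ConnectionPath.untwist hP).csForm k = fun _ _ => 0 := by
  funext x v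
  let e : Module.End ℝ ((EuclideanBundle.trivial d X N).V x) := (reflection P x).toLinearMap
  have key : ∀ t, tracePow (2 * (k + 1)) ((ConnectionPath.untwist hP).totalCurvature t x)
      (Fin.cons (1, 0) fun i => (0, v i)) = 0 := fun t => by
    have hvel : ∀ w : TangentSpace (𝓡 d) x, e * (ConnectionPath.untwist hP).velocity t x w =
        -((ConnectionPath.untwist hP).velocity t x w * e) := fun w => LinearMap.ext fun u => by
      exact reflection_twist hP x w u
    have hcurv : ∀ w w' : TangentSpace (𝓡 d) x,
        Commute e (((ConnectionPath.untwist hP).conn t).curvature x w w') := fun w w' =>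
      LinearMap.ext fun u => (MetricConnection.curvature_twist_reflection hP (1 - t) x w w' u).symm
    have h0 : ∀ b : Fin (2 * (2 * (k + 1))), b ≠ 0 → ∃ w : TangentSpace (𝓡 d) x,
        (Fin.cons (1, 0) fun i => (0, v i) : Fin (2 * (2 * (k + 1))) → ℝ × TangentSpace (𝓡 d) x) b =
          (0, w) := fun b hb => by
      obtain ⟨b, rfl⟩ := Fin.exists_succ_eq.2 hb
      exact ⟨v b, rfl⟩
    have h1 : ∀ w, (ConnectionPath.untwist hP).totalCurvature t x (1, 0) (0, w) =
        (ConnectionPath.untwist hP).velocity t x w := fun w => by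
      simp [totalCurvature, MetricConnection.curvature_zero_left]
    have h2 : ∀ w, (ConnectionPath.untwist hP).totalCurvature t x (0, w) (1, 0) =
        -(ConnectionPath.untwist hP).velocity t x w := fun w => by
      simp [totalCurvature, MetricConnection.curvature_zero_right]
    have h3 : ∀ w w', (ConnectionPath.untwist hP).totalCurvature t x (0, w) (0, w') =
        ((ConnectionPath.untwist hP).conn t).curvature x w w' := fun w w' => by
      simp [totalCurvature]
    refine tracePow_eq_zero_of_anticomm (e := e) (i := 0)
      (LinearMap.ext fun u => hP.reflection_reflection x u) ?_ ?_ ?_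
    · intro a b ha hb
      obtain ⟨w, hw⟩ := h0 a ha
      obtain ⟨w', hw'⟩ := h0 b hb
      rw [hw, hw', h3]
      exact hcurv w w'
    · intro b hb
      obtain ⟨w, hw⟩ := h0 b hb
      rw [hw, Fin.cons_zero, h1, hvel]
    · intro b hb
      obtain ⟨w, hw⟩ := h0 b hb
      rw [hw, Fin.cons_zero, h2, mul_neg, hvel, neg_mul]
  have h : ∀ t, phForm (k + 1) ((ConnectionPath.untwist hP).totalCurvature t x)
      (Fin.cons (1, 0) fun i => (0, v i)) = 0 := fun t => mul_eq_zero_of_right _ (key t)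
  exact (intervalIntegral.integral_congr fun t _ => h t).trans intervalIntegral.integral_zero

/-- `d + [P, dP]` is Chern-Simons equivalent to the product connection. -/
lemma CSEquiv.twist_trivial (hP : IsProjectionField d P r) :
    CSEquiv (MetricConnection.twist hP 1) (MetricConnection.trivial d X N) :=
  ⟨ConnectionPath.untwist hP, fun k => by
    rw [ConnectionPath.csForm_untwist]
    exact isExactForm_zero _⟩

end TwistPath


/-! ### The connection of a Parseval frame -/

section FrameConnection
variable {d : ℕ} {X : Type*} [TopologicalSpace X] [ChartedSpace (EuclideanSpace ℝ (Fin d)) X]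
  [IsManifold (𝓡 d) ∞ X] {B : EuclideanBundle d X}

set_option synthInstance.maxHeartbeats 200000 in
/-- Smoothness of `df ⊗ s` for a smooth function `f` and a smooth section `s`. -/
lemma contMDiff_mvfderiv_smulRight {f : X → ℝ} (hf : ContMDiff (𝓡 d) 𝓘(ℝ) ∞ f)
    {s : (x : X) → B.V x} (hs : B.SmoothSection s) :
    ContMDiff (𝓡 d) ((𝓡 d).prod 𝓘(ℝ, EuclideanSpace ℝ (Fin d) →L[ℝ] B.F)) ∞
      (fun y => TotalSpace.mk' (EuclideanSpace ℝ (Fin d) →L[ℝ] B.F)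
        (E := fun y : X => TangentSpace (𝓡 d) y →L[ℝ] B.V y) y
        ((mvfderiv (𝓡 d) f y).smulRight (s y))) := by
  intro x
  have h1 := (contMDiffAt_hom_bundle _).1 (contMDiffAt_mvfderiv_section (hf x))
  have h2 := (contMDiffAt_totalSpace.1 (hs x)).2
  refine (contMDiffAt_hom_bundle _).2 ⟨contMDiffAt_id, ?_⟩
  have h3 := ((contMDiffAt_const (c := ContinuousLinearMap.smulRightL ℝ
    (EuclideanSpace ℝ (Fin d)) B.F)).clm_apply h1.2).clm_apply h2
  refine h3.congr_of_eventuallyEq ?_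
  filter_upwards [(trivializationAt B.F B.V x).open_baseSet.mem_nhds
    (FiberBundle.mem_baseSet_trivializationAt' x)] with y hy
  refine ContinuousLinearMap.ext fun z => ?_
  simp [ContinuousLinearMap.inCoordinates, Trivialization.coe_linearMapAt_of_mem, hy]

variable {N : ℕ}

/-- The connection `∇ u = ∑ d⟨sᵢ, u⟩ sᵢ`, the orthogonal projection of the product connection to the
bundle embedded by the Parseval frame `s`. -/
def EuclideanBundle.IsParsevalFrame.connection {s : Fin N → (x : X) → B.V x}
    (hs : B.IsParsevalFrame s) : MetricConnection B where
  cov :=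
    { toFun := fun u x => ∑ i, (mvfderiv (𝓡 d) (fun y => B.metric.inner y (s i y) (u y)) x).smulRight
        (s i x)
      isCovariantDerivativeOnUniv :=
        { add := fun {u u' x} hu hu' _ => by
            have h : ∀ i, mvfderiv (𝓡 d) (fun y => B.metric.inner y (s i y) ((u + u') y)) x =
                mvfderiv (𝓡 d) (fun y => B.metric.inner y (s i y) (u y)) x +
                mvfderiv (𝓡 d) (fun y => B.metric.inner y (s i y) (u' y)) x := fun i => by
              simp only [Pi.add_apply, map_add]
              exact mvfderiv_fun_add (B.mdifferentiableAt_inner ((hs.smooth i).mdifferentiableAt x) hu)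
                (B.mdifferentiableAt_inner ((hs.smooth i).mdifferentiableAt x) hu')
            ext v
            simp only [h, add_apply, sum_apply, ContinuousLinearMap.smulRight_apply, add_smul,
              Finset.sum_add_distrib]
          leibniz := fun {u g x} hu hg _ => by
            have h : ∀ i, mvfderiv (𝓡 d) (fun y => B.metric.inner y (s i y) ((g • u) y)) x =
                g x • mvfderiv (𝓡 d) (fun y => B.metric.inner y (s i y) (u y)) x +
                B.metric.inner x (s i x) (u x) • mvfderiv (𝓡 d) g x := fun i => by
              simp only [Pi.smul_apply', map_smul, smul_eq_mul]
              exact mvfderiv_fun_mul hg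
                (B.mdifferentiableAt_inner ((hs.smooth i).mdifferentiableAt x) hu)
            ext v
            conv_rhs => rw [← hs.sum_smul x (u x)]
            simp only [h, add_apply, sum_apply, smul_apply, ContinuousLinearMap.smulRight_apply,
              add_smul, Finset.sum_add_distrib, Finset.smul_sum, smul_smul, smul_eq_mul, mul_comm] } }
  smooth := ⟨⟨fun {u} hu => by
    have hu' : B.SmoothSection u := contMDiffOn_univ.1 hu
    refine contMDiffOn_univ.2 ?_
    have h := ContMDiff.sum_section (s := Finset.univ) fun i _ =>
      contMDiff_mvfderiv_smulRight (B.contMDiff_inner (hs.smooth i) hu') (hs.smooth i)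
    simpa only [Finset.sum_apply] using h⟩⟩
  metric := fun x u t hu ht v => by
    have hu' := fun i => B.mdifferentiableAt_inner ((hs.smooth i).mdifferentiableAt x) hu
    have ht' := fun i => B.mdifferentiableAt_inner ((hs.smooth i).mdifferentiableAt x) ht
    have h1 : (fun y => B.metric.inner y (u y) (t y)) = fun y => ∑ i,
        B.metric.inner y (s i y) (u y) * B.metric.inner y (s i y) (t y) := by
      funext y
      rw [hs.sum_inner]
    rw [h1, mvfderiv_fun_sum _ (f := fun i y => B.metric.inner y (s i y) (u y) *
      B.metric.inner y (s i y) (t y)) fun i _ => (hu' i).mul (ht' i)]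
    have h2 : ∀ i, mvfderiv (𝓡 d) (fun y => B.metric.inner y (s i y) (u y) *
        B.metric.inner y (s i y) (t y)) x = _ := fun i => mvfderiv_fun_mul (hu' i) (ht' i)
    simp only [h2]
    simp only [sum_apply, ContinuousLinearMap.smulRight_apply, add_apply, smul_apply, smul_eq_mul,
      map_sum, map_smul, Finset.sum_add_distrib, B.metric.symm x (u x)]
    rw [add_comm]
    exact congrArg₂ (· + ·) (Finset.sum_congr rfl fun _ _ => mul_comm _ _)
      (Finset.sum_congr rfl fun _ _ => mul_comm _ _)

lemma EuclideanBundle.IsParsevalFrame.connection_apply {s : Fin N → (x : X) → B.V x}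
    (hs : B.IsParsevalFrame s) (u : (x : X) → B.V x) (x : X) (v : TangentSpace (𝓡 d) x) :
    hs.connection.cov u x v =
      ∑ i, mvfderiv (𝓡 d) (fun y => B.metric.inner y (s i y) (u y)) x v • s i x :=
  sum_apply Finset.univ (fun i => (mvfderiv (𝓡 d) (fun y => B.metric.inner y (s i y) (u y)) x).smulRight
    (s i x)) v

/-- A metric connection is induced by every Parseval frame for which its defect vanishes. -/
lemma MetricConnection.cov_eq_of_defect {s : Fin N → (x : X) → B.V x} (hs : B.IsParsevalFrame s)
    {D : MetricConnection B} (hD : ∀ x v u u', ∑ i, D.defect (s i) x v u u' = 0)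
    {u : (x : X) → B.V x} (hu : B.SmoothSection u) (x : X) (v : TangentSpace (𝓡 d) x) :
    D.cov u x v = ∑ i, mvfderiv (𝓡 d) (fun y => B.metric.inner y (s i y) (u y)) x v • s i x := by
  -- In `d⟨s i, u⟩ = ⟨D (s i), u⟩ + ⟨s i, D u⟩` the first terms sum against `s i` to zero, as the
  -- defect vanishes; the second ones reproduce `D u`.
  have h : ∑ i, B.metric.inner x (D.cov (s i) x v) (u x) • s i x = 0 := B.ext_inner fun z => by
    simpa [defect] using hD x v (u x) z
  simp only [D.metric x _ _ ((hs.smooth _).mdifferentiableAt x) (hu.mdifferentiableAt x), add_smul,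
    Finset.sum_add_distrib, hs.sum_smul, h, zero_add]

/-- The coordinates of a vector with respect to a frame. -/
def EuclideanBundle.frameCoord (B : EuclideanBundle d X) (s : Fin N → (x : X) → B.V x) (x : X) :
    B.V x →ₗ[ℝ] EuclideanSpace ℝ (Fin N) where
  toFun u := WithLp.toLp 2 fun i => B.metric.inner x (s i x) u
  map_add' u u' := PiLp.ext fun i => by simp
  map_smul' a u := PiLp.ext fun i => by simp

lemma EuclideanBundle.frameCoord_apply (s : Fin N → (x : X) → B.V x) (x : X) (u : B.V x)
    (i : Fin N) : B.frameCoord s x u i = B.metric.inner x (s i x) u := rfl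

lemma EuclideanBundle.frameProjection_eq (s : Fin N → (x : X) → B.V x) (x : X)
    (y : EuclideanSpace ℝ (Fin N)) :
    B.frameProjection s x y = B.frameCoord s x (∑ j, y j • s j x) :=
  PiLp.ext fun i => B.frameProjection_apply s x y i

lemma contMDiff_euclidean {H' M E' : Type*} [NormedAddCommGroup E'] [NormedSpace ℝ E']
    [TopologicalSpace H'] {I' : ModelWithCorners ℝ E' H'} [TopologicalSpace M] [ChartedSpace H' M]
    {f : M → EuclideanSpace ℝ (Fin N)} (hf : ∀ i, ContMDiff I' 𝓘(ℝ) ∞ fun x => f x i) :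
    ContMDiff I' 𝓘(ℝ, EuclideanSpace ℝ (Fin N)) ∞ f := by
  have h : f = fun x => ∑ i, f x i • EuclideanSpace.single i (1 : ℝ) := by
    funext x
    refine PiLp.ext fun j => ?_
    simp [Pi.single_apply]
  rw [h]
  exact contMDiff_finsetSum fun i _ => (hf i).smul (I := 𝓘(ℝ, ℝ)) contMDiff_const

lemma mvfderiv_euclidean_apply {f : X → EuclideanSpace ℝ (Fin N)} {x : X}
    (hf : MDifferentiableAt (𝓡 d) 𝓘(ℝ, EuclideanSpace ℝ (Fin N)) f x) (i : Fin N)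
    (v : TangentSpace (𝓡 d) x) :
    mvfderiv (𝓡 d) (fun y => f y i) x v = mvfderiv (𝓡 d) f x v i := by
  let L : EuclideanSpace ℝ (Fin N) →L[ℝ] ℝ := EuclideanSpace.proj i
  have h := mvfderiv_clm_apply (L := fun _ : X => L) mdifferentiableAt_const hf v
  rw [mvfderiv_const] at h
  refine h.trans ?_
  simp [L]

lemma EuclideanBundle.contMDiff_frameCoord {s : Fin N → (x : X) → B.V x}
    (hs : ∀ i, B.SmoothSection (s i)) : ContMDiff ((𝓡 d).prod 𝓘(ℝ, B.F))
      𝓘(ℝ, EuclideanSpace ℝ (Fin N)) ∞ (fun p : TotalSpace B.F B.V => B.frameCoord s p.1 p.2) :=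
  contMDiff_euclidean fun i => (B.isSmoothFunctional_inner (hs i)).contMDiff_totalSpace

/-- An orthonormal Parseval frame trivializes a bundle. -/
def EuclideanBundle.IsParsevalFrame.isometry {s : Fin N → (x : X) → B.V x}
    (hs : B.IsParsevalFrame s)
    (ho : ∀ x i j, B.metric.inner x (s i x) (s j x) = if i = j then 1 else 0) :
    BundleIsometry B (EuclideanBundle.trivial d X N) where
  toFun x := LinearEquiv.ofBijective (B.frameCoord s x) ⟨fun u u' h => by
      rw [← hs.sum_smul x u, ← hs.sum_smul x u']
      exact Finset.sum_congr rfl fun i _ =>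
        congrArg (fun y : EuclideanSpace ℝ (Fin N) => y i • s i x) h, fun y => by
      refine ⟨∑ j, (y : EuclideanSpace ℝ (Fin N)) j • s j x, PiLp.ext fun i => ?_⟩
      rw [frameCoord_apply]
      simp [ho]⟩
  isometry x u u' := by
    refine Eq.trans ?_ (hs.sum_inner x u u')
    change inner ℝ (B.frameCoord s x u) (B.frameCoord s x u') = _
    rw [PiLp.inner_apply]
    exact Finset.sum_congr rfl fun i _ => mul_comm (B.metric.inner x (s i x) u') _
  smooth := fun p => contMDiffAt_totalSpace.2
    ⟨contMDiffAt_proj B.V, B.contMDiff_frameCoord hs.smooth p⟩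

end FrameConnection


/-! ### Bundles with complementary frames -/

section Complement
variable {d : ℕ} {X : Type*} [TopologicalSpace X] [ChartedSpace (EuclideanSpace ℝ (Fin d)) X]
  [IsManifold (𝓡 d) ∞ X] {N r : ℕ}

/-- Differentiating `P a = a` gives `da = dP a + P da`, and `ε dP a = -dP ε a = -dP a` on the range
of `P`. Together with the next lemma, `d + ε dP` is the sum of the compressions of `d` to range and
kernel. -/
lemma twistCov_of_proj_eq {P : X → EuclideanSpace ℝ (Fin N) →L[ℝ] EuclideanSpace ℝ (Fin N)}
    (hP : IsProjectionField d P r) {a : X → EuclideanSpace ℝ (Fin N)} {x : X}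
    (ha : MDifferentiableAt (𝓡 d) 𝓘(ℝ, EuclideanSpace ℝ (Fin N)) a x) (h : ∀ y, P y (a y) = a y)
    (v : TangentSpace (𝓡 d) x) : twistCov d P 1 a x v = P x (mvfderiv (𝓡 d) a x v) := by
  have h1 := mvfderiv_clm_apply (hP.mdifferentiableAt x) ha v
  simp only [h] at h1
  have h2 := hP.mvfderiv_reflection_comm x v (a x)
  rw [IsProjectionField.reflection_apply, h, two_smul, add_sub_cancel_right] at h2
  rw [twistCov_apply, one_smul, ← neg_eq_iff_eq_neg.2 h2]
  exact (congrArg (· + -_) h1).trans (by abel)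

/-- Differentiating `P a = 0` gives `dP a = -P da`, and on the kernel `ε dP a = -dP ε a = dP a`. -/
lemma twistCov_of_proj_eq_zero {P : X → EuclideanSpace ℝ (Fin N) →L[ℝ] EuclideanSpace ℝ (Fin N)}
    (hP : IsProjectionField d P r) {a : X → EuclideanSpace ℝ (Fin N)} {x : X}
    (ha : MDifferentiableAt (𝓡 d) 𝓘(ℝ, EuclideanSpace ℝ (Fin N)) a x) (h : ∀ y, P y (a y) = 0)
    (v : TangentSpace (𝓡 d) x) :
    twistCov d P 1 a x v = mvfderiv (𝓡 d) a x v - P x (mvfderiv (𝓡 d) a x v) := by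
  have h1 := mvfderiv_clm_apply (hP.mdifferentiableAt x) ha v
  simp only [h] at h1
  rw [mvfderiv_const, zero_apply] at h1
  have h2 := hP.mvfderiv_reflection_comm x v (a x)
  rw [IsProjectionField.reflection_apply, h, smul_zero, zero_sub, map_neg, neg_inj] at h2
  rw [twistCov_apply, one_smul, ← h2, eq_neg_of_add_eq_zero_left h1.symm, sub_eq_add_neg]

variable {B : EuclideanBundle.{v} d X} {W : EuclideanBundle.{w} d X} {s : Fin N → (x : X) → B.V x}
  {t : Fin N → (x : X) → W.V x}

/-- The coordinate vector of `q` is fixed by the Gram matrix of `t`, hence killed by the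
complementary Gram matrix of `s`. So the sum has vanishing frame coordinates: the images of the two
bundles in `ℝᴺ` are orthogonal. -/
lemma EuclideanBundle.IsParsevalFrame.sum_smul_complement (hs : B.IsParsevalFrame s)
    (ht : W.IsParsevalFrame t)
    (h : ∀ x i j, W.metric.inner x (t i x) (t j x) =
      (if i = j then 1 else 0) - B.metric.inner x (s i x) (s j x)) (x : X) (q : W.V x) :
    ∑ j, W.metric.inner x (t j x) q • s j x = 0 := by
  have h1 : ∀ i, B.metric.inner x (s i x) (∑ j, W.metric.inner x (t j x) q • s j x) = 0 := fun i => by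
    have h2 := congrArg (W.metric.inner x (t i x)) (ht.sum_smul x q)
    simp only [map_sum, map_smul, h, smul_eq_mul, mul_sub, Finset.sum_sub_distrib, mul_ite, mul_one,
      mul_zero, Finset.sum_ite_eq, Finset.mem_univ, if_true] at h2
    simp only [map_sum, map_smul, smul_eq_mul]
    linarith
  rw [← hs.sum_smul x (∑ j, W.metric.inner x (t j x) q • s j x)]
  simp only [h1, zero_smul, Finset.sum_const_zero]

lemma EuclideanBundle.inner_sum (x : X) (p p' : B.V x) (q q' : W.V x) :
    (B.sum W).metric.inner x ((p, q) : B.V x × W.V x) ((p', q') : B.V x × W.V x) =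
      B.metric.inner x p p' + W.metric.inner x q q' := rfl

/-- Complementary Parseval frames give a Parseval frame of the direct sum. -/
lemma EuclideanBundle.IsParsevalFrame.sum (hs : B.IsParsevalFrame s)
    (ht : W.IsParsevalFrame t)
    (h : ∀ x i j, W.metric.inner x (t i x) (t j x) =
      (if i = j then 1 else 0) - B.metric.inner x (s i x) (s j x)) :
    (B.sum W).IsParsevalFrame fun i x => (s i x, t i x) where
  smooth i := fun x => (contMDiffWithinAt_prod_section B W (U := univ)).2 ⟨hs.smooth i x, ht.smooth i x⟩
  sum_inner := fun x ⟨p, q⟩ ⟨p', q'⟩ => by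
    have h1 : ∀ (p : B.V x) (q : W.V x),
        ∑ i, B.metric.inner x (s i x) p * W.metric.inner x (t i x) q = 0 := fun p q => by
      have := congrArg (B.metric.inner x p) (hs.sum_smul_complement ht h x q)
      rw [map_sum, map_zero] at this
      refine (Finset.sum_congr rfl fun i _ => ?_).trans this
      rw [map_smul, smul_eq_mul, B.metric.symm x p, mul_comm]
    simp only [inner_sum, add_mul, mul_add, Finset.sum_add_distrib, hs.sum_inner, ht.sum_inner, h1]
    have h2 := h1 p' q
    simp only [mul_comm] at h2 ⊢
    rw [h2]
    ring

lemma EuclideanBundle.SmoothSection.mdifferentiableAt_frameCoord (hs : ∀ i, B.SmoothSection (s i))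
    {u : (x : X) → B.V x} (hu : B.SmoothSection u) (x : X) :
    MDifferentiableAt (𝓡 d) 𝓘(ℝ, EuclideanSpace ℝ (Fin N)) (fun y => B.frameCoord s y (u y)) x :=
  (contMDiff_euclidean (fun i => B.contMDiff_inner (hs i) hu) x).mdifferentiableAt (n := ∞) (by simp)

lemma EuclideanBundle.mvfderiv_frameCoord_apply (hs : ∀ i, B.SmoothSection (s i))
    {u : (x : X) → B.V x} (hu : B.SmoothSection u) (x : X) (v : TangentSpace (𝓡 d) x) (i : Fin N) :
    mvfderiv (𝓡 d) (fun y => B.frameCoord s y (u y)) x v i =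
      mvfderiv (𝓡 d) (fun y => B.metric.inner y (s i y) (u y)) x v :=
  (mvfderiv_euclidean_apply (hu.mdifferentiableAt_frameCoord hs x) i v).symm

/-- `D` is the compression of `d` because the defect vanishes, and on the range of `P` this is what
`d + ε dP` is. -/
lemma twistCov_frameCoord (hs : B.IsParsevalFrame s) {D : MetricConnection B}
    (hD : ∀ x v u u', ∑ i, D.defect (s i) x v u u' = 0) {u : (x : X) → B.V x}
    (hu : B.SmoothSection u) (x : X) (v : TangentSpace (𝓡 d) x) :
    twistCov d (B.frameProjection s) 1 (fun y => B.frameCoord s y (u y)) x v =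
      B.frameCoord s x (D.cov u x v) := by
  rw [twistCov_of_proj_eq hs.isProjectionField (hu.mdifferentiableAt_frameCoord hs.smooth x)
    (fun y => (B.frameProjection_eq s y _).trans (congrArg _ (hs.sum_smul y (u y)))),
    B.frameProjection_eq, MetricConnection.cov_eq_of_defect hs hD hu]
  simp only [B.mvfderiv_frameCoord_apply hs.smooth hu]

lemma twistCov_frameCoord_complement (hs : B.IsParsevalFrame s) (ht : W.IsParsevalFrame t)
    (h : ∀ x i j, W.metric.inner x (t i x) (t j x) =
      (if i = j then 1 else 0) - B.metric.inner x (s i x) (s j x)) {u : (x : X) → W.V x}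
    (hu : W.SmoothSection u) (x : X) (v : TangentSpace (𝓡 d) x) :
    twistCov d (B.frameProjection s) 1 (fun y => W.frameCoord t y (u y)) x v =
      W.frameCoord t x (ht.connection.cov u x v) := by
  rw [twistCov_of_proj_eq_zero hs.isProjectionField (hu.mdifferentiableAt_frameCoord ht.smooth x)
    (fun y => (B.frameProjection_eq s y _).trans
      ((congrArg _ (hs.sum_smul_complement ht h y (u y))).trans (map_zero _))), ht.connection_apply]
  refine PiLp.ext fun i => ?_
  rw [PiLp.sub_apply, B.frameProjection_apply, W.frameCoord_apply]
  simp only [map_sum, map_smul, h, smul_eq_mul, mul_sub, Finset.sum_sub_distrib, mul_ite, mul_one,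
    mul_zero, Finset.sum_ite_eq, Finset.mem_univ, if_true, W.mvfderiv_frameCoord_apply ht.smooth hu]

/-- Frame coordinates of a pair are the sum of the coordinates of its components, so the identities
on range and kernel of `P` add up. -/
lemma isPullback_twist (hs : B.IsParsevalFrame s) (ht : W.IsParsevalFrame t)
    (h : ∀ x i j, W.metric.inner x (t i x) (t j x) =
      (if i = j then 1 else 0) - B.metric.inner x (s i x) (s j x)) {D : MetricConnection B}
    (hD : ∀ x v u u', ∑ i, D.defect (s i) x v u u' = 0)
    (ho : ∀ x i j, (B.sum W).metric.inner x ((s i x, t i x) : B.V x × W.V x)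
      ((s j x, t j x) : B.V x × W.V x) = if i = j then 1 else 0) :
    ((hs.sum ht h).isometry ho).IsPullback (MetricConnection.twist hs.isProjectionField 1)
      (D.sum ht.connection) := by
  intro u hu x v
  have h1 := smoothSection_fst hu
  have h2 := smoothSection_snd hu
  have e := DFunLike.congr_fun (twistCov_add (P := B.frameProjection s) 1
    (h1.mdifferentiableAt_frameCoord hs.smooth x) (h2.mdifferentiableAt_frameCoord ht.smooth x)) v
  rw [add_apply, twistCov_frameCoord hs hD h1, twistCov_frameCoord_complement hs ht h h2] at e
  exact e.symm

variable [T2Space X] [SecondCountableTopology X]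

/-- Every metric connection has a complement on a complementary bundle, such that the direct sum is
Chern-Simons equivalent to a product connection. -/
theorem MetricConnection.exists_complement (D : MetricConnection B) :
    ∃ (W : EuclideanBundle.{0} d X) (D' : MetricConnection W) (n : ℕ)
      (σ : BundleIsometry (B.sum W) (EuclideanBundle.trivial d X n))
      (D'' : MetricConnection (EuclideanBundle.trivial d X n)),
      CSEquiv D'' (MetricConnection.trivial d X n) ∧ σ.IsPullback D'' (D.sum D') := by
  obtain ⟨n, s, hs, hD⟩ := D.exists_isParsevalFrame
  obtain ⟨W, t, ht, h⟩ := hs.exists_complement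
  have ho : ∀ x i j, (B.sum W).metric.inner x ((s i x, t i x) : B.V x × W.V x)
      ((s j x, t j x) : B.V x × W.V x) = if i = j then 1 else 0 := fun x i j => by
    rw [EuclideanBundle.inner_sum, h, add_sub_cancel]
  exact ⟨W, ht.connection, n, (hs.sum ht h).isometry ho,
    MetricConnection.twist hs.isProjectionField 1, CSEquiv.twist_trivial hs.isProjectionField,
    isPullback_twist hs ht h hD ho⟩

end Complement

end

end StructKO

/-! ### Passage to Chern–Simons classes -/

theorem theorem2p6 (d : ℕ) (X : Type u) [TopologicalSpace X] [T2Space X]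
    [SecondCountableTopology X] [ChartedSpace (EuclideanSpace ℝ (Fin d)) X] [IsManifold (𝓡 d) ∞ X]
    (𝒱 : StructKO.StructuredBundle.{v} d X) :
    ∃ (𝒲 : StructKO.StructuredBundle.{0} d X) (n : ℕ),
      (𝒱.sum 𝒲).Iso (StructKO.StructuredBundle.trivial d X n) := by
  obtain ⟨B, cls⟩ := 𝒱
  obtain ⟨D, rfl⟩ := Quot.exists_rep cls
  obtain ⟨W, D', n, σ, D'', h, hσ⟩ := D.exists_complement
  -- The isometry identifies `D.sum D'` with `D''` exactly; Chern–Simons equivalence is needed only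
  -- to replace `D''` by the product connection.
  exact ⟨⟨W, Quot.mk _ D'⟩, n, σ, D.sum D', D'', rfl, Quot.sound h, hσ⟩
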